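/- All manifolds, tensors and connections are smooth, and manifolds are Hausdorff and second countable. A statistical manifold of constant curvature $c\in\mathbb R$ is a triple $(M,D,g)$ consisting of a manifold $M$, a torsion-free connection $D$ and a Riemannian metric $g$ such that $Dg$ is totally symmetric and the curvature of $D$ satisfies $\Theta_D(X,Y)Z=c\,(g(Y,Z)X-g(X,Z)Y)$. An automorphism of it is a diffeomorphism preserving $D$ and $g$. A Hessian manifold $(C,\nabla,g_C)$ is a manifold with a flat torsion-free connection $\nabla$ and a Riemannian metric $g_C$ such that $\nabla g_C$ is totally symmetric; it is of Koszul type if $g_C=\nabla\theta$ for a globally defined closed 1-form $\theta$. **Theorem.** Let $\varphi$ be an automorphism of a statistical manifold $(M,D,g)$ of constant curvature $c<0$, let $q\in\mathbb R^{>0}$, and let $C=(M\times\mathbb R^{>0})/\varphi_q$ be the quotient by the cyclic group generated by $\varphi_q(m,s)=(\varphi(m),qs)$. If $q\ne 1$, then $C$ is Hausdorff and second countable and has a smooth structure for which the projection $\pi:M\times\mathbb R^{>0}\to C$ is a local diffeomorphism. For every $q>0$ and every smooth structure on $C$ for which $\pi$ is a local diffeomorphism, the form $-2\,ds/s$ and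 the metric $g+ds^2/s^2$ descend to a 1-form $\theta$ and a Riemannian metric $h$ on $C$, and there is a connection $\nabla$ on $C$ such that 1. $(C,\nabla,h,\theta)$ is a radiant locally conformally Hessian manifold, that is: $\nabla$ is flat and torsion-free, $\theta$ is closed, $\nabla h-\theta\otimes h$ is totally symmetric, and the vector field $\xi$ with $h(\xi,\cdot)=\theta$ is Killing for $h$ and satisfies $\nabla\xi=-2\lambda\,\mathrm{Id}$, where $\lambda=1+\sqrt{1-c}$ is the positive solution of $\lambda(2-\lambda)=c$; 2. $\nabla\theta$ is a Riemannian metric and $(C,\nabla,\nabla\theta)$ is a Hessian manifold of Koszul type. -/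

import Mathlib

open scoped Manifold ContDiff

noncomputable section

section Connections

variable {E : Type*} [NormedAddCommGroup E] [NormedSpace ℝ E]
  {H : Type*} [TopologicalSpace H] {I : ModelWithCorners ℝ E H}
  {M : Type*} [TopologicalSpace M] [ChartedSpace H M]

/-- `X` is a smooth vector field on the set `U` (its values outside `U` are irrelevant). -/
def SmoothFieldOn [IsManifold I ∞ M] (X : Π x : M, TangentSpace I x) (U : Set M) : Prop :=
  ContMDiffOn I I.tangent ∞ (fun x => (⟨x, X x⟩ : TangentBundle I M)) U

/-- `θ` is a smooth 1-form, i.e. a smooth section of `Hom(TM, ℝ)`. -/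
def SmoothOneForm [IsManifold I ∞ M] (θ : Π x : M, TangentSpace I x →L[ℝ] ℝ) : Prop :=
  ContMDiff I (I.prod 𝓘(ℝ, E →L[ℝ] ℝ)) ∞
    (fun x => Bundle.TotalSpace.mk' (E →L[ℝ] ℝ)
      (E := fun x : M => TangentSpace I x →L[ℝ] Bundle.Trivial M ℝ x) x (θ x))

/-- The 1-form `θ` is closed: `dθ(X, Y) = X (θ Y) - Y (θ X) - θ [X, Y] = 0` for all local smooth
vector fields. -/
def IsClosedForm [IsManifold I ∞ M] (θ : Π x : M, TangentSpace I x →L[ℝ] ℝ) : Prop :=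
  ∀ (U : Set M), IsOpen U → ∀ X Y : Π x : M, TangentSpace I x,
    SmoothFieldOn X U → SmoothFieldOn Y U → ∀ x ∈ U,
      mvfderiv I (fun y => θ y (Y y)) x (X x) - mvfderiv I (fun y => θ y (X y)) x (Y x)
        - θ x (VectorField.mlieBracket I X Y x) = 0

/-- An affine connection on `M`: a covariant derivative on the tangent bundle. In Mathlib's
argument order, `D Y x (X x)` is `(D_X Y)(x)`. -/
abbrev AffineConnection (I : ModelWithCorners ℝ E H) (M : Type*) [TopologicalSpace M]
    [ChartedSpace H M] [IsManifold I ∞ M] :=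
  CovariantDerivative I E (fun x : M => TangentSpace I x)

/-- A smooth Riemannian metric on `M`. -/
abbrev RiemMetric (I : ModelWithCorners ℝ E H) (M : Type*) [TopologicalSpace M]
    [ChartedSpace H M] [IsManifold I ∞ M] :=
  Bundle.ContMDiffRiemannianMetric I ∞ E (fun x : M => TangentSpace I x)

variable [IsManifold I ∞ M]

/-- The curvature `Θ_D(X, Y) Z = D_X D_Y Z - D_Y D_X Z - D_{[X, Y]} Z`. -/
def curvature (D : AffineConnection I M) (X Y Z : Π x : M, TangentSpace I x) (x : M) :
    TangentSpace I x :=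
  D (fun y => D Z y (Y y)) x (X x) - D (fun y => D Z y (X y)) x (Y x)
    - D Z x (VectorField.mlieBracket I X Y x)

/-- The covariant derivative of a field `b` of bilinear forms:
`(D_X b)(Y, Z) = X (b(Y, Z)) - b(D_X Y, Z) - b(Y, D_X Z)`. -/
def covDerivBilin (D : AffineConnection I M)
    (b : Π x : M, TangentSpace I x →L[ℝ] TangentSpace I x →L[ℝ] ℝ)
    (X Y Z : Π x : M, TangentSpace I x) (x : M) : ℝ :=
  mvfderiv I (fun y => b y (Y y) (Z y)) x (X x)
    - b x (D Y x (X x)) (Z x) - b x (Y x) (D Z x (X x))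

/-- The covariant derivative of a 1-form: `(D θ)(X, Y) = (D_X θ)(Y) = X (θ Y) - θ (D_X Y)`. -/
def covDerivForm (D : AffineConnection I M) (θ : Π x : M, TangentSpace I x →L[ℝ] ℝ)
    (X Y : Π x : M, TangentSpace I x) (x : M) : ℝ :=
  mvfderiv I (fun y => θ y (Y y)) x (X x) - θ x (D Y x (X x))

/-- A ternary operation on vector fields is totally symmetric (invariant under the two
transpositions that generate the permutations of three arguments) on local smooth fields. -/
def TotallySymmetric
    (T : (Π x : M, TangentSpace I x) → (Π x : M, TangentSpace I x) →
      (Π x : M, TangentSpace I x) → M → ℝ) : Prop :=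
  ∀ (U : Set M), IsOpen U → ∀ X Y Z : Π x : M, TangentSpace I x,
    SmoothFieldOn X U → SmoothFieldOn Y U → SmoothFieldOn Z U → ∀ x ∈ U,
      T X Y Z x = T Y X Z x ∧ T X Y Z x = T X Z Y x

/-- The Riemannian metric `g` is invariant under the local flow of `ξ`, expressed as `L_ξ g = 0`. -/
def IsKillingField (g : RiemMetric I M) (ξ : Π x : M, TangentSpace I x) : Prop :=
  ∀ (U : Set M), IsOpen U → ∀ Y Z : Π x : M, TangentSpace I x,
    SmoothFieldOn Y U → SmoothFieldOn Z U → ∀ x ∈ U,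
      mvfderiv I (fun y => g.inner y (Y y) (Z y)) x (ξ x)
        - g.inner x (VectorField.mlieBracket I ξ Y x) (Z x)
        - g.inner x (Y x) (VectorField.mlieBracket I ξ Z x) = 0

variable [CompleteSpace E] [FiniteDimensional ℝ E]

/-- `(M, D, g)` is a statistical manifold: `D` is a smooth torsion-free connection, `g` is a
Riemannian metric and `D g` is totally symmetric. -/
structure IsStatistical (D : AffineConnection I M) (g : RiemMetric I M) : Prop where
  smooth : D.ContMDiffCovariantDerivative ∞
  torsion_eq_zero : D.torsion = 0
  symm : TotallySymmetric (covDerivBilin D g.inner)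

/-- `(M, D, g)` is a statistical manifold of constant curvature `c`:
`Θ_D(X, Y) Z = c (g(Y, Z) X - g(X, Z) Y)`. -/
structure IsStatisticalOfConstCurvature (D : AffineConnection I M) (g : RiemMetric I M)
    (c : ℝ) : Prop extends IsStatistical D g where
  curvature_eq : ∀ (U : Set M), IsOpen U → ∀ X Y Z : Π x : M, TangentSpace I x,
    SmoothFieldOn X U → SmoothFieldOn Y U → SmoothFieldOn Z U → ∀ x ∈ U,
      curvature D X Y Z x = c • (g.inner x (Y x) (Z x) • X x - g.inner x (X x) (Z x) • Y x)

/-- `φ` is an automorphism of `(M, D, g)`: a diffeomorphism preserving the metric and the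
connection. -/
structure IsStatisticalAut (D : AffineConnection I M) (g : RiemMetric I M)
    (φ : M ≃ₘ^∞⟮I, I⟯ M) : Prop where
  metric : ∀ (x : M) (v w : TangentSpace I x),
    g.inner (φ x) (mfderiv I I φ x v) (mfderiv I I φ x w) = g.inner x v w
  connection : ∀ (U : Set M), IsOpen U → ∀ Y : Π x : M, TangentSpace I x,
    SmoothFieldOn Y U → ∀ x : M, φ x ∈ U → ∀ v : TangentSpace I x,
      mfderiv I I φ x (D (VectorField.mpullback I I φ Y) x v) = D Y (φ x) (mfderiv I I φ x v)

/-- `(M, D)` is a flat affine manifold: `D` is a smooth flat torsion-free connection. -/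
structure IsFlatAffine (D : AffineConnection I M) : Prop where
  smooth : D.ContMDiffCovariantDerivative ∞
  torsion_eq_zero : D.torsion = 0
  flat : ∀ (U : Set M), IsOpen U → ∀ X Y Z : Π x : M, TangentSpace I x,
    SmoothFieldOn X U → SmoothFieldOn Y U → SmoothFieldOn Z U → ∀ x ∈ U,
      curvature D X Y Z x = 0

/-- `(M, D, g)` is a Hessian manifold: `(M, D)` is flat affine and `D g` is totally symmetric. -/
structure IsHessian (D : AffineConnection I M) (g : RiemMetric I M) : Prop
    extends IsFlatAffine D where
  symm : TotallySymmetric (covDerivBilin D g.inner)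

/-- The globally defined 1-form `θ` exhibits the Hessian manifold `(M, D, g)` as being of Koszul
type: `θ` is smooth and closed, and `g = D θ`. -/
structure IsKoszulHessian (D : AffineConnection I M) (g : RiemMetric I M)
    (θ : Π x : M, TangentSpace I x →L[ℝ] ℝ) : Prop extends IsHessian D g where
  smooth_form : SmoothOneForm θ
  closed : IsClosedForm θ
  metric_eq : ∀ (U : Set M), IsOpen U → ∀ X Y : Π x : M, TangentSpace I x,
    SmoothFieldOn X U → SmoothFieldOn Y U → ∀ x ∈ U,
      g.inner x (X x) (Y x) = covDerivForm D θ X Y x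

/-- `(M, D, g, θ)` is locally conformally Hessian with Lee form `θ`: `(M, D)` is flat affine, `θ`
is a closed 1-form and `D g - θ ⊗ g` is totally symmetric. -/
structure IsLCH (D : AffineConnection I M) (g : RiemMetric I M)
    (θ : Π x : M, TangentSpace I x →L[ℝ] ℝ) : Prop extends IsFlatAffine D where
  smooth_form : SmoothOneForm θ
  closed : IsClosedForm θ
  symm : TotallySymmetric
    (fun X Y Z x => covDerivBilin D g.inner X Y Z x - θ x (X x) * g.inner x (Y x) (Z x))

/-- `(M, D, g, θ)` is a radiant locally conformally Hessian manifold with Lee vector field `ξ`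
(the `g`-dual of `θ`) and constant `μ`: `ξ` is Killing and `D ξ = μ Id`. -/
structure IsRadiantLCH (D : AffineConnection I M) (g : RiemMetric I M)
    (θ : Π x : M, TangentSpace I x →L[ℝ] ℝ) (ξ : Π x : M, TangentSpace I x) (μ : ℝ) : Prop
    extends IsLCH D g θ where
  smooth_field : SmoothFieldOn ξ Set.univ
  lee : ∀ (x : M) (v : TangentSpace I x), g.inner x (ξ x) v = θ x v
  killing : IsKillingField g ξ
  radiant : ∀ (x : M) (v : TangentSpace I x), D ξ x v = μ • v

end Connections

section MappingTorus

/-- The half-line `ℝ^{>0}` as an open subset of `ℝ`, with the manifold structure this gives. -/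
def PosReal : TopologicalSpace.Opens ℝ := ⟨Set.Ioi 0, isOpen_Ioi⟩

/-- The map `φ_q(m, t) = (φ m, q t)` of `M × ℝ^{>0}`, as a bijection. -/
def conePerm {M : Type*} (φ : M ≃ M) (q : ℝ) (hq : 0 < q) : Equiv.Perm (M × PosReal) where
  toFun p := (φ p.1, ⟨q * (p.2 : ℝ), mul_pos hq p.2.2⟩)
  invFun p := (φ.symm p.1, ⟨q⁻¹ * (p.2 : ℝ), mul_pos (inv_pos.2 hq) p.2.2⟩)
  left_inv p := by
    refine Prod.ext (by simp) (Subtype.ext ?_)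
    simp [hq.ne']
  right_inv p := by
    refine Prod.ext (by simp) (Subtype.ext ?_)
    simp [hq.ne']

/-- The mapping torus `(M × ℝ^{>0}) / φ_q`: the space of orbits of the cyclic group generated by
`φ_q`, with the quotient topology. -/
abbrev MappingTorus {M : Type*} (φ : M ≃ M) (q : ℝ) (hq : 0 < q) : Type _ :=
  MulAction.orbitRel.Quotient (Subgroup.zpowers (conePerm φ q hq)) (M × PosReal)

/-- The projection of `M × ℝ^{>0}` onto the mapping torus. -/
def MappingTorus.proj {M : Type*} (φ : M ≃ M) (q : ℝ) (hq : 0 < q) (p : M × PosReal) :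
    MappingTorus φ q hq :=
  Quotient.mk _ p

variable {E : Type*} [NormedAddCommGroup E] [NormedSpace ℝ E]
  {H : Type*} [TopologicalSpace H] {I : ModelWithCorners ℝ E H}
  {M : Type*} [TopologicalSpace M] [ChartedSpace H M]

/-- The differential `ds` of the coordinate `s` on `M × ℝ^{>0}`. -/
def coneDs (I : ModelWithCorners ℝ E H) (p : M × PosReal) :
    TangentSpace (I.prod 𝓘(ℝ)) p →L[ℝ] ℝ :=
  mvfderiv (I.prod 𝓘(ℝ)) (fun p : M × PosReal => (p.2 : ℝ)) p

/-- The symmetric bilinear form `g + ds² / s²` on `M × ℝ^{>0}`. -/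
def cylMetric [IsManifold I ∞ M] (g : RiemMetric I M) (p : M × PosReal)
    (v w : TangentSpace (I.prod 𝓘(ℝ)) p) : ℝ :=
  g.inner p.1 (mfderiv (I.prod 𝓘(ℝ)) I Prod.fst p v) (mfderiv (I.prod 𝓘(ℝ)) I Prod.fst p w)
    + coneDs I p v * coneDs I p w / (p.2 : ℝ) ^ 2

end MappingTorus

end

/-! In the coordinate `t = log s` the cone `M × ℝ^{>0}` becomes the cylinder `M × ℝ`, the generator
`φ_q` becomes `(m, t) ↦ (φ m, t + log q)`, the form `-2 ds/s` becomes `-2 dt` and the metric `g +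
ds²/s²` becomes `g + dt²`. The geometry is therefore built on the cylinder from data independent of
`t`, and then pushed down.

For real `l`, `a` consider the connection (`cylConn`) determined by `∇_X Y = D_X Y + a g(X, Y) ∂_t`
for `X`, `Y` on `M`, and `∇_v ∂_t = l v` for all `v`. It is torsion-free, which forces `∇_{∂_t} W =
[∂_t, W] + l W`; this bracket expression serves as the definition for fields depending on `t`. Three
scalar conditions decide everything.

Flatness: the `M`-part of the curvature is `Θ_D(X, Y) Z + a l (g(Y, Z) X - g(X, Z) Y)`, zero when `c
+ a l = 0`. The `∂_t`-part is `a` times the failure of `D g` to be symmetric, hence zero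
(`curvature_cylConn`).

Conformal symmetry: `∇h - θ ⊗ h` for `h = g + dt²`, `θ = -2 dt` is totally symmetric when `a = l -
2`. With the flatness condition this reads `l (2 - l) = c`, so `l = 1 + √(1 - c)` and `a = √(1 - c)
- 1`. The Lee field `-2 ∂_t` is Killing because `h` does not depend on `t`, and its covariant
derivative is `-2 l Id`.

Positivity: `∇θ = 2 a g + 2 l dt²`, and `a > 0` exactly because `c < 0`. Its covariant derivative is
totally symmetric for all `l` and `a` (`covDerivBilin_cylConn_symm`, `isKoszulHessian_cylConn`,
`isRadiantLCH_cylConn`).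

All these structures are preserved by `(m, t) ↦ (φ m, t + s)` (`connRelated_cylMap`), so they do not
depend on the chosen point in a fibre of the projection and descend along any surjective local
diffeomorphism with those fibres (`exists_descended_structures`). This needs no condition on `q`.
The condition `q ≠ 1` is used only to build the quotient manifold: `log s` moves by multiples of
`log q ≠ 0`, so the action is properly discontinuous and the projection is injective on slabs of
height less than a period.

The identities in the definitions are quantified over arbitrary smooth local fields. They are
tensorial in the relevant arguments, so on the cylinder they are checked only on fields `V + r ∂_t`
with `V` on `M` and `r` constant. -/

noncomputable section AuxiliaryResults

open Bundle Set Filter Topology VectorField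

set_option linter.unusedSectionVars false

/-! ### Smoothness of fields of linear maps -/

section HomBundle

variable {EB HB B : Type*} [NormedAddCommGroup EB] [NormedSpace ℝ EB] [TopologicalSpace HB]
  {IB : ModelWithCorners ℝ EB HB} [TopologicalSpace B] [ChartedSpace HB B]
  {F₁ : Type*} [NormedAddCommGroup F₁] [NormedSpace ℝ F₁] [FiniteDimensional ℝ F₁]
  {F₂ : Type*} [NormedAddCommGroup F₂] [NormedSpace ℝ F₂]
  {E₁ : B → Type*} [TopologicalSpace (TotalSpace F₁ E₁)] [∀ x, AddCommGroup (E₁ x)]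
  [∀ x, Module ℝ (E₁ x)] [∀ x, TopologicalSpace (E₁ x)] [FiberBundle F₁ E₁] [VectorBundle ℝ F₁ E₁]
  {E₂ : B → Type*} [TopologicalSpace (TotalSpace F₂ E₂)] [∀ x, AddCommGroup (E₂ x)]
  [∀ x, Module ℝ (E₂ x)] [∀ x, TopologicalSpace (E₂ x)] [FiberBundle F₂ E₂] [VectorBundle ℝ F₂ E₂]
  [∀ x, IsTopologicalAddGroup (E₂ x)] [∀ x, ContinuousSMul ℝ (E₂ x)]

theorem contMDiffAt_clm_of_apply {n : ℕ∞ω} {f : B → F₁ →L[ℝ] F₂} {x : B}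
    (h : ∀ v, ContMDiffAt IB 𝓘(ℝ, F₂) n (fun y => f y v) x) :
    ContMDiffAt IB 𝓘(ℝ, F₁ →L[ℝ] F₂) n f x := by
  classical
  let b := Module.finBasis ℝ F₁
  -- In finite dimension a linear map is a sum of dual basis vectors tensored with its values on the
  -- basis, so finitely many values control smoothness.
  have key : f = fun y => ∑ i, ContinuousLinearMap.smulRightL ℝ F₁ F₂
      (LinearMap.toContinuousLinearMap (b.coord i)) (f y (b i)) := by
    funext y
    ext v
    conv_lhs => rw [← b.sum_repr v]
    simp [-Module.Basis.sum_repr]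
  rw [key]
  refine ContMDiffAt.sum fun i _ => ?_
  exact (ContinuousLinearMap.contMDiff _).contMDiffAt.comp x (h (b i))

/-- A field of linear maps between vector bundles is smooth as soon as it maps smooth local
sections to smooth ones. -/
theorem contMDiffAt_hom_of_apply {n : ℕ∞ω} [ContMDiffVectorBundle n F₁ E₁ IB]
    {ϕ : ∀ x, E₁ x →L[ℝ] E₂ x} {x : B}
    (h : ∀ U : Set B, IsOpen U → x ∈ U → ∀ σ : ∀ x, E₁ x,
      ContMDiffOn IB (IB.prod 𝓘(ℝ, F₁)) n (fun y => TotalSpace.mk' F₁ y (σ y)) U →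
      ContMDiffAt IB (IB.prod 𝓘(ℝ, F₂)) n (fun y => TotalSpace.mk' F₂ y (ϕ y (σ y))) x) :
    ContMDiffAt IB (IB.prod 𝓘(ℝ, F₁ →L[ℝ] F₂)) n
      (fun y => TotalSpace.mk' (F₁ →L[ℝ] F₂) (E := fun x => E₁ x →L[ℝ] E₂ x) y (ϕ y)) x := by
  rw [contMDiffAt_hom_bundle]
  refine ⟨contMDiffAt_id, contMDiffAt_clm_of_apply fun v => ?_⟩
  set e := trivializationAt F₁ E₁ x
  set e' := trivializationAt F₂ E₂ x
  -- The sections with constant coordinate `v` in the trivialization are enough: their images are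
  -- the columns of the coordinate expression of `ϕ`.
  have hσ : ContMDiffOn IB (IB.prod 𝓘(ℝ, F₁)) n
      (fun y => TotalSpace.mk' F₁ y (e.symm y v)) e.baseSet := by
    rw [e.contMDiffOn_section_baseSet_iff]
    refine (contMDiffOn_const (c := v)).congr fun y hy => ?_
    exact congrArg Prod.snd (e.apply_mk_symm hy v)
  have := h _ e.open_baseSet (mem_baseSet_trivializationAt F₁ E₁ x) _ hσ
  rw [contMDiffAt_totalSpace] at this
  refine this.2.congr_of_eventuallyEq ?_
  filter_upwards [e'.open_baseSet.mem_nhds (mem_baseSet_trivializationAt F₂ E₂ x),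
    e.open_baseSet.mem_nhds (mem_baseSet_trivializationAt F₁ E₁ x)] with y hy hy'
  simp [ContinuousLinearMap.inCoordinates, e, e', hy, Trivialization.symmL_apply _ hy']

end HomBundle

/-! ### Lie brackets as commutators of derivations -/

section Derivation

variable {E : Type*} [NormedAddCommGroup E] [NormedSpace ℝ E]
  {H : Type*} [TopologicalSpace H] {I : ModelWithCorners ℝ E H}
  {M : Type*} [TopologicalSpace M] [ChartedSpace H M] [IsManifold I ∞ M]
  {X Y Z : Π x : M, TangentSpace I x} {U : Set M} {x : M}

theorem SmoothFieldOn.contMDiffAt (h : SmoothFieldOn (I := I) X U) (hU : IsOpen U) (hx : x ∈ U) :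
    ContMDiffAt I I.tangent ∞ (fun x => (⟨x, X x⟩ : TangentBundle I M)) x :=
  ContMDiffOn.contMDiffAt h (hU.mem_nhds hx)

theorem SmoothFieldOn.mdifferentiableAt (h : SmoothFieldOn (I := I) X U) (hU : IsOpen U)
    (hx : x ∈ U) :
    MDifferentiableAt I I.tangent (fun x => (⟨x, X x⟩ : TangentBundle I M)) x :=
  (h.contMDiffAt hU hx).mdifferentiableAt (by simp)

theorem ContMDiffAt.mvfderiv_field {F : Type*} [NormedAddCommGroup F] [NormedSpace ℝ F]
    {f : M → F} (hf : ContMDiffAt I 𝓘(ℝ, F) ∞ f x)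
    (hX : ContMDiffAt I I.tangent ∞ (fun x => (⟨x, X x⟩ : TangentBundle I M)) x) :
    ContMDiffAt I 𝓘(ℝ, F) ∞ (fun y => mvfderiv I f y (X y)) x := by
  have h1 := hf.mfderiv_const (m := ∞) (by simp)
  have h2 := ContMDiffAt.clm_apply_of_inCoordinates (b₁ := fun y : M => y) (b₂ := f)
    (ϕ := fun y => mfderiv I 𝓘(ℝ, F) f y) h1 hX hf
  exact ((contMDiff_snd_tangentBundle_modelSpace F 𝓘(ℝ, F)).contMDiffAt).comp x h2

theorem SmoothFieldOn.smul {f : M → ℝ} (hf : ContMDiffOn I 𝓘(ℝ) ∞ f U)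
    (h : SmoothFieldOn (I := I) X U) : SmoothFieldOn (I := I) (f • X) U :=
  ContMDiffOn.smul_section hf h

theorem SmoothFieldOn.add 
    (h : SmoothFieldOn (I := I) X U) (h' : SmoothFieldOn (I := I) Y U) : SmoothFieldOn (I := I) (X + Y) U :=
  ContMDiffOn.add_section h h'

variable [CompleteSpace E]

/-- The bracket identities ask for class `minSmoothness ℝ n`, which over `ℝ` is just `n`. -/
instance : IsManifold I (minSmoothness ℝ 2) M := by
  rw [minSmoothness_of_isRCLikeNormedField]; infer_instance

instance : IsManifold I (minSmoothness ℝ 3) M := by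
  rw [minSmoothness_of_isRCLikeNormedField]; infer_instance

theorem SmoothFieldOn.mlieBracket (hU : IsOpen U) (h : SmoothFieldOn (I := I) X U)
    (h' : SmoothFieldOn (I := I) Y U) : SmoothFieldOn (I := I) (mlieBracket I X Y) U := by
  intro x hx
  have : IsManifold I (((⊤ : ℕ∞) : ℕ∞ω) + 1) M := by simpa using ‹IsManifold I ∞ M›
  refine (ContMDiffAt.mlieBracket_vectorField (m := ⊤) (n := ⊤) (h.contMDiffAt hU hx)
    (h'.contMDiffAt hU hx) ?_).contMDiffWithinAt
  simp

/-- Jacobi's identity for `X`, `Y` and `f • Z` contains `X (Y f) - Y (X f) = [X, Y] f`. -/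
theorem mvfderiv_mlieBracket_smul (hU : IsOpen U) (hx : x ∈ U) {f : M → ℝ}
    (hf : ContMDiffOn I 𝓘(ℝ) ∞ f U) (hX : SmoothFieldOn (I := I) X U)
    (hY : SmoothFieldOn (I := I) Y U) (hZ : SmoothFieldOn (I := I) Z U) :
    mvfderiv I f x (mlieBracket I X Y x) • Z x =
      (mvfderiv I (fun y => mvfderiv I f y (Y y)) x (X x) -
        mvfderiv I (fun y => mvfderiv I f y (X y)) x (Y x)) • Z x := by
  -- Two applications of the Leibniz rule. The two middle terms together are symmetric in `X` and
  -- `Y`, so they drop out of the Jacobi identity.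
  have key : ∀ {X Y : Π x : M, TangentSpace I x}, SmoothFieldOn (I := I) X U →
      SmoothFieldOn (I := I) Y U → mlieBracket I X (mlieBracket I Y (f • Z)) x =
        mvfderiv I (fun y => mvfderiv I f y (Y y)) x (X x) • Z x
        + mvfderiv I f x (Y x) • mlieBracket I X Z x
        + mvfderiv I f x (X x) • mlieBracket I Y Z x
        + f x • mlieBracket I X (mlieBracket I Y Z) x := by
    intro X Y hX hY
    have h1 : mlieBracket I Y (f • Z) =ᶠ[𝓝 x]
        (fun y => mvfderiv I f y (Y y)) • Z + f • mlieBracket I Y Z := by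
      filter_upwards [hU.mem_nhds hx] with y hy
      exact mlieBracket_smul_right ((hf.contMDiffAt (hU.mem_nhds hy)).mdifferentiableAt (by simp))
        (hZ.mdifferentiableAt hU hy)
    have hYf : ContMDiffOn I 𝓘(ℝ) ∞ (fun y => mvfderiv I f y (Y y)) U := fun y hy =>
      ((hf.contMDiffAt (hU.mem_nhds hy)).mvfderiv_field (hY.contMDiffAt hU hy)).contMDiffWithinAt
    have hYZ := hY.mlieBracket hU hZ
    have h2 : mlieBracket I X (mlieBracket I Y (f • Z)) x = mlieBracket I X
        ((fun y => mvfderiv I f y (Y y)) • Z + f • mlieBracket I Y Z) x :=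
      EventuallyEq.mlieBracket_vectorField_eq EventuallyEq.rfl h1
    rw [h2, mlieBracket_add_right ((hZ.smul hYf).mdifferentiableAt hU hx)
        ((hYZ.smul hf).mdifferentiableAt hU hx),
      mlieBracket_smul_right ((hYf.contMDiffAt (hU.mem_nhds hx)).mdifferentiableAt (by simp))
        (hZ.mdifferentiableAt hU hx),
      mlieBracket_smul_right ((hf.contMDiffAt (hU.mem_nhds hx)).mdifferentiableAt (by simp))
        (hYZ.mdifferentiableAt hU hx)]
    module
  have h2 : ∀ {X : Π x : M, TangentSpace I x}, SmoothFieldOn (I := I) X U →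
      ContMDiffAt I I.tangent (minSmoothness ℝ 2) (fun x => (⟨x, X x⟩ : TangentBundle I M)) x := by
    intro X hX
    rw [minSmoothness_of_isRCLikeNormedField]
    exact (hX.contMDiffAt hU hx).of_le (WithTop.coe_le_coe.2 (le_top : (2 : ℕ∞) ≤ ⊤))
  have j1 := leibniz_identity_mlieBracket_apply (h2 hX) (h2 hY) (h2 (hZ.smul hf))
  have j2 := leibniz_identity_mlieBracket_apply (h2 hX) (h2 hY) (h2 hZ)
  rw [key hX hY, key hY hX, mlieBracket_smul_right
    ((hf.contMDiffAt (hU.mem_nhds hx)).mdifferentiableAt (by simp)) (hZ.mdifferentiableAt hU hx),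
    j2] at j1
  rw [← sub_eq_zero] at j1 ⊢
  rw [← neg_eq_zero, ← j1]
  module

omit [CompleteSpace E] in
theorem exists_smoothFieldOn_eq [FiniteDimensional ℝ E] (v : TangentSpace I x) :
    ∃ (V : Set M) (Z : Π x : M, TangentSpace I x), IsOpen V ∧ x ∈ V ∧
      SmoothFieldOn (I := I) Z V ∧ Z x = v := by
  obtain ⟨s, hs, h⟩ := FiberBundle.exists_contMDiffOn_extend (k := ∞) I E (V := fun x : M => TangentSpace I x) v
  exact ⟨interior s, _, isOpen_interior, mem_interior_iff_mem_nhds.2 hs,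
    ContMDiffOn.mono h interior_subset, FiberBundle.extend_apply_self E v⟩

/-- A nonzero vector at `x` extends to a smooth local field `Z`, and the factor `Z x` in
`mvfderiv_mlieBracket_smul` can be cancelled. If the tangent space is zero, all the directions
involved vanish. -/
theorem mvfderiv_mlieBracket [FiniteDimensional ℝ E] (hU : IsOpen U) (hx : x ∈ U) {f : M → ℝ}
    (hf : ContMDiffOn I 𝓘(ℝ) ∞ f U) (hX : SmoothFieldOn (I := I) X U)
    (hY : SmoothFieldOn (I := I) Y U) :
    mvfderiv I f x (mlieBracket I X Y x) = mvfderiv I (fun y => mvfderiv I f y (Y y)) x (X x) -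
        mvfderiv I (fun y => mvfderiv I f y (X y)) x (Y x) := by
  by_cases h : ∀ v : TangentSpace I x, v = 0
  · rw [h (X x), h (Y x), h (mlieBracket I X Y x)]
    simp
  · push Not at h
    obtain ⟨v, hv⟩ := h
    obtain ⟨V, Z, hV, hxV, hZ, rfl⟩ := exists_smoothFieldOn_eq v
    exact smul_left_injective ℝ hv (mvfderiv_mlieBracket_smul (hU.inter hV) ⟨hx, hxV⟩
      (hf.mono inter_subset_left) (hX.mono inter_subset_left) (hY.mono inter_subset_left)
      (hZ.mono inter_subset_right))
end Derivation

/-! ### Tensoriality on smooth local fields, and smooth connections -/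

section Tensorial

variable {E : Type*} [NormedAddCommGroup E] [NormedSpace ℝ E]
  {H : Type*} [TopologicalSpace H] {I : ModelWithCorners ℝ E H}
  {M : Type*} [TopologicalSpace M] [ChartedSpace H M] [IsManifold I ∞ M]

/-- `T` is additive and linear over functions on vector fields that are smooth near `x`. -/
structure SmoothTensorialAt {A : Type*} [AddCommGroup A] [Module ℝ A]
    (T : (Π x : M, TangentSpace I x) → A) (x : M) : Prop where
  add : ∀ U : Set M, IsOpen U → x ∈ U → ∀ Y Z : Π x : M, TangentSpace I x,
    SmoothFieldOn Y U → SmoothFieldOn Z U → T (Y + Z) = T Y + T Z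
  smul : ∀ U : Set M, IsOpen U → x ∈ U → ∀ f : M → ℝ, ∀ Z : Π x : M, TangentSpace I x,
    ContMDiffOn I 𝓘(ℝ) ∞ f U → SmoothFieldOn Z U → T (f • Z) = f x • T Z

variable {X Y Z X' Y' Z' : Π x : M, TangentSpace I x} {U : Set M} {x : M}

namespace SmoothTensorialAt

variable {A : Type*} [AddCommGroup A] [Module ℝ A] {T : (Π x : M, TangentSpace I x) → A}

/-- The indicator of `U` is smooth on `U` with value 1 at `x`. Multiplying by it makes the two
fields equal everywhere without changing `T`; no bump function is needed, since smoothness is only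
asked on `U`. -/
theorem congr_on (h : SmoothTensorialAt T x) (hU : IsOpen U) (hx : x ∈ U)
    (hY : SmoothFieldOn Y U) (hZ : SmoothFieldOn Z U) (he : ∀ y ∈ U, Y y = Z y) : T Y = T Z := by
  classical
  let f : M → ℝ := U.indicator 1
  have hf : ContMDiffOn I 𝓘(ℝ) ∞ f U :=
    (contMDiffOn_const (c := (1 : ℝ))).congr fun y hy => by simp [f, hy]
  have e : f • Y = f • Z := by
    funext y
    by_cases hy : y ∈ U
    · simp [f, hy, he y hy]
    · simp [f, hy]
  have h1 := h.smul U hU hx f Y hf hY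
  have h2 := h.smul U hU hx f Z hf hZ
  have h3 : f x = 1 := by simp [f, hx]
  rw [h3, one_smul] at h1 h2
  rw [← h1, ← h2, e]

theorem sum (h : SmoothTensorialAt T x) (hU : IsOpen U) (hx : x ∈ U) {ι : Type*} (s : Finset ι)
    {Y : ι → Π x : M, TangentSpace I x} (hY : ∀ i, SmoothFieldOn (Y i) U) :
    T (∑ i ∈ s, Y i) = ∑ i ∈ s, T (Y i) ∧ SmoothFieldOn (∑ i ∈ s, Y i) U := by
  classical
  have h0 : SmoothFieldOn (0 : Π x : M, TangentSpace I x) U :=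
    (contMDiff_zeroSection ℝ (fun x : M => TangentSpace I x)).contMDiffOn
  induction s using Finset.induction_on with
  | empty =>
    have := h.smul U hU hx 0 0 contMDiffOn_const h0
    simpa using ⟨by simpa using this, h0⟩
  | insert a s ha ih =>
    rw [Finset.sum_insert ha, Finset.sum_insert ha, h.add U hU hx _ _ (hY a) ih.2, ih.1]
    exact ⟨rfl, (hY a).add ih.2⟩

/-- Expanding a field in a local frame, linearity over functions expresses `T Y` through the
coefficients of `Y` at `x` alone. -/
theorem pointwise [FiniteDimensional ℝ E] (h : SmoothTensorialAt T x) (hU : IsOpen U) (hx : x ∈ U)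
    (hY : SmoothFieldOn Y U) (hZ : SmoothFieldOn Z U) (he : Y x = Z x) : T Y = T Z := by
  let e := trivializationAt E (TangentSpace I : M → Type _) x
  have hxe : x ∈ e.baseSet := mem_baseSet_trivializationAt E _ x
  let b := Module.finBasis ℝ E
  have hV : IsOpen (U ∩ e.baseSet) := hU.inter e.open_baseSet
  have key : ∀ Y : Π x : M, TangentSpace I x, SmoothFieldOn Y U →
      T Y = ∑ i, e.localFrameCoeff I b i x (Y x) • T (e.localFrame b i) := by
    intro Y hY
    have hs : ∀ i, SmoothFieldOn (e.localFrame b i) (U ∩ e.baseSet) := fun i =>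
      (e.contMDiffOn_localFrame_baseSet ∞ b i).mono inter_subset_right
    have hc : ∀ i, ContMDiffOn I 𝓘(ℝ) ∞ (fun y => e.localFrameCoeff I b i y (Y y))
        (U ∩ e.baseSet) := fun i =>
      contMDiffOn_localFrameCoeff b hV inter_subset_right (ContMDiffOn.mono hY inter_subset_left) i
    have h1 := h.sum hV ⟨hx, hxe⟩ Finset.univ fun i => (hs i).smul (hc i)
    rw [h.congr_on hV ⟨hx, hxe⟩ (ContMDiffOn.mono hY inter_subset_left) h1.2 ?_, h1.1]
    · exact Finset.sum_congr rfl fun i _ => h.smul _ hV ⟨hx, hxe⟩ _ _ (hc i) (hs i)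
    · intro y hy
      have := e.eq_sum_localFrameCoeff_smul (I := I) (b := b) (s := Y) hy.2
      simpa using this
  rw [key Y hY, key Z hZ, he]

end SmoothTensorialAt

theorem AffineConnection.congr_on (D : AffineConnection I M) (hU : IsOpen U) (hx : x ∈ U)
    (hY : SmoothFieldOn Y U) (hZ : SmoothFieldOn Z U) (he : ∀ y ∈ U, Y y = Z y) :
    D Y x = D Z x :=
  D.isCovariantDerivativeOn.congr_of_eqOn (hY.mdifferentiableAt hU hx) (hZ.mdifferentiableAt hU hx)
    (hU.mem_nhds hx) he

theorem AffineConnection.add_apply (D : AffineConnection I M) (hU : IsOpen U) (hx : x ∈ U)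
    (hY : SmoothFieldOn Y U) (hZ : SmoothFieldOn Z U) : D (Y + Z) x = D Y x + D Z x :=
  D.isCovariantDerivativeOnUniv.add (hY.mdifferentiableAt hU hx) (hZ.mdifferentiableAt hU hx)

theorem AffineConnection.smul_apply (D : AffineConnection I M) (hU : IsOpen U) (hx : x ∈ U)
    {f : M → ℝ} (hf : ContMDiffOn I 𝓘(ℝ) ∞ f U)
    (hZ : SmoothFieldOn Z U) (v : TangentSpace I x) :
    D (f • Z) x v = f x • D Z x v + mvfderiv I f x v • Z x := by
  have := D.isCovariantDerivativeOnUniv.leibniz (hZ.mdifferentiableAt hU hx)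
    ((hf.contMDiffAt (hU.mem_nhds hx)).mdifferentiableAt (by simp : (∞ : ℕ∞ω) ≠ 0))
  have := congr($this v)
  simpa using this

/-- A connection maps smooth local fields to smooth local fields. -/
def IsSmoothConn (D : AffineConnection I M) : Prop :=
  ∀ U : Set M, IsOpen U → ∀ X Y : Π x : M, TangentSpace I x,
    SmoothFieldOn X U → SmoothFieldOn Y U → SmoothFieldOn (fun x => D Y x (X x)) U

theorem IsSmoothConn.contMDiffCovariantDerivative [FiniteDimensional ℝ E]
    {D : AffineConnection I M} (hD : IsSmoothConn D) : D.ContMDiffCovariantDerivative ∞ where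
  contMDiff := by
    refine ⟨fun {σ} hσ x _ => (contMDiffAt_hom_of_apply fun U hU hx X hX => ?_).contMDiffWithinAt⟩
    exact (hD U hU X σ hX (ContMDiffOn.mono hσ (subset_univ _))).contMDiffAt hU hx

/-- The hypothesis concerns globally smooth fields. A local field is cut off by a bump function
equal to 1 near the point, which does not affect the covariant derivative there; the Hausdorff
property makes the bump function globally smooth. -/
theorem isSmoothConn_of_contMDiffCovariantDerivative [FiniteDimensional ℝ E] [T2Space M]
    {D : AffineConnection I M} (hD : D.ContMDiffCovariantDerivative ∞) : IsSmoothConn D := by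
  intro U hU X Y hX hY x hx
  obtain ⟨ρ, hρ, hρU⟩ := (SmoothBumpFunction.nhds_basis_tsupport (I := I) x).mem_iff.1
    (hU.mem_nhds hx)
  have h1 : ContMDiff I I.tangent ∞ (fun y => (⟨y, (⇑ρ • Y) y⟩ : TangentBundle I M)) :=
    (ContMDiffOn.smul_section_of_tsupport ρ.contMDiff.contMDiffOn hU hρU hY)
  have h2 := hD.contMDiff.contMDiff (contMDiffOn_univ.2 (by simpa using h1))
  have h3 : ContMDiffWithinAt I I.tangent ∞
      (fun y => (⟨y, D (⇑ρ • Y) y (X y)⟩ : TangentBundle I M)) U x :=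
    ContMDiffWithinAt.clm_bundle_apply (h2.contMDiffAt univ_mem).contMDiffWithinAt (hX x hx)
  have h4 : ∀ᶠ y in 𝓝 x, D Y y = D (⇑ρ • Y) y := by
    filter_upwards [ρ.eventuallyEq_one.eventually_nhds, hU.mem_nhds hx] with y hy hyU
    refine D.isCovariantDerivativeOn.congr_of_eventuallyEq (s := univ)
      (hY.mdifferentiableAt hU hyU) (h1.mdifferentiableAt (by simp)) univ_mem ?_
    filter_upwards [hy] with z hz
    simp [hz]
  refine h3.congr_of_eventuallyEq_of_mem ?_ hx
  filter_upwards [mem_nhdsWithin_of_mem_nhds h4] with y hy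
  simp [hy]

end Tensorial

/-! ### Tensoriality of the curvature -/

section Curvature

variable {E : Type*} [NormedAddCommGroup E] [NormedSpace ℝ E]
  {H : Type*} [TopologicalSpace H] {I : ModelWithCorners ℝ E H}
  {M : Type*} [TopologicalSpace M] [ChartedSpace H M] [IsManifold I ∞ M]
  {X Y Z X' Y' Z' : Π x : M, TangentSpace I x} {U : Set M} {x : M} {D : AffineConnection I M}
  [CompleteSpace E]

omit [CompleteSpace E] in
theorem curvature_swap : curvature D X Y Z x = - curvature D Y X Z x := by
  simp only [curvature]
  rw [mlieBracket_swap_apply, map_neg]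
  abel

/-- The term `-(Y f) D_X Z` from `-D_Y (f D_X Z)` cancels against the one produced by `[f X, Y] = f
[X, Y] - (Y f) X`. -/
theorem curvature_tensorial_left (hD : IsSmoothConn D) (hU : IsOpen U) (hx : x ∈ U)
    (hZ : SmoothFieldOn Z U) :
    SmoothTensorialAt (fun X => curvature D X Y Z x) x where
  add V hV hxV X X' hX hX' := by
    have hW := hU.inter hV
    have hxW : x ∈ U ∩ V := ⟨hx, hxV⟩
    have hX := ContMDiffOn.mono hX (inter_subset_right (s := U))
    have hX' := ContMDiffOn.mono hX' (inter_subset_right (s := U))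
    have hZ := ContMDiffOn.mono hZ (inter_subset_left (t := V))
    have h1 := D.add_apply hW hxW (hD _ hW _ _ hX hZ) (hD _ hW _ _ hX' hZ)
    have h2 : (fun y => D Z y ((X + X') y)) = (fun y => D Z y (X y)) + fun y => D Z y (X' y) := by
      funext y; simp
    simp only [curvature]
    rw [h2, h1, mlieBracket_add_left (SmoothFieldOn.mdifferentiableAt hX hW hxW)
      (SmoothFieldOn.mdifferentiableAt hX' hW hxW)]
    simp only [Pi.add_apply, map_add, _root_.add_apply]
    abel
  smul V hV hxV f X hf hX := by
    have hW := hU.inter hV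
    have hxW : x ∈ U ∩ V := ⟨hx, hxV⟩
    have hX := ContMDiffOn.mono hX (inter_subset_right (s := U))
    have hf := hf.mono (inter_subset_right (s := U))
    have hZ := ContMDiffOn.mono hZ (inter_subset_left (t := V))
    have h1 := D.smul_apply hW hxW hf (hD _ hW _ _ hX hZ) (Y x)
    have h2 : (fun y => D Z y ((f • X) y)) = f • (fun y => D Z y (X y)) := by
      funext y; simp
    simp only [curvature]
    rw [h2, h1, mlieBracket_smul_left ((hf.contMDiffAt (hW.mem_nhds hxW)).mdifferentiableAt
      (by simp)) (SmoothFieldOn.mdifferentiableAt hX hW hxW)]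
    simp only [Pi.smul_apply', map_add, map_smul, map_neg, neg_smul]
    module

/-- In `D_X D_Y (f Z)` the terms with one derivative on `f` are symmetric in `X` and `Y`; those with
two antisymmetrize to `([X, Y] f) Z`, which `D_{[X, Y]} (f Z)` removes. -/
theorem curvature_tensorial_right (hD : IsSmoothConn D) (hU : IsOpen U) (hx : x ∈ U)
    (hX : SmoothFieldOn X U) (hY : SmoothFieldOn Y U) :
    SmoothTensorialAt (fun Z => curvature D X Y Z x) x where
  add V hV hxV Z Z' hZ hZ' := by
    have hW := hU.inter hV
    have hxW : x ∈ U ∩ V := ⟨hx, hxV⟩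
    have hX := ContMDiffOn.mono hX (inter_subset_left (t := V))
    have hY := ContMDiffOn.mono hY (inter_subset_left (t := V))
    have hZ := ContMDiffOn.mono hZ (inter_subset_right (s := U))
    have hZ' := ContMDiffOn.mono hZ' (inter_subset_right (s := U))
    have key : ∀ {Y : Π x : M, TangentSpace I x}, SmoothFieldOn Y (U ∩ V) →
        D (fun y => D (Z + Z') y (Y y)) x =
          D (fun y => D Z y (Y y)) x + D (fun y => D Z' y (Y y)) x := by
      intro Y hY
      rw [← D.add_apply hW hxW (hD _ hW _ _ hY hZ) (hD _ hW _ _ hY hZ')]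
      refine D.congr_on hW hxW (hD _ hW _ _ hY (SmoothFieldOn.add hZ hZ'))
        ((hD _ hW _ _ hY hZ).add (hD _ hW _ _ hY hZ')) fun y hy => ?_
      simp [D.add_apply hW hy hZ hZ']
    simp only [curvature]
    rw [key hX, key hY, D.add_apply hW hxW hZ hZ']
    simp only [_root_.add_apply]
    abel
  smul V hV hxV f Z hf hZ := by
    have hW := hU.inter hV
    have hxW : x ∈ U ∩ V := ⟨hx, hxV⟩
    have hX := ContMDiffOn.mono hX (inter_subset_left (t := V))
    have hY := ContMDiffOn.mono hY (inter_subset_left (t := V))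
    have hZ := ContMDiffOn.mono hZ (inter_subset_right (s := U))
    have hf := hf.mono (inter_subset_right (s := U))
    have key : ∀ {Y : Π x : M, TangentSpace I x}, SmoothFieldOn Y (U ∩ V) → ∀ v,
        D (fun y => D (f • Z) y (Y y)) x v =
          f x • D (fun y => D Z y (Y y)) x v + mvfderiv I f x v • D Z x (Y x)
          + (mvfderiv I f x (Y x) • D Z x v + mvfderiv I (fun y => mvfderiv I f y (Y y)) x v • Z x)
          := by
      intro Y hY v
      have hYf : ContMDiffOn I 𝓘(ℝ) ∞ (fun y => mvfderiv I f y (Y y)) (U ∩ V) := fun y hy =>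
        ((hf.contMDiffAt (hW.mem_nhds hy)).mvfderiv_field
          (SmoothFieldOn.contMDiffAt hY hW hy)).contMDiffWithinAt
      rw [← D.smul_apply hW hxW hf (hD _ hW _ _ hY hZ), ← D.smul_apply hW hxW hYf hZ,
        ← _root_.add_apply, ← D.add_apply hW hxW ((hD _ hW _ _ hY hZ).smul hf)
        (SmoothFieldOn.smul hYf hZ)]
      congr 1
      refine D.congr_on hW hxW (hD _ hW _ _ hY (SmoothFieldOn.smul hf hZ))
        (((hD _ hW _ _ hY hZ).smul hf).add (SmoothFieldOn.smul hYf hZ)) fun y hy => ?_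
      simp [D.smul_apply hW hy hf hZ]
    simp only [curvature]
    have h := mvfderiv_mlieBracket_smul hW hxW hf hX hY hZ
    rw [key hX, key hY, D.smul_apply hW hxW hf hZ, h]
    module

/-- Antisymmetry reduces the second argument to the first. Flatness may now be tested on any
convenient extensions of three vectors. -/
theorem curvature_congr [FiniteDimensional ℝ E] (hD : IsSmoothConn D) (hU : IsOpen U) (hx : x ∈ U)
    (hX : SmoothFieldOn X U) (hX' : SmoothFieldOn X' U) (hY : SmoothFieldOn Y U)
    (hY' : SmoothFieldOn Y' U) (hZ : SmoothFieldOn Z U) (hZ' : SmoothFieldOn Z' U)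
    (eX : X x = X' x) (eY : Y x = Y' x) (eZ : Z x = Z' x) :
    curvature D X Y Z x = curvature D X' Y' Z' x := by
  rw [(curvature_tensorial_right hD hU hx hX hY).pointwise hU hx hZ hZ' eZ,
    (curvature_tensorial_left hD hU hx hZ').pointwise hU hx hX hX' eX, curvature_swap,
    (curvature_tensorial_left hD hU hx hZ').pointwise hU hx hY hY' eY, ← curvature_swap]

end Curvature

/-! ### Boundedness of the unit ball of a positive definite form -/

section PosDef

/-- On the compact unit sphere the form has a positive minimum `m`, so `m ‖v‖² ≤ b v v`. This
supplies the boundedness field of a Riemannian metric. -/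
theorem isVonNBounded_of_posDef {E : Type*} [NormedAddCommGroup E] [NormedSpace ℝ E]
    [FiniteDimensional ℝ E] (b : E →L[ℝ] E →L[ℝ] ℝ) (pos : ∀ v, v ≠ 0 → 0 < b v v) :
    Bornology.IsVonNBounded ℝ {v : E | b v v < 1} := by
  rw [NormedSpace.isVonNBounded_iff]
  have : ProperSpace E := FiniteDimensional.proper ℝ E
  rcases subsingleton_or_nontrivial E with hE | hE
  · exact (Set.toFinite _).isBounded
  obtain ⟨u, hu, hmin⟩ := (isCompact_sphere (0 : E) 1).exists_isMinOn
    (NormedSpace.sphere_nonempty.2 zero_le_one)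
    (f := fun v => b v v) (ContinuousOn.clm_apply b.continuous.continuousOn continuousOn_id)
  have hm : 0 < b u u := pos u (ne_zero_of_mem_unit_sphere ⟨u, hu⟩)
  -- The radius `1/m + 1` avoids a square root: it is at least 1, so `‖v‖ ≥ 1/m + 1` would give `m
  -- ‖v‖² ≥ m ‖v‖ > 1`.
  refine (Metric.isBounded_ball (x := (0 : E)) (r := (b u u)⁻¹ + 1)).subset fun v hv => ?_
  rw [mem_ball_zero_iff]
  rcases eq_or_ne v 0 with rfl | hv0
  · simp; positivity
  have hn : 0 < ‖v‖ := norm_pos_iff.2 hv0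
  have h1 : b u u ≤ b (‖v‖⁻¹ • v) (‖v‖⁻¹ • v) := hmin (by simp [norm_smul, hn.ne'])
  have h2 : b v v < 1 := hv
  have h3 : b u u * ‖v‖ ^ 2 < 1 := by
    refine lt_of_le_of_lt ?_ h2
    calc b u u * ‖v‖ ^ 2 ≤ b (‖v‖⁻¹ • v) (‖v‖⁻¹ • v) * ‖v‖ ^ 2 := by gcongr
      _ = b v v := by simp; field_simp
  by_contra! hc
  have h4 : b u u * (b u u)⁻¹ = 1 := mul_inv_cancel₀ hm.ne'
  have h5 : 1 ≤ ‖v‖ := by have := inv_pos.2 hm; linarith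
  have h6 : b u u * ((b u u)⁻¹ + 1) ≤ b u u * ‖v‖ := by gcongr
  nlinarith [mul_pos hm hn]

end PosDef

/-! ### Smooth forms and metrics, and tensoriality of their derivatives -/

section Forms

variable {E : Type*} [NormedAddCommGroup E] [NormedSpace ℝ E]
  {H : Type*} [TopologicalSpace H] {I : ModelWithCorners ℝ E H}
  {M : Type*} [TopologicalSpace M] [ChartedSpace H M] [IsManifold I ∞ M]

/-- `b` maps smooth local fields to smooth functions. -/
def IsSmoothBilin (b : Π x : M, TangentSpace I x →L[ℝ] TangentSpace I x →L[ℝ] ℝ) : Prop :=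
  ∀ U : Set M, IsOpen U → ∀ Y Z : Π x : M, TangentSpace I x, SmoothFieldOn Y U →
    SmoothFieldOn Z U → ContMDiffOn I 𝓘(ℝ) ∞ (fun y => b y (Y y) (Z y)) U

/-- `θ` maps smooth local fields to smooth functions. -/
def IsSmoothForm (θ : Π x : M, TangentSpace I x →L[ℝ] ℝ) : Prop :=
  ∀ U : Set M, IsOpen U → ∀ Y : Π x : M, TangentSpace I x, SmoothFieldOn Y U →
    ContMDiffOn I 𝓘(ℝ) ∞ (fun y => θ y (Y y)) U

omit [IsManifold I ∞ M] in
theorem contMDiffAt_trivial_section {f : M → ℝ} {x : M} :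
    ContMDiffAt I (I.prod 𝓘(ℝ)) ∞
      (fun y => TotalSpace.mk' ℝ (E := Bundle.Trivial M ℝ) y (f y)) x ↔
    ContMDiffAt I 𝓘(ℝ) ∞ f x := by
  rw [contMDiffAt_section]
  rfl

theorem IsSmoothForm.smoothOneForm [FiniteDimensional ℝ E]
    {θ : Π x : M, TangentSpace I x →L[ℝ] ℝ} (h : IsSmoothForm θ) : SmoothOneForm θ := by
  intro x
  refine contMDiffAt_hom_of_apply fun U hU hx Y hY => ?_
  exact contMDiffAt_trivial_section.2 ((h U hU Y hY).contMDiffAt (hU.mem_nhds hx))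

theorem RiemMetric.isSmoothBilin (g : RiemMetric I M) : IsSmoothBilin g.inner := by
  intro U hU Y Z hY hZ x hx
  have := ContMDiffAt.clm_bundle_apply₂ (g.contMDiff x) (hY.contMDiffAt hU hx)
    (hZ.contMDiffAt hU hx)
  exact (contMDiffAt_trivial_section.1 this).contMDiffWithinAt

/-- A smooth positive definite symmetric bilinear form is a Riemannian metric. -/
def RiemMetric.ofPosDef [FiniteDimensional ℝ E]
    (b : Π x : M, TangentSpace I x →L[ℝ] TangentSpace I x →L[ℝ] ℝ) (hb : IsSmoothBilin b)
    (symm : ∀ x v w, b x v w = b x w v) (pos : ∀ x v, v ≠ 0 → 0 < b x v v) : RiemMetric I M where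
  inner := b
  symm := symm
  pos := pos
  isVonNBounded x := isVonNBounded_of_posDef (E := E) (b x) (pos x)
  contMDiff x := by
    refine contMDiffAt_hom_of_apply fun U hU hx Y hY => contMDiffAt_hom_of_apply
      fun V hV hxV Z hZ => contMDiffAt_trivial_section.2 ?_
    exact (hb _ (hU.inter hV) Y Z (ContMDiffOn.mono hY inter_subset_left)
      (ContMDiffOn.mono hZ inter_subset_right)).contMDiffAt ((hU.inter hV).mem_nhds ⟨hx, hxV⟩)

variable {X Y Z X' Y' Z' : Π x : M, TangentSpace I x} {U : Set M} {x : M} {D : AffineConnection I M}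
  {b : Π x : M, TangentSpace I x →L[ℝ] TangentSpace I x →L[ℝ] ℝ}
  {θ : Π x : M, TangentSpace I x →L[ℝ] ℝ}

theorem covDerivForm_tensorial (hθ : IsSmoothForm θ) (X) :
    SmoothTensorialAt (fun Y => covDerivForm D θ X Y x) x where
  add V hV hxV Y Z hY hZ := by
    have hY' := ((hθ V hV Y hY).contMDiffAt (hV.mem_nhds hxV)).mdifferentiableAt (by simp)
    have hZ' := ((hθ V hV Z hZ).contMDiffAt (hV.mem_nhds hxV)).mdifferentiableAt (by simp)
    have e : (fun y => θ y ((Y + Z) y)) = (fun y => θ y (Y y)) + fun y => θ y (Z y) := by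
      funext y; simp
    simp only [covDerivForm]
    rw [e, mvfderiv_add hY' hZ', D.add_apply hV hxV hY hZ]
    simp only [_root_.add_apply, map_add]
    ring
  smul V hV hxV f Y hf hY := by
    have hY' := ((hθ V hV Y hY).contMDiffAt (hV.mem_nhds hxV)).mdifferentiableAt (by simp)
    have hf' := (hf.contMDiffAt (hV.mem_nhds hxV)).mdifferentiableAt (by simp)
    have e : (fun y => θ y ((f • Y) y)) = f * (fun y => θ y (Y y)) := by
      funext y; simp
    simp only [covDerivForm]
    rw [e, mvfderiv_mul hf' hY', D.smul_apply hV hxV hf hY]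
    simp
    ring

theorem covDerivBilin_tensorial_left (hb : IsSmoothBilin b) (hU : IsOpen U) (hx : x ∈ U) (X)
    (hZ : SmoothFieldOn Z U) : SmoothTensorialAt (fun Y => covDerivBilin D b X Y Z x) x where
  add V hV hxV Y Y' hY hY' := by
    have hW := hU.inter hV
    have hxW : x ∈ U ∩ V := ⟨hx, hxV⟩
    have hY := ContMDiffOn.mono hY (inter_subset_right (s := U))
    have hY' := ContMDiffOn.mono hY' (inter_subset_right (s := U))
    have hZ := ContMDiffOn.mono hZ (inter_subset_left (t := V))
    have h1 := ((hb _ hW Y Z hY hZ).contMDiffAt (hW.mem_nhds hxW)).mdifferentiableAt (by simp)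
    have h2 := ((hb _ hW Y' Z hY' hZ).contMDiffAt (hW.mem_nhds hxW)).mdifferentiableAt (by simp)
    have e : (fun y => b y ((Y + Y') y) (Z y)) =
        (fun y => b y (Y y) (Z y)) + fun y => b y (Y' y) (Z y) := by
      funext y; simp
    simp only [covDerivBilin]
    rw [e, mvfderiv_add h1 h2, D.add_apply hW hxW hY hY']
    simp only [Pi.add_apply, _root_.add_apply, map_add]
    ring
  smul V hV hxV f Y hf hY := by
    have hW := hU.inter hV
    have hxW : x ∈ U ∩ V := ⟨hx, hxV⟩
    have hY := ContMDiffOn.mono hY (inter_subset_right (s := U))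
    have hf := hf.mono (inter_subset_right (s := U))
    have hZ := ContMDiffOn.mono hZ (inter_subset_left (t := V))
    have h1 := ((hb _ hW Y Z hY hZ).contMDiffAt (hW.mem_nhds hxW)).mdifferentiableAt (by simp)
    have h2 := (hf.contMDiffAt (hW.mem_nhds hxW)).mdifferentiableAt (by simp)
    have e : (fun y => b y ((f • Y) y) (Z y)) = f * (fun y => b y (Y y) (Z y)) := by
      funext y; simp
    simp only [covDerivBilin]
    rw [e, mvfderiv_mul h2 h1, D.smul_apply hW hxW hf hY]
    simp
    ring

theorem covDerivBilin_tensorial_right (hb : IsSmoothBilin b) (hU : IsOpen U) (hx : x ∈ U) (X)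
    (hY : SmoothFieldOn Y U) : SmoothTensorialAt (fun Z => covDerivBilin D b X Y Z x) x where
  add V hV hxV Z Z' hZ hZ' := by
    have hW := hU.inter hV
    have hxW : x ∈ U ∩ V := ⟨hx, hxV⟩
    have hZ := ContMDiffOn.mono hZ (inter_subset_right (s := U))
    have hZ' := ContMDiffOn.mono hZ' (inter_subset_right (s := U))
    have hY := ContMDiffOn.mono hY (inter_subset_left (t := V))
    have h1 := ((hb _ hW Y Z hY hZ).contMDiffAt (hW.mem_nhds hxW)).mdifferentiableAt (by simp)
    have h2 := ((hb _ hW Y Z' hY hZ').contMDiffAt (hW.mem_nhds hxW)).mdifferentiableAt (by simp)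
    have e : (fun y => b y (Y y) ((Z + Z') y)) =
        (fun y => b y (Y y) (Z y)) + fun y => b y (Y y) (Z' y) := by
      funext y; simp
    simp only [covDerivBilin]
    rw [e, mvfderiv_add h1 h2, D.add_apply hW hxW hZ hZ']
    simp only [Pi.add_apply, _root_.add_apply, map_add]
    ring
  smul V hV hxV f Z hf hZ := by
    have hW := hU.inter hV
    have hxW : x ∈ U ∩ V := ⟨hx, hxV⟩
    have hZ := ContMDiffOn.mono hZ (inter_subset_right (s := U))
    have hf := hf.mono (inter_subset_right (s := U))
    have hY := ContMDiffOn.mono hY (inter_subset_left (t := V))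
    have h1 := ((hb _ hW Y Z hY hZ).contMDiffAt (hW.mem_nhds hxW)).mdifferentiableAt (by simp)
    have h2 := (hf.contMDiffAt (hW.mem_nhds hxW)).mdifferentiableAt (by simp)
    have e : (fun y => b y (Y y) ((f • Z) y)) = f * (fun y => b y (Y y) (Z y)) := by
      funext y; simp
    simp only [covDerivBilin]
    rw [e, mvfderiv_mul h2 h1, D.smul_apply hW hxW hf hZ]
    simp
    ring

/-- The direction `X` enters only through its value at `x`, so it needs no smoothness; `Y` and `Z`
are replaced by tensoriality. -/
theorem covDerivBilin_congr [FiniteDimensional ℝ E] (hb : IsSmoothBilin b) (hU : IsOpen U)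
    (hx : x ∈ U) (hY : SmoothFieldOn Y U) (hY' : SmoothFieldOn Y' U) (hZ : SmoothFieldOn Z U)
    (hZ' : SmoothFieldOn Z' U) (eX : X x = X' x) (eY : Y x = Y' x) (eZ : Z x = Z' x) :
    covDerivBilin D b X Y Z x = covDerivBilin D b X' Y' Z' x := by
  rw [(covDerivBilin_tensorial_left hb hU hx X hZ).pointwise hU hx hY hY' eY,
    (covDerivBilin_tensorial_right hb hU hx X hY').pointwise hU hx hZ hZ' eZ]
  simp only [covDerivBilin, eX]

/-- The Lie derivative `(L_X b)(Y, Z)`. -/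
def lieDerivBilin (b : Π x : M, TangentSpace I x →L[ℝ] TangentSpace I x →L[ℝ] ℝ)
    (X Y Z : Π x : M, TangentSpace I x) (x : M) : ℝ :=
  mvfderiv I (fun y => b y (Y y) (Z y)) x (X x) - b x (mlieBracket I X Y x) (Z x)
    - b x (Y x) (mlieBracket I X Z x)

theorem lieDerivBilin_tensorial_left [CompleteSpace E] (hb : IsSmoothBilin b) (hU : IsOpen U)
    (hx : x ∈ U) (X)
    (hZ : SmoothFieldOn Z U) : SmoothTensorialAt (fun Y => lieDerivBilin b X Y Z x) x where
  add V hV hxV Y Y' hY hY' := by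
    have hW := hU.inter hV
    have hxW : x ∈ U ∩ V := ⟨hx, hxV⟩
    have hY := ContMDiffOn.mono hY (inter_subset_right (s := U))
    have hY' := ContMDiffOn.mono hY' (inter_subset_right (s := U))
    have hZ := ContMDiffOn.mono hZ (inter_subset_left (t := V))
    have h1 := ((hb _ hW Y Z hY hZ).contMDiffAt (hW.mem_nhds hxW)).mdifferentiableAt (by simp)
    have h2 := ((hb _ hW Y' Z hY' hZ).contMDiffAt (hW.mem_nhds hxW)).mdifferentiableAt (by simp)
    have e : (fun y => b y ((Y + Y') y) (Z y)) =
        (fun y => b y (Y y) (Z y)) + fun y => b y (Y' y) (Z y) := by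
      funext y; simp
    simp only [lieDerivBilin]
    rw [e, mvfderiv_add h1 h2, mlieBracket_add_right (SmoothFieldOn.mdifferentiableAt hY hW hxW)
      (SmoothFieldOn.mdifferentiableAt hY' hW hxW)]
    simp only [Pi.add_apply, _root_.add_apply, map_add]
    ring
  smul V hV hxV f Y hf hY := by
    have hW := hU.inter hV
    have hxW : x ∈ U ∩ V := ⟨hx, hxV⟩
    have hY := ContMDiffOn.mono hY (inter_subset_right (s := U))
    have hf := hf.mono (inter_subset_right (s := U))
    have hZ := ContMDiffOn.mono hZ (inter_subset_left (t := V))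
    have h1 := ((hb _ hW Y Z hY hZ).contMDiffAt (hW.mem_nhds hxW)).mdifferentiableAt (by simp)
    have h2 := (hf.contMDiffAt (hW.mem_nhds hxW)).mdifferentiableAt (by simp)
    have e : (fun y => b y ((f • Y) y) (Z y)) = f * (fun y => b y (Y y) (Z y)) := by
      funext y; simp
    simp only [lieDerivBilin]
    rw [e, mvfderiv_mul h2 h1, mlieBracket_smul_right h2
      (SmoothFieldOn.mdifferentiableAt hY hW hxW)]
    simp
    ring

omit [IsManifold I ∞ M] in
theorem lieDerivBilin_comm (hb : ∀ x v w, b x v w = b x w v) :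
    lieDerivBilin b X Y Z x = lieDerivBilin b X Z Y x := by
  simp only [lieDerivBilin]
  rw [hb x _ (Z x), hb x (Y x), funext fun y => hb y (Y y) (Z y)]
  ring

/-- Here `X` stays fixed, since a Lie derivative involves the first derivatives of `X`. Symmetry of
`b` carries tensoriality from one slot to the other. -/
theorem lieDerivBilin_congr [FiniteDimensional ℝ E] [CompleteSpace E] (hb : IsSmoothBilin b)
    (symm : ∀ x v w, b x v w = b x w v) (hU : IsOpen U)
    (hx : x ∈ U) (hY : SmoothFieldOn Y U) (hY' : SmoothFieldOn Y' U) (hZ : SmoothFieldOn Z U)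
    (hZ' : SmoothFieldOn Z' U) (eY : Y x = Y' x) (eZ : Z x = Z' x) :
    lieDerivBilin b X Y Z x = lieDerivBilin b X Y' Z' x := by
  rw [(lieDerivBilin_tensorial_left hb hU hx X hZ).pointwise hU hx hY hY' eY,
    lieDerivBilin_comm symm,
    (lieDerivBilin_tensorial_left hb hU hx X hY').pointwise hU hx hZ hZ' eZ,
    lieDerivBilin_comm symm]

end Forms

/-! ### Structures related by a surjective local diffeomorphism -/

section Descent

variable {E : Type*} [NormedAddCommGroup E] [NormedSpace ℝ E] [CompleteSpace E]
  {H : Type*} [TopologicalSpace H] {I : ModelWithCorners ℝ E H}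
  {N : Type*} [TopologicalSpace N] [ChartedSpace H N] [IsManifold I ∞ N]
  {C : Type*} [TopologicalSpace C] [ChartedSpace H C] [IsManifold I ∞ C]
  {F : N → C}

omit [CompleteSpace E] [IsManifold I ∞ N] [IsManifold I ∞ C] in
theorem IsLocalDiffeomorph.isInvertible_mfderiv (hF : IsLocalDiffeomorph I I ∞ F) (p : N) :
    (mfderiv I I F p).IsInvertible :=
  ⟨hF.mfderivToContinuousLinearEquiv (by simp) p, by
    rw [IsLocalDiffeomorph.mfderivToContinuousLinearEquiv_coe]⟩

omit [CompleteSpace E] [IsManifold I ∞ N] [IsManifold I ∞ C] in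
theorem IsLocalDiffeomorph.mfderiv_inverse (hF : IsLocalDiffeomorph I I ∞ F) (p : N)
    (w : TangentSpace I (F p)) : mfderiv I I F p ((mfderiv I I F p).inverse w) = w := by
  exact congr($((hF.isInvertible_mfderiv p).self_comp_inverse) w)

omit [CompleteSpace E] [IsManifold I ∞ N] [IsManifold I ∞ C] in
theorem IsLocalDiffeomorph.inverse_mfderiv (hF : IsLocalDiffeomorph I I ∞ F) (p : N)
    (v : TangentSpace I p) : (mfderiv I I F p).inverse (mfderiv I I F p v) = v := by
  exact congr($((hF.isInvertible_mfderiv p).inverse_comp_self) v)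

omit [CompleteSpace E] [IsManifold I ∞ N] [IsManifold I ∞ C] in
theorem IsLocalDiffeomorph.mfderiv_mpullback (hF : IsLocalDiffeomorph I I ∞ F) (p : N)
    (Y : Π x : C, TangentSpace I x) : mfderiv I I F p (mpullback I I F Y p) = Y (F p) :=
  hF.mfderiv_inverse p _

theorem SmoothFieldOn.mpullback (hF : IsLocalDiffeomorph I I ∞ F) {U : Set C}
    {Y : Π x : C, TangentSpace I x} (hY : SmoothFieldOn Y U) :
    SmoothFieldOn (mpullback I I F Y) (F ⁻¹' U) :=
  ContMDiffOn.mpullback_vectorField_preimage hY hF.contMDiff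
    (fun p _ => hF.isInvertible_mfderiv p) (by simp)

omit [CompleteSpace E] [IsManifold I ∞ N] [IsManifold I ∞ C] in
theorem IsLocalDiffeomorph.mvfderiv_comp (hF : IsLocalDiffeomorph I I ∞ F) {p : N}
    {f : C → ℝ} (hf : MDifferentiableAt I 𝓘(ℝ) f (F p)) (v : TangentSpace I p) :
    mvfderiv I (fun p => f (F p)) p v = mvfderiv I f (F p) (mfderiv I I F p v) :=
  mvfderiv_comp_apply p hf (hF.contMDiff.contMDiffAt.mdifferentiableAt (by simp)) v

omit [CompleteSpace E] [IsManifold I ∞ N] [IsManifold I ∞ C] in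
theorem IsLocalDiffeomorph.contMDiffAt_of_comp (hF : IsLocalDiffeomorph I I ∞ F) {p : N}
    {E' H' P : Type*} [NormedAddCommGroup E'] [NormedSpace ℝ E'] [TopologicalSpace H']
    {J : ModelWithCorners ℝ E' H'} [TopologicalSpace P] [ChartedSpace H' P] {f : C → P}
    (hf : ContMDiffAt I J ∞ (fun p => f (F p)) p) : ContMDiffAt I J ∞ f (F p) := by
  have h := hF p
  have h1 := h.localInverse_contMDiffAt
  have h2 : h.localInverse (F p) = p := h.localInverse_left_inv h.localInverse_mem_target
  rw [← h2] at hf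
  refine (hf.comp (F p) h1).congr_of_eventuallyEq ?_
  filter_upwards [h.localInverse_eventuallyEq_right] with x hx
  exact (congrArg f hx).symm

-- Composed with `F`, the field `Y` is the tangent map of `F` applied to the smooth pulled-back
-- field; smoothness of a map is detected after composing with a local diffeomorphism.
omit [CompleteSpace E] in
theorem IsLocalDiffeomorph.smoothField_of_mpullback (hF : IsLocalDiffeomorph I I ∞ F)
    (hsurj : Function.Surjective F) {U : Set C} (hU : IsOpen U) {Y : Π x : C, TangentSpace I x}
    (h : SmoothFieldOn (VectorField.mpullback I I F Y) (F ⁻¹' U)) : SmoothFieldOn Y U := by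
  intro x hx
  obtain ⟨p, rfl⟩ := hsurj x
  refine ContMDiffAt.contMDiffWithinAt (hF.contMDiffAt_of_comp (p := p) ?_)
  have h1 : ContMDiff I.tangent I.tangent ∞ (tangentMap I I F) :=
    hF.contMDiff.contMDiff_tangentMap (by simp)
  have h2 := h1.contMDiffAt.comp p (h.contMDiffAt (hU.preimage hF.contMDiff.continuous) hx)
  refine h2.congr_of_eventuallyEq (Eventually.of_forall fun q => ?_)
  simp only [Function.comp, tangentMap]
  rw [hF.mfderiv_mpullback]

/-- `F` maps the connection `D` to the connection `D'`. -/
def ConnRelated (F : N → C) (D : AffineConnection I N) (D' : AffineConnection I C) : Prop :=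
  ∀ U : Set C, IsOpen U → ∀ Y : Π x : C, TangentSpace I x, SmoothFieldOn Y U → ∀ p : N, F p ∈ U →
    ∀ v : TangentSpace I p,
      mfderiv I I F p (D (mpullback I I F Y) p v) = D' Y (F p) (mfderiv I I F p v)

variable {D : AffineConnection I N} {D' : AffineConnection I C}
  {U : Set C} {X Y Z : Π x : C, TangentSpace I x} {p : N}

omit [CompleteSpace E] in
theorem ConnRelated.mpullback_apply (h : ConnRelated F D D') (hF : IsLocalDiffeomorph I I ∞ F)
    (hU : IsOpen U) (hY : SmoothFieldOn Y U) (hp : F p ∈ U) :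
    mpullback I I F (fun x => D' Y x (X x)) p = D (mpullback I I F Y) p (mpullback I I F X p) := by
  rw [VectorField.mpullback_apply, ← hF.mfderiv_mpullback p X, ← h U hU Y hY p hp,
    hF.inverse_mfderiv]

theorem ConnRelated.isSmoothConn (h : ConnRelated F D D') (hF : IsLocalDiffeomorph I I ∞ F)
    (hsurj : Function.Surjective F) (hD : IsSmoothConn D) : IsSmoothConn D' := by
  intro U hU X Y hX hY
  have hU' := hU.preimage hF.contMDiff.continuous
  refine hF.smoothField_of_mpullback hsurj hU ?_
  refine ContMDiffOn.congr (hD _ hU' _ _ (hX.mpullback hF) (hY.mpullback hF)) fun p hp => ?_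
  rw [h.mpullback_apply hF hU hY hp]

theorem IsLocalDiffeomorph.mpullback_mlieBracket (hF : IsLocalDiffeomorph I I ∞ F)
    (hU : IsOpen U) (hX : SmoothFieldOn X U) (hY : SmoothFieldOn Y U) (hp : F p ∈ U) :
    mpullback I I F (mlieBracket I X Y) p =
      mlieBracket I (mpullback I I F X) (mpullback I I F Y) p := by
  refine VectorField.mpullback_mlieBracket (n := ∞) (hX.mdifferentiableAt hU hp)
    (hY.mdifferentiableAt hU hp) hF.contMDiff.contMDiffAt ?_
  rw [minSmoothness_of_isRCLikeNormedField]
  exact WithTop.coe_le_coe.2 (le_top : (2 : ℕ∞) ≤ ⊤)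

theorem IsLocalDiffeomorph.mfderiv_mlieBracket (hF : IsLocalDiffeomorph I I ∞ F)
    (hU : IsOpen U) (hX : SmoothFieldOn X U) (hY : SmoothFieldOn Y U) (hp : F p ∈ U) :
    mfderiv I I F p (mlieBracket I (mpullback I I F X) (mpullback I I F Y) p) =
      mlieBracket I X Y (F p) := by
  rw [← hF.mpullback_mlieBracket hU hX hY hp, hF.mfderiv_mpullback]

/-- Relatedness is applied twice. The pullback of the inner derivative agrees with the derivative of
the pullback only over `U`, which suffices because `D` is local. -/
theorem ConnRelated.curvature_eq (h : ConnRelated F D D') (hF : IsLocalDiffeomorph I I ∞ F)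
    (hsurj : Function.Surjective F) (hD : IsSmoothConn D) (hU : IsOpen U) (hX : SmoothFieldOn X U)
    (hY : SmoothFieldOn Y U) (hZ : SmoothFieldOn Z U) (hp : F p ∈ U) :
    mfderiv I I F p (curvature D (mpullback I I F X) (mpullback I I F Y) (mpullback I I F Z) p) =
      curvature D' X Y Z (F p) := by
  have hU' := hU.preimage hF.contMDiff.continuous
  have hD' := h.isSmoothConn hF hsurj hD
  have key : ∀ {X Y : Π x : C, TangentSpace I x}, SmoothFieldOn X U → SmoothFieldOn Y U →
      mfderiv I I F p (D (fun q => D (mpullback I I F Z) q (mpullback I I F Y q)) p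
        (mpullback I I F X p)) = D' (fun x => D' Z x (Y x)) (F p) (X (F p)) := by
    intro X Y hX hY
    rw [← hF.mfderiv_mpullback p X, ← h U hU _ (hD' U hU _ _ hY hZ) p hp]
    congr 2
    exact D.congr_on hU' hp (hD _ hU' _ _ (hY.mpullback hF) (hZ.mpullback hF))
      ((hD' U hU _ _ hY hZ).mpullback hF) fun q hq => (h.mpullback_apply hF hU hZ hq).symm
  simp only [curvature, map_sub]
  rw [key hX hY, key hY hX, h U hU Z hZ p hp, hF.mfderiv_mlieBracket hU hX hY hp]

theorem ConnRelated.torsion_eq_zero [FiniteDimensional ℝ E] (h : ConnRelated F D D')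
    (hF : IsLocalDiffeomorph I I ∞ F) (hsurj : Function.Surjective F) (hD : D.torsion = 0) :
    D'.torsion = 0 := by
  ext x u v
  obtain ⟨p, rfl⟩ := hsurj x
  obtain ⟨U, X, hU, hxU, hX, rfl⟩ := exists_smoothFieldOn_eq u
  obtain ⟨V, Y, hV, hxV, hY, rfl⟩ := exists_smoothFieldOn_eq v
  have hW := hU.inter hV
  have hX : SmoothFieldOn X (U ∩ V) := ContMDiffOn.mono hX inter_subset_left
  have hY : SmoothFieldOn Y (U ∩ V) := ContMDiffOn.mono hY inter_subset_right
  have hp : F p ∈ U ∩ V := ⟨hxU, hxV⟩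
  have hW' := hW.preimage hF.contMDiff.continuous
  have h1 := D.torsion_eq_zero_iff.1 hD ((hX.mpullback hF).mdifferentiableAt hW' hp)
    ((hY.mpullback hF).mdifferentiableAt hW' hp)
  have h2 := congrArg (mfderiv I I F p) h1
  rw [map_sub, h _ hW Y hY p hp, h _ hW X hX p hp, hF.mfderiv_mlieBracket hW hX hY hp,
    hF.mfderiv_mpullback, hF.mfderiv_mpullback] at h2
  rw [D'.torsion_apply (hX.mdifferentiableAt hW hp) (hY.mdifferentiableAt hW hp), h2]
  simp

theorem ConnRelated.isFlatAffine [FiniteDimensional ℝ E] (h : ConnRelated F D D')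
    (hF : IsLocalDiffeomorph I I ∞ F) (hsurj : Function.Surjective F) (hs : IsSmoothConn D)
    (hD : IsFlatAffine D) : IsFlatAffine D' where
  smooth := (h.isSmoothConn hF hsurj hs).contMDiffCovariantDerivative
  torsion_eq_zero := h.torsion_eq_zero hF hsurj hD.torsion_eq_zero
  flat U hU X Y Z hX hY hZ x hx := by
    obtain ⟨p, rfl⟩ := hsurj x
    rw [← h.curvature_eq hF hsurj hs hU hX hY hZ hx, hD.flat (F ⁻¹' U)
      (hU.preimage hF.contMDiff.continuous) _ _ _ (hX.mpullback hF) (hY.mpullback hF)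
      (hZ.mpullback hF) p hx, map_zero]

variable {b : Π p : N, TangentSpace I p →L[ℝ] TangentSpace I p →L[ℝ] ℝ}
  {b' : Π x : C, TangentSpace I x →L[ℝ] TangentSpace I x →L[ℝ] ℝ}
  {θ : Π p : N, TangentSpace I p →L[ℝ] ℝ} {θ' : Π x : C, TangentSpace I x →L[ℝ] ℝ}

theorem IsSmoothForm.of_related (hF : IsLocalDiffeomorph I I ∞ F)
    (hsurj : Function.Surjective F) (hθ : IsSmoothForm θ)
    (h : ∀ p v, θ' (F p) (mfderiv I I F p v) = θ p v) : IsSmoothForm θ' := by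
  intro U hU Y hY x hx
  obtain ⟨p, rfl⟩ := hsurj x
  have hU' := hU.preimage hF.contMDiff.continuous
  have h1 := (hθ _ hU' _ (hY.mpullback hF)).contMDiffAt (hU'.mem_nhds hx)
  refine ContMDiffAt.contMDiffWithinAt (hF.contMDiffAt_of_comp (p := p) ?_)
  simpa only [← h, hF.mfderiv_mpullback] using h1

theorem IsSmoothBilin.of_related (hF : IsLocalDiffeomorph I I ∞ F)
    (hsurj : Function.Surjective F) (hb : IsSmoothBilin b)
    (h : ∀ p v w, b' (F p) (mfderiv I I F p v) (mfderiv I I F p w) = b p v w) :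
    IsSmoothBilin b' := by
  intro U hU Y Z hY hZ x hx
  obtain ⟨p, rfl⟩ := hsurj x
  have hU' := hU.preimage hF.contMDiff.continuous
  have h1 := (hb _ hU' _ _ (hY.mpullback hF) (hZ.mpullback hF)).contMDiffAt (hU'.mem_nhds hx)
  refine ContMDiffAt.contMDiffWithinAt (hF.contMDiffAt_of_comp (p := p) ?_)
  simpa only [← h, hF.mfderiv_mpullback] using h1

omit [CompleteSpace E] [IsManifold I ∞ N] in
theorem mvfderiv_form_of_related (hF : IsLocalDiffeomorph I I ∞ F) (hθ : IsSmoothForm θ')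
    (h : ∀ p v, θ' (F p) (mfderiv I I F p v) = θ p v) (hU : IsOpen U)
    (hY : SmoothFieldOn Y U) (hp : F p ∈ U) (v : TangentSpace I p) :
    mvfderiv I (fun q => θ q (mpullback I I F Y q)) p v =
      mvfderiv I (fun x => θ' x (Y x)) (F p) (mfderiv I I F p v) := by
  rw [← hF.mvfderiv_comp
    (((hθ U hU Y hY).contMDiffAt (hU.mem_nhds hp)).mdifferentiableAt (by simp))]
  simp only [← h, hF.mfderiv_mpullback]

omit [CompleteSpace E] [IsManifold I ∞ N] in
theorem mvfderiv_bilin_of_related (hF : IsLocalDiffeomorph I I ∞ F) (hb : IsSmoothBilin b')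
    (h : ∀ p v w, b' (F p) (mfderiv I I F p v) (mfderiv I I F p w) = b p v w) (hU : IsOpen U)
    (hY : SmoothFieldOn Y U) (hZ : SmoothFieldOn Z U) (hp : F p ∈ U) (v : TangentSpace I p) :
    mvfderiv I (fun q => b q (mpullback I I F Y q) (mpullback I I F Z q)) p v =
      mvfderiv I (fun x => b' x (Y x) (Z x)) (F p) (mfderiv I I F p v) := by
  rw [← hF.mvfderiv_comp
    (((hb U hU Y Z hY hZ).contMDiffAt (hU.mem_nhds hp)).mdifferentiableAt (by simp))]
  simp only [← h, hF.mfderiv_mpullback]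

theorem IsClosedForm.of_related (hF : IsLocalDiffeomorph I I ∞ F)
    (hsurj : Function.Surjective F) (hθ' : IsSmoothForm θ')
    (h : ∀ p v, θ' (F p) (mfderiv I I F p v) = θ p v) (hθ : IsClosedForm θ) :
    IsClosedForm θ' := by
  intro U hU X Y hX hY x hx
  obtain ⟨p, rfl⟩ := hsurj x
  have := hθ _ (hU.preimage hF.contMDiff.continuous) _ _ (hX.mpullback hF) (hY.mpullback hF) p hx
  rwa [mvfderiv_form_of_related hF hθ' h hU hX hx, mvfderiv_form_of_related hF hθ' h hU hY hx,
    ← h p (mlieBracket _ _ _ _), hF.mfderiv_mlieBracket hU hX hY hx, hF.mfderiv_mpullback,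
    hF.mfderiv_mpullback] at this

omit [CompleteSpace E] in
theorem ConnRelated.covDerivForm_eq (hD : ConnRelated F D D') (hF : IsLocalDiffeomorph I I ∞ F)
    (hθ' : IsSmoothForm θ') (h : ∀ p v, θ' (F p) (mfderiv I I F p v) = θ p v) (hU : IsOpen U)
    (hY : SmoothFieldOn Y U) (hp : F p ∈ U) :
    covDerivForm D θ (mpullback I I F X) (mpullback I I F Y) p = covDerivForm D' θ' X Y (F p) := by
  simp only [covDerivForm]
  rw [mvfderiv_form_of_related hF hθ' h hU hY hp, ← h p (D _ _ _), hD U hU Y hY p hp,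
    hF.mfderiv_mpullback]

omit [CompleteSpace E] in
theorem ConnRelated.covDerivBilin_eq (hD : ConnRelated F D D') (hF : IsLocalDiffeomorph I I ∞ F)
    (hb' : IsSmoothBilin b')
    (h : ∀ p v w, b' (F p) (mfderiv I I F p v) (mfderiv I I F p w) = b p v w) (hU : IsOpen U)
    (hY : SmoothFieldOn Y U) (hZ : SmoothFieldOn Z U) (hp : F p ∈ U) :
    covDerivBilin D b (mpullback I I F X) (mpullback I I F Y) (mpullback I I F Z) p =
      covDerivBilin D' b' X Y Z (F p) := by
  simp only [covDerivBilin]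
  rw [mvfderiv_bilin_of_related hF hb' h hU hY hZ hp, ← h p (D _ _ _), ← h p _ (D _ _ _),
    hD U hU Y hY p hp, hD U hU Z hZ p hp, hF.mfderiv_mpullback, hF.mfderiv_mpullback,
    hF.mfderiv_mpullback]

theorem lieDerivBilin_of_related (hF : IsLocalDiffeomorph I I ∞ F) (hb' : IsSmoothBilin b')
    (h : ∀ p v w, b' (F p) (mfderiv I I F p v) (mfderiv I I F p w) = b p v w) (hU : IsOpen U)
    (hX : SmoothFieldOn X U) (hY : SmoothFieldOn Y U) (hZ : SmoothFieldOn Z U) (hp : F p ∈ U) :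
    lieDerivBilin b (mpullback I I F X) (mpullback I I F Y) (mpullback I I F Z) p =
      lieDerivBilin b' X Y Z (F p) := by
  simp only [lieDerivBilin]
  rw [mvfderiv_bilin_of_related hF hb' h hU hY hZ hp, ← h p (mlieBracket _ _ _ _),
    ← h p _ (mlieBracket _ _ _ _), hF.mfderiv_mlieBracket hU hX hY hp,
    hF.mfderiv_mlieBracket hU hX hZ hp, hF.mfderiv_mpullback, hF.mfderiv_mpullback,
    hF.mfderiv_mpullback]

end Descent

/-! ### Pushing structures forward through chosen preimages -/

section Push

variable {E : Type*} [NormedAddCommGroup E] [NormedSpace ℝ E] [CompleteSpace E]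
  {H : Type*} [TopologicalSpace H] {I : ModelWithCorners ℝ E H}
  {N : Type*} [TopologicalSpace N] [ChartedSpace H N] [IsManifold I ∞ N]
  {C : Type*} [TopologicalSpace C] [ChartedSpace H C] [IsManifold I ∞ C]
  {F : N → C}

/-- The covariant derivative of the pullback of `Y` at `p`, transported to `F p`. -/
def pushConnAt (F : N → C) (D : AffineConnection I N) (Y : Π x : C, TangentSpace I x) (p : N) :
    TangentSpace I (F p) →L[ℝ] TangentSpace I (F p) :=
  mfderiv I I F p ∘L D (mpullback I I F Y) p ∘L (mfderiv I I F p).inverse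

theorem pushConnAt_add (hF : IsLocalDiffeomorph I I ∞ F) (D : AffineConnection I N)
    {Y Z : Π x : C, TangentSpace I x} {p : N}
    (hY : MDifferentiableAt I I.tangent (fun x => (⟨x, Y x⟩ : TangentBundle I C)) (F p))
    (hZ : MDifferentiableAt I I.tangent (fun x => (⟨x, Z x⟩ : TangentBundle I C)) (F p)) :
    pushConnAt F D (Y + Z) p = pushConnAt F D Y p + pushConnAt F D Z p := by
  have hY' := hY.mpullback_vectorField (n := ∞) hF.contMDiff.contMDiffAt (hF.isInvertible_mfderiv p)
    (WithTop.coe_le_coe.2 (le_top : (2 : ℕ∞) ≤ ⊤))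
  have hZ' := hZ.mpullback_vectorField (n := ∞) hF.contMDiff.contMDiffAt (hF.isInvertible_mfderiv p)
    (WithTop.coe_le_coe.2 (le_top : (2 : ℕ∞) ≤ ⊤))
  have h := D.isCovariantDerivativeOnUniv.add hY' hZ'
  simp only [pushConnAt, mpullback_add]
  rw [h]
  simp

theorem pushConnAt_leibniz (hF : IsLocalDiffeomorph I I ∞ F) (D : AffineConnection I N)
    {Y : Π x : C, TangentSpace I x} {f : C → ℝ} {p : N}
    (hY : MDifferentiableAt I I.tangent (fun x => (⟨x, Y x⟩ : TangentBundle I C)) (F p))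
    (hf : MDifferentiableAt I 𝓘(ℝ) f (F p)) :
    pushConnAt F D (f • Y) p =
      f (F p) • pushConnAt F D Y p + (mvfderiv I f (F p)).smulRight (Y (F p)) := by
  have hY' := hY.mpullback_vectorField (n := ∞) hF.contMDiff.contMDiffAt (hF.isInvertible_mfderiv p)
    (WithTop.coe_le_coe.2 (le_top : (2 : ℕ∞) ≤ ⊤))
  have hf' : MDifferentiableAt I 𝓘(ℝ) (fun q => f (F q)) p :=
    hf.comp p (hF.contMDiff.contMDiffAt.mdifferentiableAt (by simp))
  have h := D.isCovariantDerivativeOnUniv.leibniz hY' hf'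
  have e : mpullback I I F (f • Y) = (fun q => f (F q)) • mpullback I I F Y := by
    funext q
    simp [VectorField.mpullback_apply]
  ext v
  simp only [pushConnAt, e]
  rw [h]
  simp [hF.mvfderiv_comp hf, hF.mfderiv_mpullback, hF.mfderiv_inverse]

/-- The connection on `C` obtained from `D` by means of a section of `F`. -/
def pushConn (hF : IsLocalDiffeomorph I I ∞ F) (hsurj : Function.Surjective F)
    (D : AffineConnection I N) : AffineConnection I C where
  toFun Y x := (pushConnAt F D Y (Function.surjInv hsurj x) : E →L[ℝ] E)
  isCovariantDerivativeOnUniv :=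
    { add := by
        intro Y Z x hY hZ _
        have hx := Function.surjInv_eq hsurj x
        -- Forgetting which preimage was chosen allows `x` to be replaced by `F p`, so no transport
        -- between tangent spaces is needed.
        generalize Function.surjInv hsurj x = p at hx
        subst hx
        exact pushConnAt_add hF D hY hZ
      leibniz := by
        intro Y f x hY hf _
        have hx := Function.surjInv_eq hsurj x
        generalize Function.surjInv hsurj x = p at hx
        subst hx
        exact pushConnAt_leibniz hF D hY hf }

/-- The pushed connection uses one preimage of each point; it is related to `D` at all preimages
once the result is constant along fibres. That constancy is stated in `E →L[ℝ] E`, the common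
underlying type, because `F p` and `F p'` are only propositionally equal. -/
theorem connRelated_pushConn (hF : IsLocalDiffeomorph I I ∞ F) (hsurj : Function.Surjective F)
    (D : AffineConnection I N)
    (hinv : ∀ U : Set C, IsOpen U → ∀ Y : Π x : C, TangentSpace I x, SmoothFieldOn Y U →
      ∀ p p' : N, F p ∈ U → F p = F p' →
        (pushConnAt F D Y p : E →L[ℝ] E) = pushConnAt F D Y p') :
    ConnRelated F D (pushConn hF hsurj D) := by
  intro U hU Y hY p hp v
  have h : (pushConn hF hsurj D) Y (F p) = pushConnAt F D Y p :=
    (hinv U hU Y hY p _ hp (Function.surjInv_eq hsurj (F p)).symm).symm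
  rw [h]
  simp [pushConnAt, hF.inverse_mfderiv]

/-- A 1-form at `p`, transported to `F p`. -/
def pushFormAt (F : N → C) (θ : Π p : N, TangentSpace I p →L[ℝ] ℝ) (p : N) :
    TangentSpace I (F p) →L[ℝ] ℝ :=
  θ p ∘L (mfderiv I I F p).inverse

def pushForm (hsurj : Function.Surjective F) (θ : Π p : N, TangentSpace I p →L[ℝ] ℝ) (x : C) :
    TangentSpace I x →L[ℝ] ℝ :=
  (pushFormAt F θ (Function.surjInv hsurj x) : E →L[ℝ] ℝ)

omit [CompleteSpace E] [IsManifold I ∞ N] [IsManifold I ∞ C] in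
theorem pushForm_apply (hF : IsLocalDiffeomorph I I ∞ F) (hsurj : Function.Surjective F)
    {θ : Π p : N, TangentSpace I p →L[ℝ] ℝ}
    (hinv : ∀ p p' : N, F p = F p' → (pushFormAt F θ p : E →L[ℝ] ℝ) = pushFormAt F θ p')
    (p : N) (v : TangentSpace I p) : pushForm hsurj θ (F p) (mfderiv I I F p v) = θ p v := by
  have h : pushForm hsurj θ (F p) = pushFormAt F θ p :=
    (hinv p _ (Function.surjInv_eq hsurj (F p)).symm).symm
  rw [h]
  simp [pushFormAt, hF.inverse_mfderiv]

/-- A bilinear form at `p`, transported to `F p`. -/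
def pushBilinAt (F : N → C) (b : Π p : N, TangentSpace I p →L[ℝ] TangentSpace I p →L[ℝ] ℝ)
    (p : N) : TangentSpace I (F p) →L[ℝ] TangentSpace I (F p) →L[ℝ] ℝ :=
  letI A : E →L[ℝ] E := (mfderiv I I F p).inverse
  letI B : E →L[ℝ] E →L[ℝ] ℝ := b p
  letI B' : E →L[ℝ] E →L[ℝ] ℝ := B.bilinearComp A A
  B'

omit [CompleteSpace E] [IsManifold I ∞ N] [IsManifold I ∞ C] in
theorem pushBilinAt_apply (F : N → C)
    (b : Π p : N, TangentSpace I p →L[ℝ] TangentSpace I p →L[ℝ] ℝ) (p : N)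
    (v w : TangentSpace I (F p)) : pushBilinAt F b p v w =
      b p ((mfderiv I I F p).inverse v) ((mfderiv I I F p).inverse w) := rfl

def pushBilin (hsurj : Function.Surjective F)
    (b : Π p : N, TangentSpace I p →L[ℝ] TangentSpace I p →L[ℝ] ℝ) (x : C) :
    TangentSpace I x →L[ℝ] TangentSpace I x →L[ℝ] ℝ :=
  (pushBilinAt F b (Function.surjInv hsurj x) : E →L[ℝ] E →L[ℝ] ℝ)

omit [CompleteSpace E] [IsManifold I ∞ N] [IsManifold I ∞ C] in
theorem pushBilin_apply (hF : IsLocalDiffeomorph I I ∞ F) (hsurj : Function.Surjective F)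
    {b : Π p : N, TangentSpace I p →L[ℝ] TangentSpace I p →L[ℝ] ℝ}
    (hinv : ∀ p p' : N, F p = F p' → (pushBilinAt F b p : E →L[ℝ] E →L[ℝ] ℝ) = pushBilinAt F b p')
    (p : N) (v w : TangentSpace I p) :
    pushBilin hsurj b (F p) (mfderiv I I F p v) (mfderiv I I F p w) = b p v w := by
  have h : pushBilin hsurj b (F p) = pushBilinAt F b p :=
    (hinv p _ (Function.surjInv_eq hsurj (F p)).symm).symm
  rw [h, pushBilinAt_apply, hF.inverse_mfderiv, hF.inverse_mfderiv]

def pushField (hsurj : Function.Surjective F) (ξ : Π p : N, TangentSpace I p) (x : C) :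
    TangentSpace I x :=
  (mfderiv I I F (Function.surjInv hsurj x) (ξ (Function.surjInv hsurj x)) : E)

omit [CompleteSpace E] [IsManifold I ∞ N] [IsManifold I ∞ C] in
theorem mpullback_pushField (hF : IsLocalDiffeomorph I I ∞ F) (hsurj : Function.Surjective F)
    {ξ : Π p : N, TangentSpace I p}
    (hinv : ∀ p p' : N, F p = F p' → (mfderiv I I F p (ξ p) : E) = mfderiv I I F p' (ξ p')) :
    mpullback I I F (pushField hsurj ξ) = ξ := by
  funext p
  have h : pushField hsurj ξ (F p) = mfderiv I I F p (ξ p) :=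
    (hinv p _ (Function.surjInv_eq hsurj (F p)).symm).symm
  rw [VectorField.mpullback_apply, h, hF.inverse_mfderiv]

/-- A Riemannian metric on the target of a surjective local diffeomorphism. -/
def pushMetric [FiniteDimensional ℝ E] (hF : IsLocalDiffeomorph I I ∞ F)
    (hsurj : Function.Surjective F) (g : RiemMetric I N)
    (hinv : ∀ p p' : N, F p = F p' →
      (pushBilinAt F g.inner p : E →L[ℝ] E →L[ℝ] ℝ) = pushBilinAt F g.inner p') :
    RiemMetric I C :=
  RiemMetric.ofPosDef (pushBilin hsurj g.inner)
    (g.isSmoothBilin.of_related hF hsurj (pushBilin_apply hF hsurj hinv))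
    (by
      intro x v w
      obtain ⟨p, rfl⟩ := hsurj x
      rw [← hF.mfderiv_inverse p v, ← hF.mfderiv_inverse p w, pushBilin_apply hF hsurj hinv,
        pushBilin_apply hF hsurj hinv, g.symm])
    (by
      intro x v hv
      obtain ⟨p, rfl⟩ := hsurj x
      rw [← hF.mfderiv_inverse p v] at hv ⊢
      rw [pushBilin_apply hF hsurj hinv]
      exact g.pos _ _ fun h => hv (by rw [h, map_zero]))

theorem pushMetric_apply [FiniteDimensional ℝ E] (hF : IsLocalDiffeomorph I I ∞ F)
    (hsurj : Function.Surjective F) (g : RiemMetric I N)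
    (hinv : ∀ p p' : N, F p = F p' →
      (pushBilinAt F g.inner p : E →L[ℝ] E →L[ℝ] ℝ) = pushBilinAt F g.inner p')
    (p : N) (v w : TangentSpace I p) :
    (pushMetric hF hsurj g hinv).inner (F p) (mfderiv I I F p v) (mfderiv I I F p w) =
      g.inner p v w :=
  pushBilin_apply hF hsurj hinv p v w

end Push

/-! ### Descent of Koszul-type Hessian and radiant l.c.H. structures -/

section DescentStructures

variable {E : Type*} [NormedAddCommGroup E] [NormedSpace ℝ E] [CompleteSpace E]
  [FiniteDimensional ℝ E]
  {H : Type*} [TopologicalSpace H] {I : ModelWithCorners ℝ E H}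
  {N : Type*} [TopologicalSpace N] [ChartedSpace H N] [IsManifold I ∞ N]
  {C : Type*} [TopologicalSpace C] [ChartedSpace H C] [IsManifold I ∞ C]
  {F : N → C} {D : AffineConnection I N} {D' : AffineConnection I C}
  {θ : Π p : N, TangentSpace I p →L[ℝ] ℝ} {θ' : Π x : C, TangentSpace I x →L[ℝ] ℝ}
  {g : RiemMetric I N} {g' : RiemMetric I C}
  {ξ : Π p : N, TangentSpace I p} {ξ' : Π x : C, TangentSpace I x}

/-- Each axiom is an identity at a point for local fields. The fields are pulled back, the identity
upstairs is used at a preimage, and relatedness translates every term. -/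
theorem ConnRelated.isKoszulHessian (hD : ConnRelated F D D') (hF : IsLocalDiffeomorph I I ∞ F)
    (hsurj : Function.Surjective F)
    (hg : ∀ p v w, g'.inner (F p) (mfderiv I I F p v) (mfderiv I I F p w) = g.inner p v w)
    (hθ : ∀ p v, θ' (F p) (mfderiv I I F p v) = θ p v) (hs : IsSmoothConn D) (hθs : IsSmoothForm θ)
    (h : IsKoszulHessian D g θ) : IsKoszulHessian D' g' θ' where
  toIsFlatAffine := hD.isFlatAffine hF hsurj hs h.toIsFlatAffine
  symm U hU X Y Z hX hY hZ x hx := by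
    obtain ⟨p, rfl⟩ := hsurj x
    have := h.symm _ (hU.preimage hF.contMDiff.continuous) _ _ _ (hX.mpullback hF)
      (hY.mpullback hF) (hZ.mpullback hF) p hx
    rwa [hD.covDerivBilin_eq hF g'.isSmoothBilin hg hU hY hZ hx,
      hD.covDerivBilin_eq hF g'.isSmoothBilin hg hU hX hZ hx,
      hD.covDerivBilin_eq hF g'.isSmoothBilin hg hU hZ hY hx] at this
  smooth_form := (hθs.of_related hF hsurj hθ).smoothOneForm
  closed := h.closed.of_related hF hsurj (hθs.of_related hF hsurj hθ) hθ
  metric_eq U hU X Y hX hY x hx := by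
    obtain ⟨p, rfl⟩ := hsurj x
    rw [← hD.covDerivForm_eq hF (hθs.of_related hF hsurj hθ) hθ hU hY hx, ← h.metric_eq _
      (hU.preimage hF.contMDiff.continuous) _ _ (hX.mpullback hF) (hY.mpullback hF) p hx, ← hg,
      hF.mfderiv_mpullback, hF.mfderiv_mpullback]

theorem ConnRelated.isRadiantLCH (hD : ConnRelated F D D') (hF : IsLocalDiffeomorph I I ∞ F)
    (hsurj : Function.Surjective F)
    (hg : ∀ p v w, g'.inner (F p) (mfderiv I I F p v) (mfderiv I I F p w) = g.inner p v w)
    (hθ : ∀ p v, θ' (F p) (mfderiv I I F p v) = θ p v) (hξ : mpullback I I F ξ' = ξ)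
    (hs : IsSmoothConn D) (hθs : IsSmoothForm θ) {μ : ℝ}
    (h : IsRadiantLCH D g θ ξ μ) : IsRadiantLCH D' g' θ' ξ' μ where
  toIsFlatAffine := hD.isFlatAffine hF hsurj hs h.toIsFlatAffine
  symm U hU X Y Z hX hY hZ x hx := by
    obtain ⟨p, rfl⟩ := hsurj x
    have := h.symm _ (hU.preimage hF.contMDiff.continuous) _ _ _ (hX.mpullback hF)
      (hY.mpullback hF) (hZ.mpullback hF) p hx
    simpa only [hD.covDerivBilin_eq hF g'.isSmoothBilin hg hU hY hZ hx,
      hD.covDerivBilin_eq hF g'.isSmoothBilin hg hU hX hZ hx,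
      hD.covDerivBilin_eq hF g'.isSmoothBilin hg hU hZ hY hx, ← hg, ← hθ,
      hF.mfderiv_mpullback] using this
  smooth_form := (hθs.of_related hF hsurj hθ).smoothOneForm
  closed := h.closed.of_related hF hsurj (hθs.of_related hF hsurj hθ) hθ
  smooth_field := hF.smoothField_of_mpullback hsurj isOpen_univ (by rw [hξ]; exact h.smooth_field)
  lee x v := by
    obtain ⟨p, rfl⟩ := hsurj x
    rw [← hF.mfderiv_inverse p v, hθ, ← hF.mfderiv_mpullback p ξ', hg, hξ, h.lee]
  killing U hU Y Z hY hZ x hx := by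
    obtain ⟨p, rfl⟩ := hsurj x
    have hξs : SmoothFieldOn ξ' univ :=
      hF.smoothField_of_mpullback hsurj isOpen_univ (by rw [hξ]; exact h.smooth_field)
    have h1 := h.killing _ (hU.preimage hF.contMDiff.continuous) _ _ (hY.mpullback hF)
      (hZ.mpullback hF) p hx
    rw [← hξ] at h1
    exact (lieDerivBilin_of_related hF g'.isSmoothBilin hg hU
      (ContMDiffOn.mono hξs (subset_univ U)) hY hZ hx).symm.trans h1
  radiant x v := by
    obtain ⟨p, rfl⟩ := hsurj x
    have hξs : SmoothFieldOn ξ' univ :=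
      hF.smoothField_of_mpullback hsurj isOpen_univ (by rw [hξ]; exact h.smooth_field)
    rw [← hF.mfderiv_inverse p v, ← hD _ isOpen_univ _ hξs p (mem_univ _), hξ, h.radiant, map_smul]

end DescentStructures

/-! ### Vector fields and brackets on `M × ℝ` -/

section Cylinder

variable {E : Type*} [NormedAddCommGroup E] [NormedSpace ℝ E]
  {H : Type*} [TopologicalSpace H] {I : ModelWithCorners ℝ E H}
  {M : Type*} [TopologicalSpace M] [ChartedSpace H M] [IsManifold I ∞ M]

theorem contMDiffAt_tangent_real {E' H' P : Type*} [NormedAddCommGroup E'] [NormedSpace ℝ E']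
    [TopologicalSpace H'] {J : ModelWithCorners ℝ E' H'} [TopologicalSpace P] [ChartedSpace H' P]
    {f τ : P → ℝ} {p : P} (hf : ContMDiffAt J 𝓘(ℝ) ∞ f p) (hτ : ContMDiffAt J 𝓘(ℝ) ∞ τ p) :
    ContMDiffAt J 𝓘(ℝ).tangent ∞ (fun q => (⟨f q, τ q⟩ : TangentBundle 𝓘(ℝ) ℝ)) p := by
  rw [contMDiffAt_totalSpace]
  exact ⟨hf, by simpa using hτ⟩

/-- A field on `M × ℝ` is smooth if its two components are. -/
theorem contMDiffAt_prod_field {W : Π p : M × ℝ, TangentSpace (I.prod 𝓘(ℝ)) p} {p : M × ℝ} :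
    ContMDiffAt (I.prod 𝓘(ℝ)) (I.prod 𝓘(ℝ)).tangent ∞
      (fun q => (⟨q, W q⟩ : TangentBundle (I.prod 𝓘(ℝ)) (M × ℝ))) p ↔
    ContMDiffAt (I.prod 𝓘(ℝ)) I.tangent ∞ (fun q => (⟨q.1, (W q).1⟩ : TangentBundle I M)) p ∧
      ContMDiffAt (I.prod 𝓘(ℝ)) 𝓘(ℝ) ∞ (fun q => (W q).2) p := by
  constructor
  · intro h
    have h1 := (contMDiff_equivTangentBundleProd (I := I) (M := M) (I' := 𝓘(ℝ)) (M' := ℝ)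
      (n := ∞)).contMDiffAt.comp p h
    exact ⟨h1.fst, (contMDiff_snd_tangentBundle_modelSpace ℝ 𝓘(ℝ)).contMDiffAt.comp p h1.snd⟩
  · rintro ⟨h1, h2⟩
    have h3 := h1.prodMk (contMDiffAt_tangent_real contMDiffAt_snd h2)
    exact (contMDiff_equivTangentBundleProd_symm (I := I) (M := M) (I' := 𝓘(ℝ)) (M' := ℝ)
      (n := ∞)).contMDiffAt.comp p h3

/-- The restriction to `M × {t}` of the `M`-component of a field on `M × ℝ`. -/
def sliceField (W : Π p : M × ℝ, TangentSpace (I.prod 𝓘(ℝ)) p) (t : ℝ) :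
    Π m : M, TangentSpace I m := fun m => (W (m, t)).1

theorem mdifferentiableAt_sliceField {W : Π p : M × ℝ, TangentSpace (I.prod 𝓘(ℝ)) p} {p : M × ℝ}
    (h : MDifferentiableAt (I.prod 𝓘(ℝ)) (I.prod 𝓘(ℝ)).tangent
      (fun q => (⟨q, W q⟩ : TangentBundle (I.prod 𝓘(ℝ)) (M × ℝ))) p) :
    MDifferentiableAt I I.tangent
      (fun m => (⟨m, sliceField W p.2 m⟩ : TangentBundle I M)) p.1 := by
  have h1 := ((contMDiff_equivTangentBundleProd (I := I) (M := M) (I' := 𝓘(ℝ)) (M' := ℝ)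
      (n := ∞)).contMDiffAt.mdifferentiableAt (by simp)).comp p h
  have h2 : MDifferentiableAt I (I.prod 𝓘(ℝ)) (fun m : M => (m, p.2)) p.1 :=
    mdifferentiableAt_id.prodMk mdifferentiableAt_const
  exact MDifferentiableAt.comp p.1 h1.fst h2

theorem mdifferentiableAt_snd_field {W : Π p : M × ℝ, TangentSpace (I.prod 𝓘(ℝ)) p} {p : M × ℝ}
    (h : MDifferentiableAt (I.prod 𝓘(ℝ)) (I.prod 𝓘(ℝ)).tangent
      (fun q => (⟨q, W q⟩ : TangentBundle (I.prod 𝓘(ℝ)) (M × ℝ))) p) :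
    MDifferentiableAt (I.prod 𝓘(ℝ)) 𝓘(ℝ) (fun q => ((W q).2 : ℝ)) p := by
  have h1 := ((contMDiff_equivTangentBundleProd (I := I) (M := M) (I' := 𝓘(ℝ)) (M' := ℝ)
      (n := ∞)).contMDiffAt.mdifferentiableAt (by simp)).comp p h
  exact ((contMDiff_snd_tangentBundle_modelSpace ℝ 𝓘(ℝ) (n := ∞)).contMDiffAt.mdifferentiableAt
    (by simp)).comp p h1.snd

theorem SmoothFieldOn.sliceField {W : Π p : M × ℝ, TangentSpace (I.prod 𝓘(ℝ)) p}
    {U : Set (M × ℝ)} (hU : IsOpen U) (h : SmoothFieldOn W U) (t : ℝ) :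
    SmoothFieldOn (sliceField W t) ((fun m : M => (m, t)) ⁻¹' U) := by
  intro m hm
  have h2 : ContMDiffAt I (I.prod 𝓘(ℝ)) ∞ (fun m : M => (m, t)) m :=
    contMDiffAt_id.prodMk contMDiffAt_const
  exact ContMDiffAt.contMDiffWithinAt (ContMDiffAt.comp m
    (contMDiffAt_prod_field.1 (h.contMDiffAt hU hm)).1 h2)

omit [IsManifold I ∞ M] in
theorem mvfderiv_slice {f : M × ℝ → ℝ} {p : M × ℝ}
    (hf : MDifferentiableAt (I.prod 𝓘(ℝ)) 𝓘(ℝ) f p) (u : TangentSpace I p.1) :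
    mvfderiv I (fun m => f (m, p.2)) p.1 u =
      mvfderiv (I.prod 𝓘(ℝ)) f p ((u, (0 : ℝ)) : E × ℝ) := by
  have h2 : MDifferentiableAt I (I.prod 𝓘(ℝ)) (fun m : M => (m, p.2)) p.1 :=
    mdifferentiableAt_id.prodMk mdifferentiableAt_const
  have h3 := mvfderiv_comp_apply p.1 hf h2 u
  rw [mfderiv_prod_left] at h3
  exact h3

omit [IsManifold I ∞ M] in
theorem mvfderiv_comp_fst {f : M → ℝ} {p : M × ℝ} (hf : MDifferentiableAt I 𝓘(ℝ) f p.1)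
    (v : TangentSpace (I.prod 𝓘(ℝ)) p) :
    mvfderiv (I.prod 𝓘(ℝ)) (fun q => f q.1) p v = mvfderiv I f p.1 v.1 := by
  have h3 := mvfderiv_comp_apply p hf (mdifferentiableAt_fst (I' := 𝓘(ℝ))) v
  rw [mfderiv_fst] at h3
  exact h3

omit [IsManifold I ∞ M] in
theorem mvfderiv_snd (p : M × ℝ) (v : TangentSpace (I.prod 𝓘(ℝ)) p) :
    mvfderiv (I.prod 𝓘(ℝ)) (fun q : M × ℝ => q.2) p v = v.2 := by
  have := congr($(mfderiv_snd (I := I) (I' := 𝓘(ℝ)) (x := p)) v)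
  exact this

/-- The field `V + f ∂_t` on `M × ℝ`. -/
def cylField (V : Π m : M, TangentSpace I m) (f : M → ℝ) :
    Π p : M × ℝ, TangentSpace (I.prod 𝓘(ℝ)) p :=
  fun p => ((V p.1, f p.1) : E × ℝ)

variable {V V' : Π m : M, TangentSpace I m} {f f' : M → ℝ} {U : Set M}

theorem smoothFieldOn_cylField (hU : IsOpen U) (hV : SmoothFieldOn V U)
    (hf : ContMDiffOn I 𝓘(ℝ) ∞ f U) :
    SmoothFieldOn (cylField V f) (Prod.fst ⁻¹' U : Set (M × ℝ)) := by
  intro p hp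
  refine ContMDiffAt.contMDiffWithinAt (contMDiffAt_prod_field.2 ⟨?_, ?_⟩)
  · exact (hV.contMDiffAt hU hp).comp p contMDiffAt_fst
  · exact (hf.contMDiffAt (hU.mem_nhds hp)).comp p contMDiffAt_fst

theorem mvfderiv_congr {E' H' P : Type*} [NormedAddCommGroup E'] [NormedSpace ℝ E']
    [TopologicalSpace H'] {J : ModelWithCorners ℝ E' H'} [TopologicalSpace P] [ChartedSpace H' P]
    {f₁ f₂ : P → ℝ} {x : P} (e : f₁ =ᶠ[𝓝 x] f₂) : mvfderiv J f₁ x = mvfderiv J f₂ x := by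
  ext v
  exact congr($(e.mfderiv_eq) v)

/-- Linear functionals of a chart are smooth local functions; they separate tangent vectors because
the derivative of the chart is injective and the dual of `E` separates points. -/
theorem eq_zero_of_mvfderiv_eq_zero {m : M} {v : TangentSpace I m}
    (h : ∀ U : Set M, IsOpen U → m ∈ U → ∀ f : M → ℝ, ContMDiffOn I 𝓘(ℝ) ∞ f U →
      mvfderiv I f m v = 0) : v = 0 := by
  have h1 := isInvertible_mfderiv_extChartAt (I := I) (mem_extChartAt_source (I := I) m)
  have h2 : mfderiv I 𝓘(ℝ, E) (extChartAt I m) m v = 0 := by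
    refine SeparatingDual.eq_zero_of_forall_dual_eq_zero (R := ℝ) (V := E) fun l => ?_
    have h3 := h _ (chartAt H m).open_source (mem_chart_source H m) (fun y => l (extChartAt I m y))
      (l.contMDiff.comp_contMDiffOn contMDiffOn_extChartAt)
    have h4 : MDifferentiableAt I 𝓘(ℝ, E) (extChartAt I m) m :=
      mdifferentiableAt_extChartAt (mem_chart_source H m)
    have h5 : mfderiv I 𝓘(ℝ) (fun y => l (extChartAt I m y)) m =
        l ∘L mfderiv I 𝓘(ℝ, E) (extChartAt I m) m :=
      (l.hasMFDerivAt.comp m h4.hasMFDerivAt).mfderiv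
    exact (congr($h5 v)).symm.trans h3
  exact h1.injective (h2.trans (map_zero _).symm)

variable [CompleteSpace E] [FiniteDimensional ℝ E]

/-- A bracket is known from its action on functions: functions pulled back from `M` detect the first
component, the coordinate `t` the second. -/
theorem mlieBracket_cylField (hU : IsOpen U) (hV : SmoothFieldOn V U) (hV' : SmoothFieldOn V' U)
    (hf : ContMDiffOn I 𝓘(ℝ) ∞ f U) (hf' : ContMDiffOn I 𝓘(ℝ) ∞ f' U) {p : M × ℝ}
    (hp : p.1 ∈ U) :
    mlieBracket (I.prod 𝓘(ℝ)) (cylField V f) (cylField V' f') p =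
      cylField (mlieBracket I V V')
        (fun m => mvfderiv I f' m (V m) - mvfderiv I f m (V' m)) p := by
  have hW := smoothFieldOn_cylField hU hV hf
  have hW' := smoothFieldOn_cylField hU hV' hf'
  have hU' : IsOpen (Prod.fst ⁻¹' U : Set (M × ℝ)) := hU.preimage continuous_fst
  have diff : ∀ {f : M → ℝ} {U : Set M}, IsOpen U → ContMDiffOn I 𝓘(ℝ) ∞ f U → ∀ {m}, m ∈ U →
      MDifferentiableAt I 𝓘(ℝ) f m := fun hU hf _ hm =>
    (hf.contMDiffAt (hU.mem_nhds hm)).mdifferentiableAt (by simp)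
  refine Prod.ext ?_ ?_
  · rw [← sub_eq_zero]
    refine eq_zero_of_mvfderiv_eq_zero (I := I) (m := p.1) fun O hO hmO φ hφ => ?_
    have hUO := hU.inter hO
    have hUO' : IsOpen (Prod.fst ⁻¹' (U ∩ O) : Set (M × ℝ)) := hUO.preimage continuous_fst
    have hφ' : ContMDiffOn (I.prod 𝓘(ℝ)) 𝓘(ℝ) ∞ (fun q : M × ℝ => φ q.1)
        (Prod.fst ⁻¹' (U ∩ O)) :=
      (hφ.mono inter_subset_right).comp contMDiff_fst.contMDiffOn fun q hq => hq
    have h1 := mvfderiv_mlieBracket hUO' (x := p) ⟨hp, hmO⟩ hφ'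
      (ContMDiffOn.mono hW (preimage_mono inter_subset_left))
      (ContMDiffOn.mono hW' (preimage_mono inter_subset_left))
    have h2 := mvfderiv_mlieBracket hUO (x := p.1) ⟨hp, hmO⟩ (hφ.mono inter_subset_right)
      (ContMDiffOn.mono hV inter_subset_left) (ContMDiffOn.mono hV' inter_subset_left)
    have key : ∀ {V V' : Π m : M, TangentSpace I m} {f f' : M → ℝ}, SmoothFieldOn V U →
        SmoothFieldOn V' U →
        mvfderiv (I.prod 𝓘(ℝ)) (fun q => mvfderiv (I.prod 𝓘(ℝ)) (fun q : M × ℝ => φ q.1) q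
          (cylField V' f' q)) p (cylField V f p) =
        mvfderiv I (fun m => mvfderiv I φ m (V' m)) p.1 (V p.1) := by
      intro V V' f f' hV hV'
      have e : (fun q => mvfderiv (I.prod 𝓘(ℝ)) (fun q : M × ℝ => φ q.1) q
          (cylField V' f' q)) =ᶠ[𝓝 p] fun q => mvfderiv I φ q.1 (V' q.1) := by
        filter_upwards [hUO'.mem_nhds (⟨hp, hmO⟩ : p.1 ∈ U ∩ O)] with q hq
        exact mvfderiv_comp_fst (diff hO hφ hq.2) _
      have h4 : MDifferentiableAt I 𝓘(ℝ) (fun m => mvfderiv I φ m (V' m)) p.1 :=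
        ((hφ.contMDiffAt (hO.mem_nhds hmO)).mvfderiv_field
          (hV'.contMDiffAt hU hp)).mdifferentiableAt (by simp)
      have h5 : mvfderiv (I.prod 𝓘(ℝ)) (fun q => mvfderiv (I.prod 𝓘(ℝ))
          (fun q : M × ℝ => φ q.1) q (cylField V' f' q)) p =
          mvfderiv (I.prod 𝓘(ℝ)) (fun q : M × ℝ => mvfderiv I φ q.1 (V' q.1)) p := by
        exact mvfderiv_congr e
      rw [h5]
      exact mvfderiv_comp_fst h4 _
    rw [key hV hV', key hV' hV, ← h2, mvfderiv_comp_fst (diff hO hφ hmO)] at h1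
    refine (map_sub _ _ _).trans (sub_eq_zero.2 h1)
  · have h1 := mvfderiv_mlieBracket hU' (x := p) hp (f := fun q : M × ℝ => q.2)
      contMDiff_snd.contMDiffOn hW hW'
    have key : ∀ {V V' : Π m : M, TangentSpace I m} {f f' : M → ℝ},
        ContMDiffOn I 𝓘(ℝ) ∞ f' U →
        mvfderiv (I.prod 𝓘(ℝ)) (fun q => mvfderiv (I.prod 𝓘(ℝ)) (fun q : M × ℝ => q.2) q
          (cylField V' f' q)) p (cylField V f p) = mvfderiv I f' p.1 (V p.1) := by
      intro V V' f f' hf'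
      have e : (fun q => mvfderiv (I.prod 𝓘(ℝ)) (fun q : M × ℝ => q.2) q
          (cylField V' f' q)) = fun q => f' q.1 := funext fun q => mvfderiv_snd q _
      rw [e]
      exact mvfderiv_comp_fst (diff hU hf' hp) _
    rw [key hf', key hf, mvfderiv_snd] at h1
    exact h1

end Cylinder

/-! ### The two-parameter family of connections on `M × ℝ` -/

section CylinderConnection

variable {E : Type*} [NormedAddCommGroup E] [NormedSpace ℝ E]
  {H : Type*} [TopologicalSpace H] {I : ModelWithCorners ℝ E H}
  {M : Type*} [TopologicalSpace M] [ChartedSpace H M] [IsManifold I ∞ M]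

theorem smoothFieldOn_zero {U : Set M} : SmoothFieldOn (0 : Π x : M, TangentSpace I x) U :=
  (contMDiff_zeroSection ℝ (fun x : M => TangentSpace I x)).contMDiffOn

variable [CompleteSpace E] [FiniteDimensional ℝ E]

/-- The field `∂_t` on `M × ℝ`. -/
def radialField : Π p : M × ℝ, TangentSpace (I.prod 𝓘(ℝ)) p := cylField 0 1

theorem smoothFieldOn_radialField (U : Set (M × ℝ)) :
    SmoothFieldOn (radialField (I := I)) U :=
  ContMDiffOn.mono (smoothFieldOn_cylField isOpen_univ smoothFieldOn_zero contMDiffOn_const)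
    (fun _ _ => mem_univ _)

section LinearAlgebra

omit [CompleteSpace E] [FiniteDimensional ℝ E]

/-- The pointwise expression for the connection on the cylinder: `A`, `B` are the derivatives of
the components of a field with value `W`, `G` is the `g`-dual of its first component and `Z` its
bracket with the radial field. -/
def cylLin (l a : ℝ) (A : E →L[ℝ] E) (B : E × ℝ →L[ℝ] ℝ) (G : E →L[ℝ] ℝ) (Z W : E × ℝ) :
    E × ℝ →L[ℝ] E × ℝ :=
  ((A + (l * W.2) • ContinuousLinearMap.id ℝ E).prod
      (B ∘L ContinuousLinearMap.inl ℝ E ℝ + a • G)) ∘L ContinuousLinearMap.fst ℝ E ℝ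
    + (ContinuousLinearMap.snd ℝ E ℝ).smulRight (Z + l • W)

variable {l a : ℝ} {A A' : E →L[ℝ] E} {B B' : E × ℝ →L[ℝ] ℝ} {G G' : E →L[ℝ] ℝ} {Z Z' W W' : E × ℝ}

theorem cylLin_apply (v : E × ℝ) :
    cylLin l a A B G Z W v =
      (A v.1 + (l * W.2) • v.1 + v.2 • (Z.1 + l • W.1),
        B (v.1, 0) + a * G v.1 + v.2 * (Z.2 + l * W.2)) := rfl

theorem cylLin_add : cylLin l a (A + A') (B + B') (G + G') (Z + Z') (W + W') =
    cylLin l a A B G Z W + cylLin l a A' B' G' Z' W' := by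
  refine ContinuousLinearMap.ext fun v => ?_
  rw [add_apply, cylLin_apply, cylLin_apply, cylLin_apply]
  refine Prod.ext ?_ ?_
  · simp only [add_apply, Prod.fst_add, Prod.snd_add]
    module
  · simp only [add_apply, Prod.snd_add]
    ring

/-- This is the Leibniz rule with `η = df`: each datum changes by its own product rule, and the
extra terms reassemble to `η ⊗ W` after splitting `η` into its `M`-part and its value on `∂_t`. -/
theorem cylLin_smul (f : ℝ) (η : E × ℝ →L[ℝ] ℝ) :
    cylLin l a (f • A + (η ∘L ContinuousLinearMap.inl ℝ E ℝ).smulRight W.1) (f • B + W.2 • η)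
      (f • G) (η (0, 1) • W + f • Z) (f • W) =
    f • cylLin l a A B G Z W + η.smulRight W := by
  refine ContinuousLinearMap.ext fun v => ?_
  have hv : η v = η (v.1, 0) + v.2 * η (0, 1) := by
    rw [← smul_eq_mul, ← map_smul, ← map_add]
    simp
  simp only [add_apply, smul_apply, cylLin_apply, ContinuousLinearMap.smulRight_apply, hv]
  refine Prod.ext ?_ ?_
  · simp
    module
  · simp
    ring

end LinearAlgebra

/-- The covariant derivative of `W = X + τ ∂_t` on `M × ℝ`: its value on `u + r ∂_t` is
`D_u X + l τ u + (u τ + a g(X, u)) ∂_t + r ([∂_t, W] + l W)`. -/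
def cylConnAt (D : AffineConnection I M) (g : RiemMetric I M) (l a : ℝ)
    (W : Π p : M × ℝ, TangentSpace (I.prod 𝓘(ℝ)) p) (p : M × ℝ) : E × ℝ →L[ℝ] E × ℝ :=
  cylLin l a (D (sliceField W p.2) p.1) (mvfderiv (I.prod 𝓘(ℝ)) (fun q => ((W q).2 : ℝ)) p)
    (g.inner p.1 (W p).1) (mlieBracket (I.prod 𝓘(ℝ)) radialField W p) (W p)

theorem mvfderiv_add_real {E' H' P : Type*} [NormedAddCommGroup E'] [NormedSpace ℝ E']
    [TopologicalSpace H'] {J : ModelWithCorners ℝ E' H'} [TopologicalSpace P] [ChartedSpace H' P]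
    {f₁ f₂ : P → ℝ} {x : P} (h₁ : MDifferentiableAt J 𝓘(ℝ) f₁ x)
    (h₂ : MDifferentiableAt J 𝓘(ℝ) f₂ x) (v : TangentSpace J x) :
    mvfderiv J (fun y => f₁ y + f₂ y) x v = mvfderiv J f₁ x v + mvfderiv J f₂ x v := by
  have := congr($((h₁.hasMFDerivAt.add h₂.hasMFDerivAt).mfderiv) v)
  exact this

theorem mvfderiv_mul_real {E' H' P : Type*} [NormedAddCommGroup E'] [NormedSpace ℝ E']
    [TopologicalSpace H'] {J : ModelWithCorners ℝ E' H'} [TopologicalSpace P] [ChartedSpace H' P]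
    {f₁ f₂ : P → ℝ} {x : P} (h₁ : MDifferentiableAt J 𝓘(ℝ) f₁ x)
    (h₂ : MDifferentiableAt J 𝓘(ℝ) f₂ x) (v : TangentSpace J x) :
    mvfderiv J (fun y => f₁ y * f₂ y) x v = f₁ x * mvfderiv J f₂ x v + f₂ x * mvfderiv J f₁ x v := by
  have := congr($((h₁.hasMFDerivAt.mul h₂.hasMFDerivAt).mfderiv) v)
  exact this

theorem mdifferentiableAt_slice {f : M × ℝ → ℝ} {p : M × ℝ}
    (hf : MDifferentiableAt (I.prod 𝓘(ℝ)) 𝓘(ℝ) f p) :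
    MDifferentiableAt I 𝓘(ℝ) (fun m => f (m, p.2)) p.1 := by
  have h2 : MDifferentiableAt I (I.prod 𝓘(ℝ)) (fun m : M => (m, p.2)) p.1 :=
    mdifferentiableAt_id.prodMk mdifferentiableAt_const
  exact MDifferentiableAt.comp p.1 hf h2

/-- The connection on `M × ℝ` with covariant derivatives `cylConnAt`. -/
def cylConn (D : AffineConnection I M) (g : RiemMetric I M) (l a : ℝ) :
    AffineConnection (I.prod 𝓘(ℝ)) (M × ℝ) where
  toFun W p := cylConnAt D g l a W p
  isCovariantDerivativeOnUniv :=
    { add := by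
        intro W W' p hW hW' _
        have h1 : D (sliceField (W + W') p.2) p.1 = _ :=
          D.isCovariantDerivativeOnUniv.add (mdifferentiableAt_sliceField hW)
            (mdifferentiableAt_sliceField hW')
        have h2 := mlieBracket_add_right (V := radialField (I := I)) hW hW'
        have h3 : mvfderiv (I.prod 𝓘(ℝ)) (fun q => (((W + W') q).2 : ℝ)) p =
            mvfderiv (I.prod 𝓘(ℝ)) (fun q => ((W q).2 : ℝ)) p +
            mvfderiv (I.prod 𝓘(ℝ)) (fun q => ((W' q).2 : ℝ)) p := by
          ext1 v
          exact mvfderiv_add_real (mdifferentiableAt_snd_field hW)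
            (mdifferentiableAt_snd_field hW') v
        have h4 : g.inner p.1 ((W + W') p).1 = g.inner p.1 (W p).1 + g.inner p.1 (W' p).1 :=
          map_add _ _ _
        rw [cylConnAt, h1, h2, h3, h4]
        exact cylLin_add
      leibniz := by
        intro W f p hW hf _
        let A : E →L[ℝ] E := D (sliceField W p.2) p.1
        -- The slice of `f • W` at height `t` is the slice of `W` times `f (·, t)`, whose
        -- differential is the restriction of `df` to directions tangent to `M`.
        have h1 : @Eq (E →L[ℝ] E) (D (sliceField (f • W) p.2) p.1) (f p • A +
              (((mvfderiv (I.prod 𝓘(ℝ)) f p : E × ℝ →L[ℝ] ℝ) ∘L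
                ContinuousLinearMap.inl ℝ E ℝ).smulRight ((W p).1 : E))) := by
          have h := D.isCovariantDerivativeOnUniv.leibniz (mdifferentiableAt_sliceField hW)
            (mdifferentiableAt_slice hf)
          ext1 v
          have h' := congr($h v)
          exact h'.trans (congrArg (fun z : ℝ => f p • A v + z • ((W p).1 : E))
            (mvfderiv_slice hf v))
        have h2 := mlieBracket_smul_right (V := radialField (I := I)) hf hW
        have h3 : mvfderiv (I.prod 𝓘(ℝ)) (fun q => (((f • W) q).2 : ℝ)) p =
            f p • mvfderiv (I.prod 𝓘(ℝ)) (fun q => ((W q).2 : ℝ)) p +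
              (W p).2 • mvfderiv (I.prod 𝓘(ℝ)) f p := by
          ext1 v
          exact mvfderiv_mul_real hf (mdifferentiableAt_snd_field hW) v
        have h4 : g.inner p.1 ((f • W) p).1 = f p • g.inner p.1 (W p).1 :=
          map_smul _ _ _
        rw [cylConnAt, h1, h2, h3, h4]
        exact cylLin_smul _ _ }

theorem cylConn_apply (D : AffineConnection I M) (g : RiemMetric I M) (l a : ℝ)
    (W : Π p : M × ℝ, TangentSpace (I.prod 𝓘(ℝ)) p) (p : M × ℝ) (v : E × ℝ) :
    cylConn D g l a W p v =
      cylLin (E := E) l a (D (sliceField W p.2) p.1)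
        (mvfderiv (I.prod 𝓘(ℝ)) (fun q => ((W q).2 : ℝ)) p) (g.inner p.1 (W p).1)
        (mlieBracket (I.prod 𝓘(ℝ)) radialField W p) (W p) v := rfl

theorem mvfderiv_const_real {x : M} (c : ℝ) : mvfderiv I (fun _ : M => c) x = 0 :=
  mfderiv_const (I := I) (I' := 𝓘(ℝ)) (c := c) (x := x)

theorem mlieBracket_radialField_cylField {V : Π m : M, TangentSpace I m} {f : M → ℝ} {U : Set M}
    (hU : IsOpen U) (hV : SmoothFieldOn V U) (hf : ContMDiffOn I 𝓘(ℝ) ∞ f U) {p : M × ℝ}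
    (hp : p.1 ∈ U) : mlieBracket (I.prod 𝓘(ℝ)) radialField (cylField V f) p = 0 := by
  refine (mlieBracket_cylField hU smoothFieldOn_zero hV contMDiffOn_const hf hp).trans ?_
  refine Prod.ext ?_ ?_
  · exact congr($(mlieBracket_zero_left (I := I) (W := V)) p.1)
  · change mvfderiv I f p.1 0 - mvfderiv I (fun _ => (1 : ℝ)) p.1 (V p.1) = 0
    rw [map_zero, mvfderiv_const_real]
    exact sub_zero 0

/-- A field independent of `t` commutes with `∂_t`, so the bracket term drops out and `∇_{∂_t}` acts
on it as the scalar `l`. -/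
theorem cylConn_cylField (D : AffineConnection I M) (g : RiemMetric I M) (l a : ℝ)
    {V : Π m : M, TangentSpace I m} {f : M → ℝ} {U : Set M} (hU : IsOpen U)
    (hV : SmoothFieldOn V U) (hf : ContMDiffOn I 𝓘(ℝ) ∞ f U) {p : M × ℝ} (hp : p.1 ∈ U)
    (u : TangentSpace I p.1) (r : ℝ) :
    cylConn D g l a (cylField V f) p ((u, r) : E × ℝ) =
      ((D V p.1 u + l • (f p.1 • u + r • V p.1),
        mvfderiv I f p.1 u + a * g.inner p.1 (V p.1) u + l * (f p.1 * r)) : E × ℝ) := by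
  have hb := mlieBracket_radialField_cylField hU hV hf hp
  have hd : MDifferentiableAt I 𝓘(ℝ) f p.1 :=
    (hf.contMDiffAt (hU.mem_nhds hp)).mdifferentiableAt (by simp)
  have h1 : mvfderiv (I.prod 𝓘(ℝ)) (fun q => ((cylField (I := I) V f q).2 : ℝ)) p
      ((u, (0 : ℝ)) : E × ℝ) = mvfderiv I f p.1 u :=
    mvfderiv_comp_fst hd _
  rw [cylConn_apply, hb]
  refine (cylLin_apply _).trans (Prod.ext ?_ ?_)
  · change D V p.1 u + (l * f p.1) • u + r • (0 + l • V p.1) =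
      D V p.1 u + l • (f p.1 • u + r • V p.1)
    module
  · change mvfderiv (I.prod 𝓘(ℝ)) (fun q => ((cylField (I := I) V f q).2 : ℝ)) p
      ((u, (0 : ℝ)) : E × ℝ) + a * g.inner p.1 (V p.1) u + r * (0 + l * f p.1) =
      mvfderiv I f p.1 u + a * g.inner p.1 (V p.1) u + l * (f p.1 * r)
    rw [h1]
    ring

end CylinderConnection

/-! ### Smoothness of a connection from its values on local frames -/

section SmoothFrames

variable {E : Type*} [NormedAddCommGroup E] [NormedSpace ℝ E]
  {H : Type*} [TopologicalSpace H] {I : ModelWithCorners ℝ E H}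
  {M : Type*} [TopologicalSpace M] [ChartedSpace H M] [IsManifold I ∞ M]

theorem SmoothFieldOn.sum {ι : Type*} (s : Finset ι) {Y : ι → Π x : M, TangentSpace I x} {U : Set M}
    (hY : ∀ i ∈ s, SmoothFieldOn (Y i) U) : SmoothFieldOn (∑ i ∈ s, Y i) U := by
  classical
  induction s using Finset.induction_on with
  | empty => exact smoothFieldOn_zero
  | insert a s ha ih =>
    rw [Finset.sum_insert ha]
    exact (hY a (Finset.mem_insert_self a s)).add
      (ih fun i hi => hY i (Finset.mem_insert_of_mem hi))

theorem SmoothFieldOn.congr {X Y : Π x : M, TangentSpace I x} {U : Set M} (h : SmoothFieldOn X U)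
    (e : ∀ x ∈ U, Y x = X x) : SmoothFieldOn Y U :=
  ContMDiffOn.congr h fun x hx => by rw [e x hx]

theorem AffineConnection.sum_apply (D : AffineConnection I M) {ι : Type*} (s : Finset ι)
    {Y : ι → Π x : M, TangentSpace I x} {U : Set M} {x : M} (hU : IsOpen U) (hx : x ∈ U)
    (hY : ∀ i ∈ s, SmoothFieldOn (Y i) U) : D (∑ i ∈ s, Y i) x = ∑ i ∈ s, D (Y i) x := by
  classical
  induction s using Finset.induction_on with
  | empty => simp [CovariantDerivative.zero]
  | insert a s ha ih =>
    rw [Finset.sum_insert ha, Finset.sum_insert ha,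
      D.add_apply hU hx (hY a (Finset.mem_insert_self a s))
        (SmoothFieldOn.sum s fun i hi => hY i (Finset.mem_insert_of_mem hi)),
      ih fun i hi => hY i (Finset.mem_insert_of_mem hi)]

/-- A connection is smooth if its covariant derivatives of smooth local frames are smooth. -/
theorem isSmoothConn_of_frame {ι : Type*} [Fintype ι] {D : AffineConnection I M}
    (h : ∀ x : M, ∃ (O : Set M) (e : ι → Π x : M, TangentSpace I x), IsOpen O ∧ x ∈ O ∧
      (∀ i, SmoothFieldOn (e i) O) ∧ (∀ i j, SmoothFieldOn (fun x => D (e i) x (e j x)) O) ∧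
      ∀ W ⊆ O, IsOpen W → ∀ Y : Π x : M, TangentSpace I x, SmoothFieldOn Y W →
        ∃ c : ι → M → ℝ, (∀ i, ContMDiffOn I 𝓘(ℝ) ∞ (c i) W) ∧
          ∀ y ∈ W, Y y = ∑ i, c i y • e i y) : IsSmoothConn D := by
  intro U hU X Y hX hY x hx
  obtain ⟨O, e, hO, hxO, he, hee, hspan⟩ := h x
  have hW : IsOpen (U ∩ O) := hU.inter hO
  have hX := ContMDiffOn.mono hX (inter_subset_left (t := O))
  have hY := ContMDiffOn.mono hY (inter_subset_left (t := O))
  have he : ∀ i, SmoothFieldOn (e i) (U ∩ O) := fun i => ContMDiffOn.mono (he i) inter_subset_right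
  have hee : ∀ i j, SmoothFieldOn (fun x => D (e i) x (e j x)) (U ∩ O) :=
    fun i j => ContMDiffOn.mono (hee i j) inter_subset_right
  obtain ⟨c, hc, hcX⟩ := hspan _ inter_subset_right hW X hX
  obtain ⟨d, hd, hdY⟩ := hspan _ inter_subset_right hW Y hY
  have h1 : ∀ i, SmoothFieldOn (fun x => D (e i) x (X x)) (U ∩ O) := by
    intro i
    refine (SmoothFieldOn.sum Finset.univ fun j _ => (hee i j).smul (hc j)).congr fun y hy => ?_
    simp [hcX y hy]
  have h2 : SmoothFieldOn (fun x => D Y x (X x)) (U ∩ O) := by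
    refine (SmoothFieldOn.sum Finset.univ fun i _ =>
      ((h1 i).smul (hd i)).add ((he i).smul (f := fun y => mvfderiv I (d i) y (X y)) ?_)).congr
        fun y hy => ?_
    · intro y hy
      exact (((hd i).contMDiffAt (hW.mem_nhds hy)).mvfderiv_field
        (SmoothFieldOn.contMDiffAt hX hW hy)).contMDiffWithinAt
    · rw [D.congr_on hW hy hY (SmoothFieldOn.sum Finset.univ fun i _ => (he i).smul (hd i))
        (fun z hz => by simpa using hdY z hz),
        D.sum_apply Finset.univ hW hy fun i _ => (he i).smul (hd i)]
      simp only [Finset.sum_apply, _root_.sum_apply]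
      refine Finset.sum_congr rfl fun i _ => ?_
      exact D.smul_apply hW hy (hd i) (he i) _
  exact (h2.contMDiffAt hW ⟨hx, hxO⟩).contMDiffWithinAt

end SmoothFrames

/-! ### Smoothness of the cylinder connection -/

section CylinderSmooth

variable {E : Type*} [NormedAddCommGroup E] [NormedSpace ℝ E]
  {H : Type*} [TopologicalSpace H] {I : ModelWithCorners ℝ E H}
  {M : Type*} [TopologicalSpace M] [ChartedSpace H M] [IsManifold I ∞ M]
  [CompleteSpace E] [FiniteDimensional ℝ E]

variable {D : AffineConnection I M} {g : RiemMetric I M} {l a : ℝ}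
  {V V' : Π m : M, TangentSpace I m} {f f' : M → ℝ} {U : Set M} {p : M × ℝ}

theorem contMDiffOn_mvfderiv_field (hU : IsOpen U) (hV : SmoothFieldOn V U)
    (hf : ContMDiffOn I 𝓘(ℝ) ∞ f U) : ContMDiffOn I 𝓘(ℝ) ∞ (fun m => mvfderiv I f m (V m)) U :=
  fun _ hx => ((hf.contMDiffAt (hU.mem_nhds hx)).mvfderiv_field
    (hV.contMDiffAt hU hx)).contMDiffWithinAt

variable (g l a) in
/-- The `∂_t`-component of the covariant derivative of `V + f ∂_t` along `V' + f' ∂_t`. -/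
def cylCoeff (V V' : Π m : M, TangentSpace I m) (f f' : M → ℝ) (m : M) : ℝ :=
  mvfderiv I f m (V' m) + a * g.inner m (V m) (V' m) + l * (f m * f' m)

variable (D l) in
/-- The `M`-component of the covariant derivative of `V + f ∂_t` along `V' + f' ∂_t`. -/
def cylHor (V V' : Π m : M, TangentSpace I m) (f f' : M → ℝ) (m : M) : TangentSpace I m :=
  D V m (V' m) + l • (f m • V' m + f' m • V m)

theorem contMDiffOn_cylCoeff (hU : IsOpen U) (hV : SmoothFieldOn V U) (hV' : SmoothFieldOn V' U)
    (hf : ContMDiffOn I 𝓘(ℝ) ∞ f U) (hf' : ContMDiffOn I 𝓘(ℝ) ∞ f' U) :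
    ContMDiffOn I 𝓘(ℝ) ∞ (cylCoeff g l a V V' f f') U :=
  ((contMDiffOn_mvfderiv_field hU hV' hf).add
    (contMDiffOn_const.mul (g.isSmoothBilin U hU V V' hV hV'))).add
    (contMDiffOn_const.mul (hf.mul hf'))

theorem smoothFieldOn_cylHor (hD : IsSmoothConn D) (hU : IsOpen U) (hV : SmoothFieldOn V U)
    (hV' : SmoothFieldOn V' U) (hf : ContMDiffOn I 𝓘(ℝ) ∞ f U)
    (hf' : ContMDiffOn I 𝓘(ℝ) ∞ f' U) : SmoothFieldOn (cylHor D l V V' f f') U :=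
  (hD U hU V' V hV' hV).add
    (SmoothFieldOn.smul (f := fun _ => l) contMDiffOn_const ((hV'.smul hf).add (hV.smul hf')))

theorem cylConn_cylField_cylField (hU : IsOpen U)
    (hV : SmoothFieldOn V U) (hf : ContMDiffOn I 𝓘(ℝ) ∞ f U) (hp : p.1 ∈ U) :
    cylConn D g l a (cylField V f) p (cylField V' f' p) =
      cylField (cylHor D l V V' f f') (cylCoeff g l a V V' f f') p :=
  cylConn_cylField D g l a hU hV hf hp (V' p.1) (f' p.1)

/-- A local frame of `M` together with `∂_t` (index `none`) is a frame of the cylinder consisting of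
fields independent of `t`, and covariant derivatives of such fields are smooth fields of the same
kind. -/
theorem isSmoothConn_cylConn (hD : IsSmoothConn D) : IsSmoothConn (cylConn D g l a) := by
  let b := Module.finBasis ℝ E
  refine isSmoothConn_of_frame (ι := Option (Fin (Module.finrank ℝ E))) fun x => ?_
  let e := trivializationAt E (TangentSpace I : M → Type _) x.1
  let v : Option (Fin (Module.finrank ℝ E)) → Π m : M, TangentSpace I m :=
    fun i => i.elim 0 (e.localFrame b)
  let r : Option (Fin (Module.finrank ℝ E)) → M → ℝ := fun i => i.elim 1 0
  have hO : IsOpen (Prod.fst ⁻¹' e.baseSet : Set (M × ℝ)) := e.open_baseSet.preimage continuous_fst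
  have hv : ∀ i, SmoothFieldOn (v i) e.baseSet := fun i => match i with
    | none => smoothFieldOn_zero
    | some i => e.contMDiffOn_localFrame_baseSet ∞ b i
  have hr : ∀ i, ContMDiffOn I 𝓘(ℝ) ∞ (r i) e.baseSet := fun i => match i with
    | none => contMDiffOn_const
    | some i => contMDiffOn_const
  refine ⟨_, fun i => cylField (v i) (r i), hO,
    mem_baseSet_trivializationAt E (TangentSpace I : M → Type _) x.1,
    fun i => smoothFieldOn_cylField e.open_baseSet (hv i) (hr i), fun i j => ?_, ?_⟩
  · exact (smoothFieldOn_cylField e.open_baseSet (smoothFieldOn_cylHor hD e.open_baseSet (hv i)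
      (hv j) (hr i) (hr j)) (contMDiffOn_cylCoeff e.open_baseSet (hv i) (hv j) (hr i)
      (hr j))).congr fun y hy => cylConn_cylField_cylField e.open_baseSet (hv i) (hr i) hy
  · intro W hWO hW Y hY
    -- The coefficients of `Y`: its `t`-component, and the coordinates of its `M`-component in the
    -- trivialization; unlike the frame, they may depend on `t`.
    refine ⟨fun i q => i.elim (Y q).2 fun i => b.repr (e ⟨q.1, (Y q).1⟩).2 i, fun i => ?_, ?_⟩
    · intro q hq
      have hq' : q.1 ∈ e.baseSet := hWO hq
      have h1 := contMDiffAt_prod_field.1 (hY.contMDiffAt hW hq)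
      match i with
      | none => exact h1.2.contMDiffWithinAt
      | some i =>
        have h2 := (e.contMDiffAt_iff (x₀ := q)
          (f := fun q => (⟨q.1, (Y q).1⟩ : TangentBundle I M)) (e.mem_source.2 hq')).1 h1.1
        have h3 : ContMDiff 𝓘(ℝ, E) 𝓘(ℝ) ∞ (fun w => b.repr w i) :=
          (LinearMap.toContinuousLinearMap (b.coord i)).contMDiff
        exact (h3.contMDiffAt.comp q h2.2).contMDiffWithinAt
    · intro q hq
      have h1 := e.eq_sum_localFrameCoeff_smul (I := I) (b := b)
        (s := sliceField Y q.2) (hWO hq)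
      simp only [e.localFrameCoeff_eq_coeff (hWO hq)] at h1
      rw [Fintype.sum_option]
      have h2 : (ContinuousLinearMap.inl ℝ E ℝ) (Y q).1 = ∑ i, b.repr (e ⟨q.1, (Y q).1⟩).2 i •
          (ContinuousLinearMap.inl ℝ E ℝ) (e.localFrame b i q.1) := by
        have aux : ∀ (c : Fin (Module.finrank ℝ E) → ℝ) (w : Fin (Module.finrank ℝ E) → E),
            (ContinuousLinearMap.inl ℝ E ℝ) (∑ i, c i • w i) =
              ∑ i, c i • (ContinuousLinearMap.inl ℝ E ℝ) (w i) := fun c w => by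
          simp only [map_sum, map_smul]
        exact (congrArg _ h1).trans (aux _ _)
      change Y q = (Y q).2 • ((0, 1) : E × ℝ) + ∑ i, b.repr (e ⟨q.1, (Y q).1⟩).2 i •
          (ContinuousLinearMap.inl ℝ E ℝ) (e.localFrame b i q.1)
      rw [← h2]
      refine Prod.ext ?_ ?_ <;> simp

end CylinderSmooth

/-! ### Metrics, Lee form and torsion on the cylinder -/

section CylinderMetric

variable {E : Type*} [NormedAddCommGroup E] [NormedSpace ℝ E]
  {H : Type*} [TopologicalSpace H] {I : ModelWithCorners ℝ E H}
  {M : Type*} [TopologicalSpace M] [ChartedSpace H M] [IsManifold I ∞ M]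

/-- The bilinear form `α g + β dt²` on `M × ℝ`. -/
def cylBilin (g : RiemMetric I M) (α β : ℝ) (p : M × ℝ) :
    TangentSpace (I.prod 𝓘(ℝ)) p →L[ℝ] TangentSpace (I.prod 𝓘(ℝ)) p →L[ℝ] ℝ :=
  letI G : E →L[ℝ] E →L[ℝ] ℝ := g.inner p.1
  letI B : E × ℝ →L[ℝ] E × ℝ →L[ℝ] ℝ :=
    α • G.bilinearComp (ContinuousLinearMap.fst ℝ E ℝ) (ContinuousLinearMap.fst ℝ E ℝ) +
      β • (ContinuousLinearMap.mul ℝ ℝ).bilinearComp (ContinuousLinearMap.snd ℝ E ℝ)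
        (ContinuousLinearMap.snd ℝ E ℝ)
  B

theorem cylBilin_apply (g : RiemMetric I M) (α β : ℝ) (p : M × ℝ)
    (v w : TangentSpace (I.prod 𝓘(ℝ)) p) :
    cylBilin g α β p v w = α * g.inner p.1 v.1 w.1 + β * (v.2 * w.2) := rfl

theorem isSmoothBilin_cylBilin (g : RiemMetric I M) (α β : ℝ) :
    IsSmoothBilin (cylBilin g α β) := by
  intro U hU Y Z hY hZ p hp
  have hY' := contMDiffAt_prod_field.1 (hY.contMDiffAt hU hp)
  have hZ' := contMDiffAt_prod_field.1 (hZ.contMDiffAt hU hp)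
  have h1 : ContMDiffAt (I.prod 𝓘(ℝ)) (I.prod 𝓘(ℝ, ℝ)) ∞
      (fun q : M × ℝ => TotalSpace.mk' ℝ (E := Bundle.Trivial M ℝ) q.1
        (g.inner q.1 (Y q).1 (Z q).1)) p :=
    ContMDiffAt.clm_bundle_apply₂ ((g.contMDiff p.1).comp p contMDiffAt_fst) hY'.1 hZ'.1
  have h2 : ContMDiffAt (I.prod 𝓘(ℝ)) 𝓘(ℝ) ∞
      (fun q : M × ℝ => g.inner q.1 (Y q).1 (Z q).1) p := by
    rw [contMDiffAt_totalSpace] at h1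
    simpa using h1.2
  exact ((contMDiffAt_const.mul h2).add
    (contMDiffAt_const.mul (hY'.2.mul hZ'.2))).contMDiffWithinAt

/-- The Riemannian metric `α g + β dt²` on `M × ℝ`. -/
def cylRiem [FiniteDimensional ℝ E] (g : RiemMetric I M) {α β : ℝ} (hα : 0 < α) (hβ : 0 < β) :
    RiemMetric (I.prod 𝓘(ℝ)) (M × ℝ) :=
  RiemMetric.ofPosDef (cylBilin g α β) (isSmoothBilin_cylBilin g α β)
    (fun p v w => by
      rw [cylBilin_apply, cylBilin_apply, mul_comm v.2]
      exact congrArg (fun z => α * z + β * (w.2 * v.2)) (g.symm p.1 v.1 w.1))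
    (fun p v hv => by
      rw [cylBilin_apply]
      have h2 : 0 ≤ β * (v.2 * v.2) := mul_nonneg hβ.le (mul_self_nonneg _)
      by_cases h : v.1 = 0
      · have h3 : v.2 ≠ 0 := fun h' => hv (Prod.ext h h')
        have h4 : g.inner p.1 v.1 v.1 = 0 := by
          have : g.inner p.1 v.1 = 0 := (congrArg _ h).trans (map_zero (g.inner p.1))
          rw [this]; rfl
        have h5 := mul_pos hβ (mul_self_pos.2 h3)
        rw [h4]
        linarith
      · have := mul_pos hα (g.pos p.1 v.1 h)
        linarith)

/-- The 1-form `-2 dt` on `M × ℝ`. -/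
def cylForm (p : M × ℝ) : TangentSpace (I.prod 𝓘(ℝ)) p →L[ℝ] ℝ :=
  (-2 : ℝ) • ContinuousLinearMap.snd ℝ E ℝ

theorem cylForm_apply (p : M × ℝ) (v : TangentSpace (I.prod 𝓘(ℝ)) p) :
    cylForm p v = -2 * v.2 := rfl

theorem isSmoothForm_cylForm : IsSmoothForm (cylForm (I := I) (M := M)) := by
  intro U hU Y hY p hp
  exact (contMDiffAt_const.mul
    (contMDiffAt_prod_field.1 (hY.contMDiffAt hU hp)).2).contMDiffWithinAt

variable [CompleteSpace E] [FiniteDimensional ℝ E]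

/-- The form is the differential of the function `-2 t`, so closedness is the commutator formula for
that function. -/
theorem isClosedForm_cylForm : IsClosedForm (cylForm (I := I) (M := M)) := by
  intro U hU X Y hX hY p hp
  have h0 : ContMDiffOn (I.prod 𝓘(ℝ)) 𝓘(ℝ) ∞ (fun q : M × ℝ => -2 * q.2) U :=
    contMDiffOn_const.mul contMDiff_snd.contMDiffOn
  have h1 := mvfderiv_mlieBracket hU hp h0 hX hY
  have h2 : ∀ (q : M × ℝ) (v : TangentSpace (I.prod 𝓘(ℝ)) q),
      mvfderiv (I.prod 𝓘(ℝ)) (fun q : M × ℝ => -2 * q.2) q v = cylForm q v := by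
    intro q v
    rw [mvfderiv_mul_real mdifferentiableAt_const mdifferentiableAt_snd, mvfderiv_snd,
      mvfderiv_const_real, cylForm_apply]
    simp
  simp only [h2] at h1
  rw [h1, sub_self]

/-- The field `-2 ∂_t` on `M × ℝ`. -/
def cylLee : Π p : M × ℝ, TangentSpace (I.prod 𝓘(ℝ)) p := cylField 0 (fun _ => -2)

theorem exists_smoothFieldOn_eq₃ {x : M} (v₁ v₂ v₃ : TangentSpace I x) :
    ∃ (U : Set M) (V₁ V₂ V₃ : Π x : M, TangentSpace I x), IsOpen U ∧ x ∈ U ∧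
      SmoothFieldOn V₁ U ∧ SmoothFieldOn V₂ U ∧ SmoothFieldOn V₃ U ∧
      V₁ x = v₁ ∧ V₂ x = v₂ ∧ V₃ x = v₃ := by
  obtain ⟨U₁, V₁, hU₁, hx₁, h₁, e₁⟩ := exists_smoothFieldOn_eq v₁
  obtain ⟨U₂, V₂, hU₂, hx₂, h₂, e₂⟩ := exists_smoothFieldOn_eq v₂
  obtain ⟨U₃, V₃, hU₃, hx₃, h₃, e₃⟩ := exists_smoothFieldOn_eq v₃
  exact ⟨U₁ ∩ (U₂ ∩ U₃), V₁, V₂, V₃, hU₁.inter (hU₂.inter hU₃), ⟨hx₁, hx₂, hx₃⟩,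
    ContMDiffOn.mono h₁ inter_subset_left,
    ContMDiffOn.mono h₂ (inter_subset_right.trans inter_subset_left),
    ContMDiffOn.mono h₃ (inter_subset_right.trans inter_subset_right), e₁, e₂, e₃⟩

/-- Vectors on `M × ℝ` extend to fields `V + r ∂_t` with constant `r`. -/
theorem exists_cylField_eq₃ {p : M × ℝ} (w₁ w₂ w₃ : TangentSpace (I.prod 𝓘(ℝ)) p) :
    ∃ (U : Set M) (V₁ V₂ V₃ : Π x : M, TangentSpace I x) (r₁ r₂ r₃ : ℝ), IsOpen U ∧ p.1 ∈ U ∧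
      SmoothFieldOn V₁ U ∧ SmoothFieldOn V₂ U ∧ SmoothFieldOn V₃ U ∧
      cylField V₁ (fun _ => r₁) p = w₁ ∧ cylField V₂ (fun _ => r₂) p = w₂ ∧
      cylField V₃ (fun _ => r₃) p = w₃ := by
  obtain ⟨U, V₁, V₂, V₃, hU, hx, h₁, h₂, h₃, e₁, e₂, e₃⟩ :=
    exists_smoothFieldOn_eq₃ (I := I) (x := p.1) w₁.1 w₂.1 w₃.1
  exact ⟨U, V₁, V₂, V₃, w₁.2, w₂.2, w₃.2, hU, hx, h₁, h₂, h₃, Prod.ext e₁ rfl, Prod.ext e₂ rfl,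
    Prod.ext e₃ rfl⟩

variable {D : AffineConnection I M} {g : RiemMetric I M} {l a : ℝ} {U : Set M} {p : M × ℝ}
  {V₁ V₂ V₃ : Π m : M, TangentSpace I m} {r₁ r₂ r₃ : ℝ}

theorem mlieBracket_cylField_const (hU : IsOpen U) (h₁ : SmoothFieldOn V₁ U)
    (h₂ : SmoothFieldOn V₂ U) (hp : p.1 ∈ U) :
    mlieBracket (I.prod 𝓘(ℝ)) (cylField V₁ fun _ => r₁) (cylField V₂ fun _ => r₂) p =
      cylField (mlieBracket I V₁ V₂) (fun _ => 0) p := by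
  rw [mlieBracket_cylField hU h₁ h₂ contMDiffOn_const contMDiffOn_const hp]
  refine Prod.ext rfl ?_
  change mvfderiv I (fun _ => r₂) p.1 (V₁ p.1) - mvfderiv I (fun _ => r₁) p.1 (V₂ p.1) = 0
  rw [mvfderiv_const_real, mvfderiv_const_real]
  exact sub_zero 0

/-- The terms added to `D` are symmetric in the two vectors, and torsion is a tensor, so fields with
constant `t`-component suffice. -/
theorem torsion_cylConn (hD : D.torsion = 0) : (cylConn D g l a).torsion = 0 := by
  ext p w₁ w₂
  obtain ⟨U, V₁, V₂, -, r₁, r₂, -, hU, hp, h₁, h₂, -, rfl, rfl, -⟩ := exists_cylField_eq₃ w₁ w₂ 0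
  have hU' : IsOpen (Prod.fst ⁻¹' U : Set (M × ℝ)) := hU.preimage continuous_fst
  have hW₁ := smoothFieldOn_cylField hU h₁ (contMDiffOn_const (c := r₁))
  have hW₂ := smoothFieldOn_cylField hU h₂ (contMDiffOn_const (c := r₂))
  rw [(cylConn D g l a).torsion_apply (hW₁.mdifferentiableAt hU' hp)
    (hW₂.mdifferentiableAt hU' hp), mlieBracket_cylField_const hU h₁ h₂ hp,
    cylConn_cylField_cylField hU h₂ contMDiffOn_const hp,
    cylConn_cylField_cylField hU h₁ contMDiffOn_const hp]
  have h3 := D.torsion_eq_zero_iff.1 hD (h₁.mdifferentiableAt hU hp) (h₂.mdifferentiableAt hU hp)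
  refine Prod.ext ?_ ?_
  · change D V₂ p.1 (V₁ p.1) + l • (r₂ • V₁ p.1 + r₁ • V₂ p.1) -
      (D V₁ p.1 (V₂ p.1) + l • (r₁ • V₂ p.1 + r₂ • V₁ p.1)) - mlieBracket I V₁ V₂ p.1 = 0
    rw [← h3]
    module
  · change mvfderiv I (fun _ => r₂) p.1 (V₁ p.1) + a * g.inner p.1 (V₂ p.1) (V₁ p.1) +
      l * (r₂ * r₁) - (mvfderiv I (fun _ => r₁) p.1 (V₂ p.1) +
        a * g.inner p.1 (V₁ p.1) (V₂ p.1) + l * (r₁ * r₂)) - 0 = 0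
    rw [mvfderiv_const_real, mvfderiv_const_real, g.symm p.1 (V₂ p.1)]
    simp
    ring

/-- This turns symmetry into arithmetic: apart from the `D g` term and the symmetric `dt³` term, a
`∂_t` in the first slot has coefficient `2 α l`, in another slot `α l + β a`. -/
theorem covDerivBilin_cylField {α β : ℝ} (hU : IsOpen U)
    (h₂ : SmoothFieldOn V₂ U) (h₃ : SmoothFieldOn V₃ U) (hp : p.1 ∈ U) :
    covDerivBilin (cylConn D g l a) (cylBilin g α β) (cylField V₁ fun _ => r₁)
      (cylField V₂ fun _ => r₂) (cylField V₃ fun _ => r₃) p =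
      α * covDerivBilin D g.inner V₁ V₂ V₃ p.1
        - 2 * α * l * (r₁ * g.inner p.1 (V₂ p.1) (V₃ p.1))
        - (α * l + β * a) * (r₂ * g.inner p.1 (V₁ p.1) (V₃ p.1)
          + r₃ * g.inner p.1 (V₁ p.1) (V₂ p.1)) - 2 * β * l * (r₁ * r₂ * r₃) := by
  have hd : MDifferentiableAt I 𝓘(ℝ) (fun m => g.inner m (V₂ m) (V₃ m)) p.1 :=
    ((g.isSmoothBilin U hU V₂ V₃ h₂ h₃).contMDiffAt (hU.mem_nhds hp)).mdifferentiableAt (by simp)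
  have h4 : mvfderiv (I.prod 𝓘(ℝ)) (fun q => cylBilin g α β q (cylField V₂ (fun _ => r₂) q)
      (cylField V₃ (fun _ => r₃) q)) p (cylField V₁ (fun _ => r₁) p) =
      α * mvfderiv I (fun m => g.inner m (V₂ m) (V₃ m)) p.1 (V₁ p.1) := by
    have hd' : MDifferentiableAt I 𝓘(ℝ) (fun m => α * g.inner m (V₂ m) (V₃ m)) p.1 :=
      mdifferentiableAt_const.mul hd
    refine (mvfderiv_comp_fst (f := fun m => α * g.inner m (V₂ m) (V₃ m) + β * (r₂ * r₃))
      (hd'.add mdifferentiableAt_const) _).trans ?_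
    change mvfderiv I (fun m => α * g.inner m (V₂ m) (V₃ m) + β * (r₂ * r₃)) p.1 (V₁ p.1) = _
    rw [mvfderiv_add_real hd' mdifferentiableAt_const,
      mvfderiv_mul_real mdifferentiableAt_const hd, mvfderiv_const_real, mvfderiv_const_real]
    simp
  rw [covDerivBilin, covDerivBilin, h4, cylConn_cylField_cylField hU h₂ contMDiffOn_const hp,
    cylConn_cylField_cylField hU h₃ contMDiffOn_const hp, cylBilin_apply, cylBilin_apply]
  have h5 : (cylField (cylHor D l V₂ V₁ (fun _ => r₂) fun _ => r₁)
      (cylCoeff g l a V₂ V₁ (fun _ => r₂) fun _ => r₁) p).1 =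
      D V₂ p.1 (V₁ p.1) + l • (r₂ • V₁ p.1 + r₁ • V₂ p.1) := rfl
  have h6 : (cylField (cylHor D l V₃ V₁ (fun _ => r₃) fun _ => r₁)
      (cylCoeff g l a V₃ V₁ (fun _ => r₃) fun _ => r₁) p).1 =
      D V₃ p.1 (V₁ p.1) + l • (r₃ • V₁ p.1 + r₁ • V₃ p.1) := rfl
  have h7 : (cylField (cylHor D l V₂ V₁ (fun _ => r₂) fun _ => r₁)
      (cylCoeff g l a V₂ V₁ (fun _ => r₂) fun _ => r₁) p).2 =
      0 + a * g.inner p.1 (V₂ p.1) (V₁ p.1) + l * (r₂ * r₁) := by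
    change mvfderiv I (fun _ => r₂) p.1 (V₁ p.1) + _ + _ = _
    rw [mvfderiv_const_real]
    rfl
  have h8 : (cylField (cylHor D l V₃ V₁ (fun _ => r₃) fun _ => r₁)
      (cylCoeff g l a V₃ V₁ (fun _ => r₃) fun _ => r₁) p).2 =
      0 + a * g.inner p.1 (V₃ p.1) (V₁ p.1) + l * (r₃ * r₁) := by
    change mvfderiv I (fun _ => r₃) p.1 (V₁ p.1) + _ + _ = _
    rw [mvfderiv_const_real]
    rfl
  rw [h7, h8]
  change _ - (α * g.inner p.1 (D V₂ p.1 (V₁ p.1) + l • (r₂ • V₁ p.1 + r₁ • V₂ p.1)) (V₃ p.1) +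
    β * (_ * r₃)) - (α * g.inner p.1 (V₂ p.1) (D V₃ p.1 (V₁ p.1) +
      l • (r₃ • V₁ p.1 + r₁ • V₃ p.1)) + β * (r₂ * _)) = _
  simp only [map_add, map_smul, add_apply, smul_apply, smul_eq_mul]
  rw [g.symm p.1 (V₂ p.1) (V₁ p.1), g.symm p.1 (V₃ p.1) (V₁ p.1)]
  ring

end CylinderMetric

/-! ### Flatness, the Hessian structure and the radiant l.c.H. structure -/

section CylinderFlat

variable {E : Type*} [NormedAddCommGroup E] [NormedSpace ℝ E]
  {H : Type*} [TopologicalSpace H] {I : ModelWithCorners ℝ E H}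
  {M : Type*} [TopologicalSpace M] [ChartedSpace H M] [IsManifold I ∞ M]
  [CompleteSpace E] [FiniteDimensional ℝ E]
  {D : AffineConnection I M} {g : RiemMetric I M} {l a c : ℝ} {U : Set M} {p : M × ℝ}
  {V₁ V₂ V₃ : Π m : M, TangentSpace I m} {r₁ r₂ r₃ : ℝ}

theorem cylConn_cylConn_cylField (hD : IsSmoothConn D) (hU : IsOpen U)
    (h₂ : SmoothFieldOn V₂ U) (h₃ : SmoothFieldOn V₃ U) (hp : p.1 ∈ U) :
    cylConn D g l a (fun q => cylConn D g l a (cylField V₃ fun _ => r₃) q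
      (cylField V₂ (fun _ => r₂) q)) p (cylField V₁ (fun _ => r₁) p) =
    ((D (fun y => D V₃ y (V₂ y)) p.1 (V₁ p.1)
        + l • (r₃ • D V₂ p.1 (V₁ p.1) + r₂ • D V₃ p.1 (V₁ p.1))
        + l • ((a * g.inner p.1 (V₃ p.1) (V₂ p.1) + l * (r₃ * r₂)) • V₁ p.1
          + r₁ • (D V₃ p.1 (V₂ p.1) + l • (r₃ • V₂ p.1 + r₂ • V₃ p.1))),
      a * mvfderiv I (fun y => g.inner y (V₃ y) (V₂ y)) p.1 (V₁ p.1)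
        + a * (g.inner p.1 (D V₃ p.1 (V₂ p.1)) (V₁ p.1)
          + l * (r₃ * g.inner p.1 (V₂ p.1) (V₁ p.1) + r₂ * g.inner p.1 (V₃ p.1) (V₁ p.1)))
        + l * ((a * g.inner p.1 (V₃ p.1) (V₂ p.1) + l * (r₃ * r₂)) * r₁)) : E × ℝ) := by
  have hU' : IsOpen (Prod.fst ⁻¹' U : Set (M × ℝ)) := hU.preimage continuous_fst
  have hH := smoothFieldOn_cylHor (l := l) hD hU h₃ h₂ (contMDiffOn_const (c := r₃))
    (contMDiffOn_const (c := r₂))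
  have hC := contMDiffOn_cylCoeff (g := g) (l := l) (a := a) hU h₃ h₂
    (contMDiffOn_const (c := r₃)) (contMDiffOn_const (c := r₂))
  have hHC := smoothFieldOn_cylField hU hH hC
  have e : ∀ q ∈ (Prod.fst ⁻¹' U : Set (M × ℝ)), cylConn D g l a (cylField V₃ fun _ => r₃) q
      (cylField V₂ (fun _ => r₂) q) = cylField (cylHor D l V₃ V₂ (fun _ => r₃) fun _ => r₂)
        (cylCoeff g l a V₃ V₂ (fun _ => r₃) fun _ => r₂) q := fun q hq =>
    cylConn_cylField_cylField hU h₃ contMDiffOn_const hq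
  have hd : MDifferentiableAt I 𝓘(ℝ) (fun m => g.inner m (V₃ m) (V₂ m)) p.1 :=
    ((g.isSmoothBilin U hU V₃ V₂ h₃ h₂).contMDiffAt (hU.mem_nhds hp)).mdifferentiableAt (by simp)
  have hd' : MDifferentiableAt I 𝓘(ℝ) (fun m => a * g.inner m (V₃ m) (V₂ m)) p.1 :=
    mdifferentiableAt_const.mul hd
  have hcoeff : cylCoeff g l a V₃ V₂ (fun _ => r₃) (fun _ => r₂) =
      fun m => a * g.inner m (V₃ m) (V₂ m) + l * (r₃ * r₂) := by
    funext m
    rw [cylCoeff, mvfderiv_const_real]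
    simp
  have hD1 : D (cylHor D l V₃ V₂ (fun _ => r₃) fun _ => r₂) p.1 (V₁ p.1) =
      D (fun y => D V₃ y (V₂ y)) p.1 (V₁ p.1)
        + l • (r₃ • D V₂ p.1 (V₁ p.1) + r₂ • D V₃ p.1 (V₁ p.1)) := by
    have k : ∀ (r : ℝ) {V : Π m : M, TangentSpace I m}, SmoothFieldOn V U →
        D ((fun _ : M => r) • V) p.1 (V₁ p.1) = r • D V p.1 (V₁ p.1) := by
      intro r V hV
      rw [D.smul_apply hU hp contMDiffOn_const hV, mvfderiv_const_real]
      simp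
    have s2 := h₂.smul (contMDiffOn_const (c := r₃))
    have s3 := h₃.smul (contMDiffOn_const (c := r₂))
    change D ((fun y => D V₃ y (V₂ y)) + (fun _ : M => l) • ((fun _ : M => r₃) • V₂ + (fun _ : M => r₂) • V₃))
      p.1 (V₁ p.1) = _
    rw [D.add_apply hU hp (hD U hU V₂ V₃ h₂ h₃) ((s2.add s3).smul contMDiffOn_const), add_apply,
      k l (s2.add s3), D.add_apply hU hp s2 s3, add_apply, k r₃ h₂, k r₂ h₃]
  rw [(cylConn D g l a).congr_on hU' hp (hHC.congr e) hHC e,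
    cylConn_cylField_cylField hU hH hC hp]
  refine Prod.ext ?_ ?_
  · change D (cylHor D l V₃ V₂ (fun _ => r₃) fun _ => r₂) p.1 (V₁ p.1) +
      l • (cylCoeff g l a V₃ V₂ (fun _ => r₃) (fun _ => r₂) p.1 • V₁ p.1 + r₁ •
        (D V₃ p.1 (V₂ p.1) + l • (r₃ • V₂ p.1 + r₂ • V₃ p.1))) = _
    rw [hcoeff, hD1]
  · change mvfderiv I (cylCoeff g l a V₃ V₂ (fun _ => r₃) fun _ => r₂) p.1 (V₁ p.1) +
      a * g.inner p.1 (D V₃ p.1 (V₂ p.1) + l • (r₃ • V₂ p.1 + r₂ • V₃ p.1)) (V₁ p.1) +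
      l * (cylCoeff g l a V₃ V₂ (fun _ => r₃) (fun _ => r₂) p.1 * r₁) = _
    rw [hcoeff, mvfderiv_add_real hd' mdifferentiableAt_const,
      mvfderiv_mul_real mdifferentiableAt_const hd, mvfderiv_const_real, mvfderiv_const_real]
    simp only [map_add, map_smul, add_apply, smul_apply, smul_eq_mul, zero_apply]
    ring

/-- The constant curvature of `D` is compensated by the detour through `∂_t`, which contributes `a l
= -c`. Terms with some `r_i` cancel by torsion-freeness and symmetry of `g`, and the `∂_t`-component
by symmetry of `D g`. -/
theorem curvature_cylConn (hs : IsSmoothConn D) (h : IsStatisticalOfConstCurvature D g c)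
    (hla : c + a * l = 0) (hU : IsOpen U) (h₁ : SmoothFieldOn V₁ U) (h₂ : SmoothFieldOn V₂ U)
    (h₃ : SmoothFieldOn V₃ U) (hp : p.1 ∈ U) :
    curvature (cylConn D g l a) (cylField V₁ fun _ => r₁) (cylField V₂ fun _ => r₂)
      (cylField V₃ fun _ => r₃) p = 0 := by
  have ht := D.torsion_eq_zero_iff.1 h.torsion_eq_zero (h₁.mdifferentiableAt hU hp)
    (h₂.mdifferentiableAt hU hp)
  have hc := h.curvature_eq U hU V₁ V₂ V₃ h₁ h₂ h₃ p.1 hp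
  -- The two transpositions combine to `(D_{V₂} g)(V₃, V₁) = (D_{V₁} g)(V₃, V₂)`, with `V₃` first as
  -- in `cylCoeff`.
  have hg := (h.symm U hU V₁ V₂ V₃ h₁ h₂ h₃ p.1 hp).1.symm.trans
    (h.symm U hU V₁ V₂ V₃ h₁ h₂ h₃ p.1 hp).2
  have hg' := (h.symm U hU V₂ V₁ V₃ h₂ h₁ h₃ p.1 hp).2.symm.trans hg
  rw [curvature, cylConn_cylConn_cylField hs hU h₂ h₃ hp,
    cylConn_cylConn_cylField hs hU h₁ h₃ hp, mlieBracket_cylField_const hU h₁ h₂ hp,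
    cylConn_cylField_cylField hU h₃ contMDiffOn_const hp]
  rw [curvature, sub_sub, sub_eq_iff_eq_add] at hc
  simp only [covDerivBilin, ← ht] at hg' hc
  refine Prod.ext ?_ ?_
  · change (_ : TangentSpace I p.1) - _ - (D V₃ p.1 (mlieBracket I V₁ V₂ p.1) +
      l • (r₃ • mlieBracket I V₁ V₂ p.1 + (0 : ℝ) • V₃ p.1)) = 0
    rw [← ht, hc, g.symm p.1 (V₃ p.1) (V₂ p.1), g.symm p.1 (V₃ p.1) (V₁ p.1)]
    have hc' : c = - (a * l) := by linarith
    rw [hc']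
    module
  · change (_ : ℝ) - _ - (mvfderiv I (fun _ => r₃) p.1 (mlieBracket I V₁ V₂ p.1) +
      a * g.inner p.1 (V₃ p.1) (mlieBracket I V₁ V₂ p.1) + l * (r₃ * 0)) = 0
    rw [mvfderiv_const_real, ← ht, zero_apply, map_sub]
    rw [g.symm p.1 (V₂ p.1) (V₁ p.1)]
    simp only [mul_zero, add_zero, zero_add]
    linear_combination (-a) * hg'

theorem isFlatAffine_cylConn (hs : IsSmoothConn D) (h : IsStatisticalOfConstCurvature D g c)
    (hla : c + a * l = 0) : IsFlatAffine (cylConn D g l a) where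
  smooth := (isSmoothConn_cylConn hs).contMDiffCovariantDerivative
  torsion_eq_zero := torsion_cylConn h.torsion_eq_zero
  flat O hO X Y Z hX hY hZ p hp := by
    obtain ⟨U, V₁, V₂, V₃, r₁, r₂, r₃, hU, hpU, h₁, h₂, h₃, e₁, e₂, e₃⟩ :=
      exists_cylField_eq₃ (X p) (Y p) (Z p)
    have hU' : IsOpen (Prod.fst ⁻¹' U : Set (M × ℝ)) := hU.preimage continuous_fst
    have hsub : ∀ {V : Π m : M, TangentSpace I m} {r : ℝ}, SmoothFieldOn V U →
        SmoothFieldOn (cylField V fun _ => r) (O ∩ Prod.fst ⁻¹' U) := fun hV =>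
      ContMDiffOn.mono (smoothFieldOn_cylField hU hV contMDiffOn_const) inter_subset_right
    rw [curvature_congr (isSmoothConn_cylConn hs) (hO.inter hU') ⟨hp, hpU⟩
      (ContMDiffOn.mono hX inter_subset_left) (hsub h₁) (ContMDiffOn.mono hY inter_subset_left)
      (hsub h₂) (ContMDiffOn.mono hZ inter_subset_left) (hsub h₃) e₁.symm e₂.symm e₃.symm]
    exact curvature_cylConn hs h hla hU h₁ h₂ h₃ hpU

/-- The condition `hk` equates the coefficient of `∂_t` in the first slot with that in the other
slots. The value `k = 0` gives the Hessian condition and `k = 1` the conformal one. -/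
theorem covDerivBilin_cylConn_symm (h : TotallySymmetric (covDerivBilin D g.inner)) {α β k : ℝ}
    (hk : 2 * α * l - 2 * k * α = α * l + β * a) :
    TotallySymmetric (fun X Y Z p => covDerivBilin (cylConn D g l a) (cylBilin g α β) X Y Z p
      - k * (cylForm p (X p) * cylBilin g α β p (Y p) (Z p))) := by
  intro O hO X Y Z hX hY hZ p hp
  obtain ⟨U, V₁, V₂, V₃, r₁, r₂, r₃, hU, hpU, h₁, h₂, h₃, e₁, e₂, e₃⟩ :=
    exists_cylField_eq₃ (X p) (Y p) (Z p)
  have hU' : IsOpen (Prod.fst ⁻¹' U : Set (M × ℝ)) := hU.preimage continuous_fst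
  have hsub : ∀ {V : Π m : M, TangentSpace I m} {r : ℝ}, SmoothFieldOn V U →
      SmoothFieldOn (cylField V fun _ => r) (O ∩ Prod.fst ⁻¹' U) := fun hV =>
    ContMDiffOn.mono (smoothFieldOn_cylField hU hV contMDiffOn_const) inter_subset_right
  have key : ∀ {X Y Z : Π p : M × ℝ, TangentSpace (I.prod 𝓘(ℝ)) p}
      {V₁ V₂ V₃ : Π m : M, TangentSpace I m} {r₁ r₂ r₃ : ℝ}, SmoothFieldOn Y O →
      SmoothFieldOn Z O → SmoothFieldOn V₂ U → SmoothFieldOn V₃ U →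
      cylField V₁ (fun _ => r₁) p = X p → cylField V₂ (fun _ => r₂) p = Y p →
      cylField V₃ (fun _ => r₃) p = Z p →
      covDerivBilin (cylConn D g l a) (cylBilin g α β) X Y Z p
        - k * (cylForm p (X p) * cylBilin g α β p (Y p) (Z p)) =
      α * covDerivBilin D g.inner V₁ V₂ V₃ p.1
        - 2 * α * l * (r₁ * g.inner p.1 (V₂ p.1) (V₃ p.1))
        - (α * l + β * a) * (r₂ * g.inner p.1 (V₁ p.1) (V₃ p.1)
          + r₃ * g.inner p.1 (V₁ p.1) (V₂ p.1)) - 2 * β * l * (r₁ * r₂ * r₃)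
        + 2 * k * r₁ * (α * g.inner p.1 (V₂ p.1) (V₃ p.1) + β * (r₂ * r₃)) := by
    intro X Y Z V₁ V₂ V₃ r₁ r₂ r₃ hY hZ h₂ h₃ e₁ e₂ e₃
    rw [covDerivBilin_congr (isSmoothBilin_cylBilin g α β) (hO.inter hU') ⟨hp, hpU⟩
      (ContMDiffOn.mono hY inter_subset_left) (hsub h₂) (ContMDiffOn.mono hZ inter_subset_left)
      (hsub h₃) e₁.symm e₂.symm e₃.symm, covDerivBilin_cylField hU h₂ h₃ hpU, ← e₁, ← e₂, ← e₃]
    change _ - k * (-2 * r₁ * (α * g.inner p.1 (V₂ p.1) (V₃ p.1) + β * (r₂ * r₃))) = _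
    ring
  have hs := h U hU V₁ V₂ V₃ h₁ h₂ h₃ p.1 hpU
  refine ⟨?_, ?_⟩
  · beta_reduce
    rw [key hY hZ h₂ h₃ e₁ e₂ e₃, key hX hZ h₁ h₃ e₂ e₁ e₃, hs.1, g.symm p.1 (V₂ p.1) (V₁ p.1)]
    linear_combination (r₂ * g.inner p.1 (V₁ p.1) (V₃ p.1)
      - r₁ * g.inner p.1 (V₂ p.1) (V₃ p.1)) * hk
  · beta_reduce
    rw [key hY hZ h₂ h₃ e₁ e₂ e₃, key hZ hY h₃ h₂ e₁ e₃ e₂, hs.2, g.symm p.1 (V₃ p.1) (V₂ p.1)]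
    ring

/-- On fields with constant `t`-component, `∇(-2 dt)` is twice the `∂_t`-component of the covariant
derivative, that is `2 a g + 2 l dt²`. For these `α` and `β` the symmetry condition with `k = 0` is
an identity in `l` and `a`. -/
theorem isKoszulHessian_cylConn (hs : IsSmoothConn D) (h : IsStatisticalOfConstCurvature D g c)
    (hla : c + a * l = 0) (ha : 0 < 2 * a) (hl : 0 < 2 * l) :
    IsKoszulHessian (cylConn D g l a) (cylRiem g ha hl) cylForm where
  toIsFlatAffine := isFlatAffine_cylConn hs h hla
  symm := by
    have := covDerivBilin_cylConn_symm (l := l) (a := a) h.symm (α := 2 * a) (β := 2 * l) (k := 0)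
      (by ring)
    simp only [zero_mul, sub_zero] at this
    exact this
  smooth_form := isSmoothForm_cylForm.smoothOneForm
  closed := isClosedForm_cylForm
  metric_eq O hO X Y hX hY p hp := by
    obtain ⟨U, V₁, V₂, -, r₁, r₂, -, hU, hpU, h₁, h₂, -, e₁, e₂, -⟩ :=
      exists_cylField_eq₃ (X p) (Y p) 0
    have hU' : IsOpen (Prod.fst ⁻¹' U : Set (M × ℝ)) := hU.preimage continuous_fst
    have h2 : covDerivForm (cylConn D g l a) cylForm X Y p = covDerivForm (cylConn D g l a) cylForm
        X (cylField V₂ fun _ => r₂) p :=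
      (covDerivForm_tensorial (D := cylConn D g l a) isSmoothForm_cylForm X).pointwise
        (hO.inter hU') ⟨hp, hpU⟩ (ContMDiffOn.mono hY inter_subset_left)
        (ContMDiffOn.mono (smoothFieldOn_cylField hU h₂ contMDiffOn_const) inter_subset_right)
        e₂.symm
    have h3 : (fun q => cylForm q (cylField (I := I) V₂ (fun _ => r₂) q)) =
        fun _ : M × ℝ => -2 * r₂ := rfl
    rw [h2, covDerivForm, h3, mvfderiv_const_real, ← e₁, ← e₂,
      cylConn_cylField_cylField hU h₂ contMDiffOn_const hpU]
    change 2 * a * g.inner p.1 (V₁ p.1) (V₂ p.1) + 2 * l * (r₁ * r₂) = 0 -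
      -2 * (mvfderiv I (fun _ => r₂) p.1 (V₁ p.1) + a * g.inner p.1 (V₂ p.1) (V₁ p.1)
        + l * (r₂ * r₁))
    rw [mvfderiv_const_real, g.symm p.1 (V₂ p.1), zero_apply]
    ring

theorem cylConn_cylLee (v : TangentSpace (I.prod 𝓘(ℝ)) p) :
    cylConn D g l a cylLee p v = (-2 * l) • v := by
  have key : ∀ (u : TangentSpace I p.1) (r : ℝ), cylConn D g l a cylLee p ((u, r) : E × ℝ) =
      (((-2 * l) • u, (-2 * l) * r) : E × ℝ) := by
    intro u r
    have h1 : D 0 p.1 u = 0 := by rw [CovariantDerivative.zero]; rfl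
    refine (cylConn_cylField D g l a isOpen_univ smoothFieldOn_zero contMDiffOn_const
      (mem_univ _) u r).trans (Prod.ext ?_ ?_)
    · change D 0 p.1 u + l • ((-2 : ℝ) • u + r • 0) = (-2 * l) • u
      rw [h1]
      module
    · change mvfderiv I (fun _ => (-2 : ℝ)) p.1 u + a * g.inner p.1 0 u + l * (-2 * r) =
        (-2 * l) * r
      rw [mvfderiv_const_real, map_zero, zero_apply]
      ring
  exact key v.1 v.2

/-- On fields independent of `t` both brackets vanish, and so does the `t`-derivative of the metric
coefficients. -/
theorem isKillingField_cylLee {α β : ℝ} (hα : 0 < α) (hβ : 0 < β) :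
    IsKillingField (cylRiem g hα hβ) cylLee := by
  intro O hO Y Z hY hZ p hp
  obtain ⟨U, V₁, V₂, -, r₁, r₂, -, hU, hpU, h₁, h₂, -, e₁, e₂, -⟩ :=
    exists_cylField_eq₃ (Y p) (Z p) 0
  have hU' : IsOpen (Prod.fst ⁻¹' U : Set (M × ℝ)) := hU.preimage continuous_fst
  have hsub : ∀ {V : Π m : M, TangentSpace I m} {r : ℝ}, SmoothFieldOn V U →
      SmoothFieldOn (cylField V fun _ => r) (O ∩ Prod.fst ⁻¹' U) := fun hV =>
    ContMDiffOn.mono (smoothFieldOn_cylField hU hV contMDiffOn_const) inter_subset_right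
  change lieDerivBilin (cylRiem g hα hβ).inner cylLee Y Z p = 0
  rw [lieDerivBilin_congr (cylRiem g hα hβ).isSmoothBilin (cylRiem g hα hβ).symm (hO.inter hU')
    ⟨hp, hpU⟩ (ContMDiffOn.mono hY inter_subset_left) (hsub h₁)
    (ContMDiffOn.mono hZ inter_subset_left) (hsub h₂) e₁.symm e₂.symm, lieDerivBilin, cylLee]
  have hb : ∀ {V : Π m : M, TangentSpace I m} {r : ℝ}, SmoothFieldOn V U →
      mlieBracket (I.prod 𝓘(ℝ)) (cylField 0 fun _ => -2) (cylField V fun _ => r) p = 0 := by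
    intro V r hV
    rw [mlieBracket_cylField_const hU smoothFieldOn_zero hV hpU]
    exact Prod.ext congr($(mlieBracket_zero_left (I := I) (W := V)) p.1) rfl
  have hd : MDifferentiableAt I 𝓘(ℝ) (fun m => g.inner m (V₁ m) (V₂ m)) p.1 :=
    ((g.isSmoothBilin U hU V₁ V₂ h₁ h₂).contMDiffAt (hU.mem_nhds hpU)).mdifferentiableAt (by simp)
  have h4 : mvfderiv (I.prod 𝓘(ℝ)) (fun q => cylBilin g α β q (cylField V₁ (fun _ => r₁) q)
      (cylField V₂ (fun _ => r₂) q)) p (cylField 0 (fun _ => -2) p) = 0 := by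
    refine (mvfderiv_comp_fst (f := fun m => α * g.inner m (V₁ m) (V₂ m) + β * (r₁ * r₂))
      ((mdifferentiableAt_const.mul hd).add mdifferentiableAt_const) _).trans ?_
    exact map_zero _
  rw [hb h₁, hb h₂, map_zero, map_zero, zero_apply]
  exact (sub_zero _).trans ((sub_zero _).trans h4)

/-- The relation `a = l - 2` is the symmetry condition for `α = β = k = 1`. -/
theorem isRadiantLCH_cylConn (hs : IsSmoothConn D) (h : IsStatisticalOfConstCurvature D g c)
    (hla : c + a * l = 0) (hal : a = l - 2) :
    IsRadiantLCH (cylConn D g l a) (cylRiem g one_pos one_pos) cylForm cylLee (-2 * l) where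
  toIsFlatAffine := isFlatAffine_cylConn hs h hla
  smooth_form := isSmoothForm_cylForm.smoothOneForm
  closed := isClosedForm_cylForm
  symm := by
    have := covDerivBilin_cylConn_symm (l := l) (a := a) h.symm (α := 1) (β := 1) (k := 1)
      (by rw [hal]; ring)
    simp only [one_mul] at this
    exact this
  smooth_field := ContMDiffOn.mono (smoothFieldOn_cylField isOpen_univ smoothFieldOn_zero
    contMDiffOn_const) fun _ _ => mem_univ _
  lee p v := by
    have key : ∀ (u : TangentSpace I p.1) (r : ℝ),
        1 * g.inner p.1 0 u + 1 * (-2 * r) = -2 * r := by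
      intro u r
      rw [map_zero, zero_apply]
      ring
    exact key v.1 v.2
  killing := isKillingField_cylLee _ _
  radiant _ v := cylConn_cylLee v

end CylinderFlat

/-! ### Invariance of pushed structures under a deck transformation -/

theorem cylLin_conj {E : Type*} [NormedAddCommGroup E] [NormedSpace ℝ E] {l a : ℝ}
    {A A' : E →L[ℝ] E} {B B' : E × ℝ →L[ℝ] ℝ} {G G' : E →L[ℝ] ℝ} {Z Z' W W' : E × ℝ}
    (P : E →L[ℝ] E) {u : E} {r : ℝ} (hA : P (A u) = A' (P u)) (hB : B (u, 0) = B' (P u, 0))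
    (hG : G u = G' (P u)) (hZ : (P Z.1, Z.2) = Z') (hW : (P W.1, W.2) = W') :
    (P (cylLin l a A B G Z W (u, r)).1, (cylLin l a A B G Z W (u, r)).2) =
      cylLin l a A' B' G' Z' W' (P u, r) := by
  subst hZ hW
  simp only [cylLin_apply, map_add, map_smul, hA, hB, hG]

section DeckTransformations

variable {E : Type*} [NormedAddCommGroup E] [NormedSpace ℝ E] [CompleteSpace E]
  {H : Type*} [TopologicalSpace H] {I : ModelWithCorners ℝ E H}
  {N : Type*} [TopologicalSpace N] [ChartedSpace H N] [IsManifold I ∞ N]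
  {C : Type*} [TopologicalSpace C] [ChartedSpace H C] [IsManifold I ∞ C]
  {F : N → C} {T : N → N}

theorem mfderiv_deck (hF : IsLocalDiffeomorph I I ∞ F) (hT : IsLocalDiffeomorph I I ∞ T)
    (h : ∀ p, F (T p) = F p) (p : N) (v : TangentSpace I p) :
    (mfderiv I I F (T p) (mfderiv I I T p v) : E) = mfderiv I I F p v := by
  have h1 := mfderiv_comp_apply p (hF.contMDiff.contMDiffAt.mdifferentiableAt (by simp))
    (hT.contMDiff.contMDiffAt.mdifferentiableAt (by simp) : MDifferentiableAt I I T p) v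
  have h2 : F ∘ T = F := funext h
  rw [h2] at h1
  exact h1.symm

theorem inverse_mfderiv_deck (hF : IsLocalDiffeomorph I I ∞ F) (hT : IsLocalDiffeomorph I I ∞ T)
    (h : ∀ p, F (T p) = F p) (p : N) (w : E) :
    (mfderiv I I F (T p)).inverse w = mfderiv I I T p ((mfderiv I I F p).inverse w) := by
  have h1 := mfderiv_deck hF hT h p ((mfderiv I I F p).inverse w)
  have h2 : (mfderiv I I F p ((mfderiv I I F p).inverse w) : E) = w := hF.mfderiv_inverse p w
  rw [h2] at h1
  have h3 := hF.inverse_mfderiv (T p) (mfderiv I I T p ((mfderiv I I F p).inverse w))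
  rw [← h3]
  exact congrArg _ h1.symm

theorem pushFormAt_deck (hF : IsLocalDiffeomorph I I ∞ F) (hT : IsLocalDiffeomorph I I ∞ T)
    (h : ∀ p, F (T p) = F p) {θ : Π p : N, TangentSpace I p →L[ℝ] ℝ}
    (hθ : ∀ p v, θ (T p) (mfderiv I I T p v) = θ p v) (p : N) :
    (pushFormAt F θ (T p) : E →L[ℝ] ℝ) = pushFormAt F θ p := by
  refine ContinuousLinearMap.ext fun w => ?_
  exact (congrArg _ (inverse_mfderiv_deck hF hT h p w)).trans (hθ p _)

theorem pushBilinAt_deck (hF : IsLocalDiffeomorph I I ∞ F) (hT : IsLocalDiffeomorph I I ∞ T)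
    (h : ∀ p, F (T p) = F p) {b : Π p : N, TangentSpace I p →L[ℝ] TangentSpace I p →L[ℝ] ℝ}
    (hb : ∀ p v w, b (T p) (mfderiv I I T p v) (mfderiv I I T p w) = b p v w) (p : N) :
    (pushBilinAt F b (T p) : E →L[ℝ] E →L[ℝ] ℝ) = pushBilinAt F b p := by
  refine ContinuousLinearMap.ext fun v => ContinuousLinearMap.ext fun w => ?_
  refine (pushBilinAt_apply F b (T p) v w).trans (Eq.trans ?_ (pushBilinAt_apply F b p v w).symm)
  exact (congrArg₂ (fun v w => b (T p) v w) (inverse_mfderiv_deck hF hT h p v)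
    (inverse_mfderiv_deck hF hT h p w)).trans (hb p _ _)

/-- Since `F ∘ T = F`, the pullback of `Y` along `F` is its own pullback along `T`; invariance of
`D` under `T` then compares the derivatives at `p` and `T p`. -/
theorem pushConnAt_deck (hF : IsLocalDiffeomorph I I ∞ F) (hT : IsLocalDiffeomorph I I ∞ T)
    (h : ∀ p, F (T p) = F p) {D : AffineConnection I N} (hD : ConnRelated T D D)
    {U : Set C} (hU : IsOpen U) {Y : Π x : C, TangentSpace I x} (hY : SmoothFieldOn Y U) {p : N}
    (hp : F p ∈ U) : (pushConnAt F D Y (T p) : E →L[ℝ] E) = pushConnAt F D Y p := by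
  have h1 : mpullback I I T (mpullback I I F Y) = mpullback I I F Y := by
    funext q
    refine (hT.isInvertible_mfderiv q).injective ?_
    rw [hT.mfderiv_mpullback]
    refine (hF.isInvertible_mfderiv (T q)).injective ?_
    rw [hF.mfderiv_mpullback]
    refine Eq.trans ?_ (mfderiv_deck hF hT h q _).symm
    refine Eq.trans ?_ (hF.mfderiv_mpullback q Y).symm
    rw [h]
  refine ContinuousLinearMap.ext fun w => ?_
  have h2 := hD (F ⁻¹' U) (hU.preimage hF.contMDiff.continuous) (mpullback I I F Y)
    (hY.mpullback hF) p (by rw [mem_preimage, h]; exact hp) ((mfderiv I I F p).inverse w)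
  rw [h1] at h2
  refine Eq.trans ?_ (mfderiv_deck hF hT h p (D (mpullback I I F Y) p
    ((mfderiv I I F p).inverse w)))
  refine congrArg (mfderiv I I F (T p)) (Eq.trans ?_ h2.symm)
  exact congrArg (D (mpullback I I F Y) (T p)) (inverse_mfderiv_deck hF hT h p w)

end DeckTransformations

/-! ### The automorphism acting on the cylinder, and descent -/

section CylinderDeck

variable {E : Type*} [NormedAddCommGroup E] [NormedSpace ℝ E] [CompleteSpace E]
  [FiniteDimensional ℝ E]
  {H : Type*} [TopologicalSpace H] {I : ModelWithCorners ℝ E H}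
  {M : Type*} [TopologicalSpace M] [ChartedSpace H M] [IsManifold I ∞ M]
  {D : AffineConnection I M} {g : RiemMetric I M} {l a : ℝ} {φ : M ≃ₘ^∞⟮I, I⟯ M} {s : ℝ}

/-- The map `(m, t) ↦ (φ m, t + s)` of `M × ℝ`. -/
def cylMap (φ : M ≃ₘ^∞⟮I, I⟯ M) (s : ℝ) (p : M × ℝ) : M × ℝ := (φ p.1, p.2 + s)

theorem isLocalDiffeomorph_cylMap :
    IsLocalDiffeomorph (I.prod 𝓘(ℝ)) (I.prod 𝓘(ℝ)) ∞ (cylMap φ s) := by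
  let τ : ℝ ≃ₘ^∞⟮𝓘(ℝ), 𝓘(ℝ)⟯ ℝ :=
    { toEquiv := Equiv.addRight s
      contMDiff_toFun := (contDiff_id.add contDiff_const).contMDiff
      contMDiff_invFun := (contDiff_id.add contDiff_const).contMDiff }
  exact (φ.prodCongr τ).isLocalDiffeomorph

theorem mfderiv_cylMap (p : M × ℝ) (u : TangentSpace I p.1) (r : ℝ) :
    mfderiv (I.prod 𝓘(ℝ)) (I.prod 𝓘(ℝ)) (cylMap φ s) p ((u, r) : E × ℝ) =
      ((mfderiv I I φ p.1 u, r) : E × ℝ) := by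
  have h1 : MDifferentiableAt I I φ p.1 := φ.contMDiff.contMDiffAt.mdifferentiableAt (by simp)
  have h2 : HasMFDerivAt 𝓘(ℝ) 𝓘(ℝ) (fun t : ℝ => t + s) p.2 (ContinuousLinearMap.id ℝ ℝ) :=
    ((hasFDerivAt_id (𝕜 := ℝ) p.2).add_const s).hasMFDerivAt
  have h3 : mfderiv (I.prod 𝓘(ℝ)) (I.prod 𝓘(ℝ)) (cylMap φ s) p = _ :=
    mfderiv_prodMap (p := p) h1 h2.mdifferentiableAt
  rw [h2.mfderiv] at h3
  exact congr($h3 ((u, r) : E × ℝ))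

theorem mpullback_cylMap (W : Π p : M × ℝ, TangentSpace (I.prod 𝓘(ℝ)) p) (p : M × ℝ) :
    mpullback (I.prod 𝓘(ℝ)) (I.prod 𝓘(ℝ)) (cylMap φ s) W p =
      ((mpullback I I φ (sliceField W (p.2 + s)) p.1, (W (cylMap φ s p)).2) : E × ℝ) := by
  have hT := isLocalDiffeomorph_cylMap (φ := φ) (s := s)
  refine (hT.isInvertible_mfderiv p).injective ?_
  rw [hT.mfderiv_mpullback]
  refine Eq.trans ?_ (mfderiv_cylMap p _ _).symm
  refine Prod.ext ?_ rfl
  exact (φ.isLocalDiffeomorph.mfderiv_mpullback p.1 (sliceField W (p.2 + s))).symm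

/-- Every ingredient of `cylLin` is natural: the slice derivative and the `g`-dual because `φ`
preserves `D` and `g`, the derivative of the `t`-component by the chain rule, and the bracket
because `∂_t` is invariant. `cylLin_conj` assembles them. -/
theorem connRelated_cylMap (hφ : IsStatisticalAut D g φ) :
    ConnRelated (cylMap φ s) (cylConn D g l a) (cylConn D g l a) := by
  intro U hU W hW p hp v
  have hT := isLocalDiffeomorph_cylMap (φ := φ) (s := s)
  have hφl := φ.isLocalDiffeomorph
  have key : ∀ (u : TangentSpace I p.1) (r : ℝ),
      mfderiv (I.prod 𝓘(ℝ)) (I.prod 𝓘(ℝ)) (cylMap φ s) p (cylConn D g l a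
        (mpullback (I.prod 𝓘(ℝ)) (I.prod 𝓘(ℝ)) (cylMap φ s) W) p ((u, r) : E × ℝ)) =
      cylConn D g l a W (cylMap φ s p) ((mfderiv I I φ p.1 u, r) : E × ℝ) := by
    intro u r
    have hslice : sliceField (mpullback (I.prod 𝓘(ℝ)) (I.prod 𝓘(ℝ)) (cylMap φ s) W) p.2 =
        mpullback I I φ (sliceField W (p.2 + s)) :=
      funext fun m => congrArg Prod.fst (mpullback_cylMap W (m, p.2))
    have hconn := hφ.connection _ (hU.preimage (Continuous.prodMk_left (p.2 + s)))
      _ (hW.sliceField hU (p.2 + s)) p.1 hp u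
    have hrad : mpullback (I.prod 𝓘(ℝ)) (I.prod 𝓘(ℝ)) (cylMap φ s) radialField =
        radialField (I := I) := by
      funext q
      rw [mpullback_cylMap]
      refine Prod.ext ?_ rfl
      exact map_zero _
    have hbr := hT.mfderiv_mlieBracket hU (smoothFieldOn_radialField U) hW hp
    rw [hrad] at hbr
    have hsnd : (fun q => ((mpullback (I.prod 𝓘(ℝ)) (I.prod 𝓘(ℝ)) (cylMap φ s) W q).2 : ℝ)) =
        fun q => (W (cylMap φ s q)).2 :=
      funext fun q => by rw [mpullback_cylMap]
    have hd := hT.mvfderiv_comp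
      (mdifferentiableAt_snd_field (hW.mdifferentiableAt hU hp)) ((u, (0 : ℝ)) : E × ℝ)
    rw [mfderiv_cylMap] at hd
    have e2 : (mpullback (I.prod 𝓘(ℝ)) (I.prod 𝓘(ℝ)) (cylMap φ s) W p).2 =
        (W (cylMap φ s p)).2 := congrFun hsnd p
    have e4 : ((mfderiv I I φ p.1 (mpullback (I.prod 𝓘(ℝ)) (I.prod 𝓘(ℝ)) (cylMap φ s) W p).1,
        (mpullback (I.prod 𝓘(ℝ)) (I.prod 𝓘(ℝ)) (cylMap φ s) W p).2) : E × ℝ) =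
        W (cylMap φ s p) :=
      (mfderiv_cylMap (φ := φ) (s := s) p _ _).symm.trans (hT.mfderiv_mpullback p W)
    have e3 : ((mfderiv I I φ p.1 (mlieBracket (I.prod 𝓘(ℝ)) radialField
          (mpullback (I.prod 𝓘(ℝ)) (I.prod 𝓘(ℝ)) (cylMap φ s) W) p).1,
        (mlieBracket (I.prod 𝓘(ℝ)) radialField
          (mpullback (I.prod 𝓘(ℝ)) (I.prod 𝓘(ℝ)) (cylMap φ s) W) p).2) : E × ℝ) =
        mlieBracket (I.prod 𝓘(ℝ)) radialField W (cylMap φ s p) :=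
      (mfderiv_cylMap (φ := φ) (s := s) p _ _).symm.trans hbr
    have hA : mfderiv I I φ p.1 (D (sliceField (mpullback (I.prod 𝓘(ℝ)) (I.prod 𝓘(ℝ))
        (cylMap φ s) W) p.2) p.1 u) = D (sliceField W (p.2 + s)) (φ p.1) (mfderiv I I φ p.1 u) := by
      rw [hslice]
      exact hconn
    have hB : mvfderiv (I.prod 𝓘(ℝ)) (fun q => ((mpullback (I.prod 𝓘(ℝ)) (I.prod 𝓘(ℝ))
        (cylMap φ s) W q).2 : ℝ)) p ((u, (0 : ℝ)) : E × ℝ) =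
        mvfderiv (I.prod 𝓘(ℝ)) (fun q => ((W q).2 : ℝ)) (cylMap φ s p)
          ((mfderiv I I φ p.1 u, (0 : ℝ)) : E × ℝ) := by
      rw [hsnd]
      exact hd
    have hG : g.inner p.1 (mpullback (I.prod 𝓘(ℝ)) (I.prod 𝓘(ℝ)) (cylMap φ s) W p).1 u =
        g.inner (φ p.1) (W (cylMap φ s p)).1 (mfderiv I I φ p.1 u) := by
      refine (hφ.metric p.1 _ u).symm.trans ?_
      exact congrArg (fun w => g.inner (φ p.1) w (mfderiv I I φ p.1 u))
        (congrArg (Prod.fst (α := E) (β := ℝ)) e4)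
    exact (mfderiv_cylMap p _ _).trans (cylLin_conj (E := E) (mfderiv I I φ p.1) hA hB hG e3 e4)
  exact (key v.1 v.2).trans (congrArg _ (mfderiv_cylMap p v.1 v.2).symm)

theorem cylForm_cylMap (p : M × ℝ) (v : TangentSpace (I.prod 𝓘(ℝ)) p) :
    cylForm (cylMap φ s p) (mfderiv (I.prod 𝓘(ℝ)) (I.prod 𝓘(ℝ)) (cylMap φ s) p v) =
      cylForm p v := by
  have h := congrArg (cylForm (I := I) (cylMap φ s p)) (mfderiv_cylMap (φ := φ) (s := s) p v.1 v.2)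
  exact h

theorem cylBilin_cylMap (hφ : IsStatisticalAut D g φ) (α β : ℝ) (p : M × ℝ)
    (v w : TangentSpace (I.prod 𝓘(ℝ)) p) :
    cylBilin g α β (cylMap φ s p) (mfderiv (I.prod 𝓘(ℝ)) (I.prod 𝓘(ℝ)) (cylMap φ s) p v)
      (mfderiv (I.prod 𝓘(ℝ)) (I.prod 𝓘(ℝ)) (cylMap φ s) p w) = cylBilin g α β p v w :=
  (congrArg₂ (fun v w => cylBilin g α β (cylMap φ s p) v w) (mfderiv_cylMap p v.1 v.2)
    (mfderiv_cylMap p w.1 w.2)).trans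
    (congrArg (fun z => α * z + β * (v.2 * w.2)) (hφ.metric p.1 v.1 w.1))

theorem mfderiv_cylMap_cylLee (p : M × ℝ) :
    mfderiv (I.prod 𝓘(ℝ)) (I.prod 𝓘(ℝ)) (cylMap φ s) p (cylLee p) = cylLee (cylMap φ s p) :=
  (mfderiv_cylMap p 0 (-2)).trans (Prod.ext (map_zero (mfderiv I I φ p.1)) rfl)

/-- This passes from invariance under one generator to constancy on fibres. Allowing either point to
be the iterate replaces negative powers, and `P` restricts to points over the domain of a local
field. -/
theorem eq_of_iterate {N A : Type*} {T : N → N} {Q : N → A} {P : N → Prop}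
    (hP : ∀ x, P (T x) ↔ P x) (hQ : ∀ x, P x → Q (T x) = Q x) {p p' : N}
    (h : ∃ k : ℕ, T^[k] p = p' ∨ T^[k] p' = p) (hp : P p) : Q p = Q p' := by
  have key : ∀ (k : ℕ) (x : N), (P (T^[k] x) ↔ P x) ∧ (P x → Q (T^[k] x) = Q x) := by
    intro k
    induction k with
    | zero => exact fun x => ⟨Iff.rfl, fun _ => rfl⟩
    | succ k ih =>
      intro x
      rw [Function.iterate_succ_apply]
      exact ⟨(ih (T x)).1.trans (hP x), fun hx =>
        ((ih (T x)).2 ((hP x).2 hx)).trans (hQ x hx)⟩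
  obtain ⟨k, rfl | rfl⟩ := h
  · exact ((key k p).2 hp).symm
  · exact (key k p').2 ((key k p').1.1 hp)

/-- The structures on the cylinder descend to every quotient by an automorphism. -/
theorem exists_descended_structures {C : Type*} [TopologicalSpace C]
    [ChartedSpace (ModelProd H ℝ) C] [IsManifold (I.prod 𝓘(ℝ)) ∞ C] {F : M × ℝ → C} {c : ℝ}
    (hF : IsLocalDiffeomorph (I.prod 𝓘(ℝ)) (I.prod 𝓘(ℝ)) ∞ F) (hsurj : Function.Surjective F)
    (hFφ : ∀ p, F (cylMap φ s p) = F p)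
    (hfib : ∀ p p', F p = F p' → ∃ k : ℕ, (cylMap φ s)^[k] p = p' ∨ (cylMap φ s)^[k] p' = p)
    (hs : IsSmoothConn D) (h : IsStatisticalOfConstCurvature D g c) (hφ : IsStatisticalAut D g φ)
    (hla : c + a * l = 0) (hal : a = l - 2) (ha : 0 < 2 * a) (hl : 0 < 2 * l) :
    ∃ (nabla : AffineConnection (I.prod 𝓘(ℝ)) C)
      (θ : Π x : C, TangentSpace (I.prod 𝓘(ℝ)) x →L[ℝ] ℝ)
      (gK k : RiemMetric (I.prod 𝓘(ℝ)) C) (ξ : Π x : C, TangentSpace (I.prod 𝓘(ℝ)) x),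
      (∀ p v, θ (F p) (mfderiv (I.prod 𝓘(ℝ)) (I.prod 𝓘(ℝ)) F p v) = cylForm p v) ∧
      (∀ p v w, k.inner (F p) (mfderiv (I.prod 𝓘(ℝ)) (I.prod 𝓘(ℝ)) F p v)
        (mfderiv (I.prod 𝓘(ℝ)) (I.prod 𝓘(ℝ)) F p w) = cylBilin g 1 1 p v w) ∧
      IsRadiantLCH nabla k θ ξ (-2 * l) ∧ IsKoszulHessian nabla gK θ := by
  have hT := isLocalDiffeomorph_cylMap (φ := φ) (s := s)
  have hconn : ConnRelated F (cylConn D g l a) (pushConn hF hsurj (cylConn D g l a)) := by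
    refine connRelated_pushConn hF hsurj (cylConn D g l a) fun U hU Y hY p p' hp hpp => ?_
    -- A fixed codomain, so that values at different points of a fibre can be compared.
    let Q : M × ℝ → (E × ℝ →L[ℝ] E × ℝ) := fun p => pushConnAt F (cylConn D g l a) Y p
    have hQ : ∀ x, F x ∈ U → Q (cylMap φ s x) = Q x := fun x hx =>
      pushConnAt_deck hF hT hFφ (connRelated_cylMap hφ) hU hY hx
    exact eq_of_iterate (P := fun p => F p ∈ U) (fun x => by rw [hFφ]) hQ (hfib p p' hpp) hp
  have hθ := pushForm_apply hF hsurj (θ := cylForm (I := I)) fun p p' hp => by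
    let Q : M × ℝ → (E × ℝ →L[ℝ] ℝ) :=
      fun p => pushFormAt F (cylForm (I := I)) p
    have hQ : ∀ x, True → Q (cylMap φ s x) = Q x := fun x _ =>
      pushFormAt_deck hF hT hFφ cylForm_cylMap x
    exact eq_of_iterate (P := fun _ => True) (fun _ => Iff.rfl) hQ (hfib p p' hp) trivial
  have hb : ∀ {α β : ℝ} (hα : 0 < α) (hβ : 0 < β) (p p' : M × ℝ), F p = F p' →
      (pushBilinAt F (cylRiem g hα hβ).inner p : E × ℝ →L[ℝ] E × ℝ →L[ℝ] ℝ) =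
        pushBilinAt F (cylRiem g hα hβ).inner p' := by
    intro α β hα hβ p p' hp
    let Q : M × ℝ → (E × ℝ →L[ℝ] E × ℝ →L[ℝ] ℝ) := fun p =>
      pushBilinAt F (cylRiem g hα hβ).inner p
    have hQ : ∀ x, True → Q (cylMap φ s x) = Q x := fun x _ =>
      pushBilinAt_deck hF hT hFφ (cylBilin_cylMap hφ α β) x
    exact eq_of_iterate (P := fun _ => True) (fun _ => Iff.rfl) hQ (hfib p p' hp) trivial
  have hξ := mpullback_pushField hF hsurj (ξ := cylLee (I := I)) fun p p' hp => by
    let Q : M × ℝ → E × ℝ := fun p => mfderiv (I.prod 𝓘(ℝ)) (I.prod 𝓘(ℝ)) F p (cylLee p)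
    have hQ : ∀ x, True → Q (cylMap φ s x) = Q x := fun x _ =>
      (congrArg _ (mfderiv_cylMap_cylLee x).symm).trans (mfderiv_deck hF hT hFφ x _)
    exact eq_of_iterate (P := fun _ => True) (fun _ => Iff.rfl) hQ (hfib p p' hp) trivial
  refine ⟨pushConn hF hsurj (cylConn D g l a), pushForm hsurj cylForm,
    pushMetric hF hsurj (cylRiem g ha hl) (hb ha hl),
    pushMetric hF hsurj (cylRiem g one_pos one_pos) (hb one_pos one_pos), pushField hsurj cylLee,
    hθ, pushMetric_apply hF hsurj _ _, ?_, ?_⟩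
  · exact hconn.isRadiantLCH hF hsurj (pushMetric_apply hF hsurj _ _) hθ hξ
      (isSmoothConn_cylConn hs) isSmoothForm_cylForm (isRadiantLCH_cylConn hs h hla hal)
  · exact hconn.isKoszulHessian hF hsurj (pushMetric_apply hF hsurj _ _) hθ
      (isSmoothConn_cylConn hs) isSmoothForm_cylForm (isKoszulHessian_cylConn hs h hla ha hl)

end CylinderDeck

/-! ### Smooth structure on the base of a covering -/

section Quotient

variable {E : Type*} [NormedAddCommGroup E] [NormedSpace ℝ E]
  {H : Type*} [TopologicalSpace H] {I : ModelWithCorners ℝ E H}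
  {N : Type*} [TopologicalSpace N] [ChartedSpace H N] [IsManifold I ∞ N]
  {C : Type*} [TopologicalSpace C] {pr : N → C} {V : N → Set N}

/-- The homeomorphism of an open set on which an open continuous map is injective onto its image. -/
def sheet (hc : Continuous pr) (ho : IsOpenMap pr) (hV : ∀ p, IsOpen (V p))
    (hinj : ∀ p, InjOn pr (V p)) (p : N) : OpenPartialHomeomorph N C :=
  haveI : Nonempty N := ⟨p⟩
  OpenPartialHomeomorph.ofContinuousOpenRestrict ((hinj p).toPartialEquiv pr (V p))
    hc.continuousOn (ho.domRestrict (hV p)) (hV p)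

variable (hc : Continuous pr) (ho : IsOpenMap pr) (hV : ∀ p, IsOpen (V p))
  (hinj : ∀ p, InjOn pr (V p))

theorem sheet_apply (p x : N) : sheet hc ho hV hinj p x = pr x := rfl

/-- If `T` preserves `pr` and sends `p₁` into the sheet of `p`, then near `p₁` the point of that
sheet over `pr x` must be `T x`. All smoothness on the quotient reduces to this. -/
theorem sheet_symm_eventuallyEq {T : N → N} {p p₁ : N} (hT : ContinuousAt T p₁)
    (hpr : ∀ x, pr (T x) = pr x) (h : T p₁ ∈ V p) :
    (fun x => (sheet hc ho hV hinj p).symm (pr x)) =ᶠ[𝓝 p₁] T := by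
  filter_upwards [hT.preimage_mem_nhds ((hV p).mem_nhds h)] with x hx
  rw [← hpr x]
  exact (sheet hc ho hV hinj p).left_inv hx

/-- The charts of the base of a covering. -/
def quotientChart (p : N) : OpenPartialHomeomorph C H :=
  (sheet hc ho hV hinj p).symm ≫ₕ chartAt H p

/-- The charted space structure on the quotient. -/
@[reducible]
def quotientChartedSpace (hpV : ∀ p, p ∈ V p) (hsurj : Function.Surjective pr) :
    ChartedSpace H C where
  atlas := range (quotientChart (H := H) hc ho hV hinj)
  chartAt x := quotientChart hc ho hV hinj (Function.surjInv hsurj x)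
  mem_chart_source x := by
    have hx : sheet hc ho hV hinj (Function.surjInv hsurj x) (Function.surjInv hsurj x) = x :=
      Function.surjInv_eq hsurj x
    have h1 : Function.surjInv hsurj x ∈ (sheet hc ho hV hinj (Function.surjInv hsurj x)).source :=
      hpV _
    have h2 := (sheet hc ho hV hinj (Function.surjInv hsurj x)).map_source h1
    have h3 := (sheet hc ho hV hinj (Function.surjInv hsurj x)).left_inv h1
    rw [hx] at h2 h3
    refine ⟨h2, ?_⟩
    change (sheet hc ho hV hinj (Function.surjInv hsurj x)).symm x ∈
      (chartAt H (Function.surjInv hsurj x)).source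
    rw [h3]
    exact mem_chart_source H _
  chart_mem_atlas x := mem_range_self _

/-- Near each point, a change of charts is a deck transformation read in charts of `N`. -/
theorem contMDiffAt_quotient_transition
    (hT : ∀ p p', pr p = pr p' → ∃ T : N → N, ContMDiff I I ∞ T ∧ T p = p' ∧ ∀ x, pr (T x) = pr x)
    {p p' : N} {y : H} (hy : y ∈ ((quotientChart (H := H) hc ho hV hinj p).symm ≫ₕ
      quotientChart (H := H) hc ho hV hinj p').source) :
    ContMDiffAt I I ∞ ((quotientChart (H := H) hc ho hV hinj p).symm ≫ₕ
      quotientChart (H := H) hc ho hV hinj p') y := by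
  set e := sheet hc ho hV hinj p
  set e' := sheet hc ho hV hinj p'
  have hy1 : y ∈ (chartAt H p).target := hy.1.1
  have hy2 : (chartAt H p).symm y ∈ e.source := hy.1.2
  have hy3 : pr ((chartAt H p).symm y) ∈ e'.target := hy.2.1
  have hy4 : e'.symm (pr ((chartAt H p).symm y)) ∈ (chartAt H p').source := hy.2.2
  have hfib : pr ((chartAt H p).symm y) = pr (e'.symm (pr ((chartAt H p).symm y))) :=
    (e'.right_inv hy3).symm
  obtain ⟨T, hTs, hTp, hpr⟩ := hT _ _ hfib
  have hTV : T ((chartAt H p).symm y) ∈ V p' := hTp ▸ e'.map_target hy3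
  have h1 := sheet_symm_eventuallyEq hc ho hV hinj hTs.continuous.continuousAt hpr hTV
  have hcs : ContMDiffAt I I ∞ (chartAt H p).symm y :=
    contMDiffOn_chart_symm.contMDiffAt ((chartAt H p).open_target.mem_nhds hy1)
  have h2 : ContMDiffAt I I ∞ (fun z => chartAt H p' (T ((chartAt H p).symm z))) y := by
    have h3 : ContMDiffAt I I ∞ (chartAt H p') (T ((chartAt H p).symm y)) :=
      contMDiffOn_chart.contMDiffAt ((chartAt H p').open_source.mem_nhds (hTp ▸ hy4))
    exact h3.comp y ((hTs _).comp y hcs)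
  refine h2.congr_of_eventuallyEq ?_
  filter_upwards [hcs.continuousAt.eventually h1] with z hz
  exact congrArg (chartAt H p') hz

theorem isManifold_quotient (hpV : ∀ p, p ∈ V p) (hsurj : Function.Surjective pr)
    (hT : ∀ p p', pr p = pr p' → ∃ T : N → N, ContMDiff I I ∞ T ∧ T p = p' ∧ ∀ x, pr (T x) = pr x) :
    let _ := quotientChartedSpace (H := H) hc ho hV hinj hpV hsurj
    IsManifold I ∞ C := by
  intro _
  refine isManifold_of_contDiffOn I ∞ C ?_
  rintro _ _ ⟨p, rfl⟩ ⟨p', rfl⟩ z ⟨hz, hzr⟩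
  have h1 := contMDiffAt_quotient_transition hc ho hV hinj hT hz
  obtain ⟨y, rfl⟩ := hzr
  rw [I.left_inv] at h1
  have h2 := (contMDiffAt_iff.1 h1).2
  simp only [mfld_simps] at h2
  exact h2.mono inter_subset_right

theorem isLocalDiffeomorph_quotient (hpV : ∀ p, p ∈ V p) (hsurj : Function.Surjective pr)
    (hT : ∀ p p', pr p = pr p' → ∃ T : N → N, ContMDiff I I ∞ T ∧ T p = p' ∧ ∀ x, pr (T x) = pr x) :
    let _ := quotientChartedSpace (H := H) hc ho hV hinj hpV hsurj
    IsLocalDiffeomorph I I ∞ pr := by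
  intro _
  have hM := isManifold_quotient (I := I) hc ho hV hinj hpV hsurj hT
  let s := Function.surjInv hsurj
  have hs : ∀ x, pr (s x) = x := Function.surjInv_eq hsurj
  have hpr : ContMDiff I I ∞ pr := by
    intro p
    obtain ⟨T, hTs, hTp, hprT⟩ := hT p (s (pr p)) (hs _).symm
    rw [contMDiffAt_iff_target]
    refine ⟨hc.continuousAt, ?_⟩
    have h1 := sheet_symm_eventuallyEq hc ho hV hinj hTs.continuous.continuousAt hprT
      (p := s (pr p)) (by rw [hTp]; exact hpV _)
    have h2 : ContMDiffAt I 𝓘(ℝ, E) ∞ (fun x => extChartAt I (s (pr p)) (T x)) p := by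
      refine ContMDiffAt.comp p ?_ (hTs p)
      rw [hTp]
      exact contMDiffAt_extChartAt
    refine h2.congr_of_eventuallyEq ?_
    filter_upwards [h1] with x hx
    exact congrArg (extChartAt I (s (pr p))) hx
  have hsymm : ∀ p, ContMDiffOn I I ∞ (sheet hc ho hV hinj p).symm
      (sheet hc ho hV hinj p).target := by
    intro p x hx
    have hp₁ := (sheet hc ho hV hinj p).map_target hx
    have hx₁ : pr ((sheet hc ho hV hinj p).symm x) = x := (sheet hc ho hV hinj p).right_inv hx
    obtain ⟨T, hTs, hTp, hprT⟩ := hT (s x) _ ((hs x).trans hx₁.symm)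
    have h1 := sheet_symm_eventuallyEq hc ho hV hinj hTs.continuous.continuousAt hprT
      (p := p) (by rw [hTp]; exact hp₁)
    have hxs : x ∈ (sheet hc ho hV hinj (s x)).target := by
      rw [← hs x, hs x]
      have := (sheet hc ho hV hinj (s x)).map_source (hpV (s x))
      rwa [sheet_apply, hs] at this
    have h2 : (sheet hc ho hV hinj (s x)).symm x = s x := by
      have := (sheet hc ho hV hinj (s x)).left_inv (hpV (s x))
      rwa [sheet_apply, hs] at this
    -- The chart at `x` is the inverse of the sheet at `s x` followed by a chart of `N`, so undoing
    -- the latter shows that this inverse sheet is smooth at `x`; inverses of other sheets differ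
    -- from it by a deck transformation.
    have h3 : ContMDiffAt I I ∞ (fun y => (chartAt H (s x)).symm (chartAt H x y)) x := by
      refine ContMDiffAt.comp x ?_
        (contMDiffOn_chart.contMDiffAt ((chartAt H x).open_source.mem_nhds (mem_chart_source H x)))
      exact contMDiffOn_chart_symm.contMDiffAt ((chartAt H (s x)).open_target.mem_nhds
        ((chartAt H x).map_source (mem_chart_source H x)).1)
    have h4 : (fun y => (chartAt H (s x)).symm (chartAt H x y)) =ᶠ[𝓝 x]
        (sheet hc ho hV hinj (s x)).symm := by
      filter_upwards [(chartAt H x).open_source.mem_nhds (mem_chart_source H x)] with y hy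
      exact (chartAt H (s x)).left_inv hy.2
    have h5 := h3.congr_of_eventuallyEq h4.symm
    have h6 : ContMDiffAt I I ∞ (fun y => T ((sheet hc ho hV hinj (s x)).symm y)) x :=
      ContMDiffAt.comp x (hTs _) h5
    refine (h6.congr_of_eventuallyEq ?_).contMDiffWithinAt
    have h7 := ((sheet hc ho hV hinj (s x)).continuousAt_symm hxs).eventually
      (h2.symm ▸ h1 : _ =ᶠ[𝓝 ((sheet hc ho hV hinj (s x)).symm x)] _)
    filter_upwards [h7, (sheet hc ho hV hinj (s x)).open_target.mem_nhds hxs] with y hy hy'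
    rw [← hy]
    exact congrArg _ ((sheet hc ho hV hinj (s x)).right_inv hy').symm
  intro p
  exact ⟨{ toPartialEquiv := (sheet hc ho hV hinj p).toPartialEquiv
           open_source := hV p
           open_target := (sheet hc ho hV hinj p).open_target
           contMDiffOn_toFun := hpr.contMDiffOn
           contMDiffOn_invFun := hsymm p }, hpV p, fun _ _ => rfl⟩

end Quotient

/-! ### The cyclic action on the cone, measured by logarithmic height -/

section ConeAction

variable {M : Type*} (φ : M ≃ M) {q : ℝ} (hq : 0 < q)

theorem conePerm_zpow_snd (j : ℤ) (p : M × PosReal) :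
    (((conePerm φ q hq ^ j) p).2 : ℝ) = q ^ j * p.2 := by
  induction j using Int.induction_on generalizing p with
  | zero => simp
  | succ i ih =>
    rw [zpow_add_one, Equiv.Perm.mul_apply, ih, zpow_add_one₀ hq.ne', mul_assoc]
    rfl
  | pred i ih =>
    rw [zpow_sub_one, Equiv.Perm.mul_apply, ih, zpow_sub_one₀ hq.ne', mul_assoc]
    rfl

theorem log_conePerm_zpow_snd (j : ℤ) (p : M × PosReal) :
    Real.log ((conePerm φ q hq ^ j) p).2 = j * Real.log q + Real.log p.2 := by
  have hp : (0 : ℝ) < p.2 := p.2.2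
  rw [conePerm_zpow_snd, Real.log_mul (zpow_pos hq j).ne' hp.ne', Real.log_zpow]

theorem MappingTorus.proj_eq_iff {p p' : M × PosReal} :
    MappingTorus.proj φ q hq p = MappingTorus.proj φ q hq p' ↔
      ∃ j : ℤ, (conePerm φ q hq ^ j) p' = p := by
  refine Quotient.eq.trans ?_
  rw [MulAction.orbitRel_apply, MulAction.mem_orbit_iff]
  constructor
  · rintro ⟨⟨_, j, rfl⟩, h⟩
    exact ⟨j, h⟩
  · rintro ⟨j, h⟩
    exact ⟨⟨_, j, rfl⟩, h⟩

theorem MappingTorus.proj_conePerm_zpow (j : ℤ) (p : M × PosReal) :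
    MappingTorus.proj φ q hq ((conePerm φ q hq ^ j) p) = MappingTorus.proj φ q hq p :=
  (MappingTorus.proj_eq_iff φ hq).2 ⟨j, rfl⟩

theorem MappingTorus.proj_surjective : Function.Surjective (MappingTorus.proj φ q hq) :=
  Quotient.mk_surjective

/-- The points of the cone whose logarithmic height differs from that of `p` by less than half
a period. -/
def coneSlab (q : ℝ) (p : M × PosReal) : Set (M × PosReal) :=
  {p' | |Real.log p'.2 - Real.log p.2| < |Real.log q| / 2}

/-- Heights in a slab differ by less than `|log q|`, whereas the `j`-th power of the generator moves
heights by `j log q`; hence `j = 0`. -/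
theorem injOn_proj_coneSlab (hq1 : q ≠ 1) (p : M × PosReal) :
    InjOn (MappingTorus.proj φ q hq) (coneSlab q p) := by
  intro x hx y hy hxy
  obtain ⟨j, rfl⟩ := (MappingTorus.proj_eq_iff φ hq).1 hxy
  have hl : 0 < |Real.log q| :=
    abs_pos.2 (Real.log_ne_zero_of_pos_of_ne_one hq hq1)
  have h1 : |(j : ℝ) * Real.log q| < |Real.log q| := by
    have h2 : (j : ℝ) * Real.log q = (Real.log ((conePerm φ q hq ^ j) y).2 - Real.log p.2)
        - (Real.log y.2 - Real.log p.2) := by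
      rw [log_conePerm_zpow_snd]; ring
    rw [h2]
    refine (abs_sub _ _).trans_lt ?_
    have h3 : |Real.log ((conePerm φ q hq ^ j) y).2 - Real.log p.2| < |Real.log q| / 2 := hx
    have h4 : |Real.log y.2 - Real.log p.2| < |Real.log q| / 2 := hy
    linarith
  rw [abs_mul] at h1
  have h5 : |(j : ℝ)| < 1 := by
    by_contra hj
    exact absurd h1 (not_lt.2 (le_mul_of_one_le_left hl.le (not_lt.1 hj)))
  have h6 : |j| < 1 := by exact_mod_cast h5
  rw [Int.abs_lt_one_iff.1 h6]
  rfl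

theorem mem_coneSlab_self (hq : 0 < q) (hq1 : q ≠ 1) (p : M × PosReal) : p ∈ coneSlab q p := by
  have hl : 0 < |Real.log q| :=
    abs_pos.2 (Real.log_ne_zero_of_pos_of_ne_one hq hq1)
  change |Real.log p.2 - Real.log p.2| < _
  rw [sub_self, abs_zero]
  linarith

variable [TopologicalSpace M]

theorem continuous_log_snd : Continuous (fun p : M × PosReal => Real.log p.2) := by
  refine (continuous_subtype_val.comp continuous_snd).log fun p => ?_
  have hp : (0 : ℝ) < p.2 := p.2.2
  exact hp.ne'

theorem isOpen_coneSlab (p : M × PosReal) : IsOpen (coneSlab q p) :=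
  isOpen_lt (continuous_log_snd.sub continuous_const).abs continuous_const

/-- Logarithmic heights are bounded by `A` and `B` on the two compact sets, so a power `j` moving
one to meet the other satisfies `|j| ≤ (A + B) / |log q|`. -/
theorem properlyDiscontinuousSMul_conePerm (hq1 : q ≠ 1) :
    ProperlyDiscontinuousSMul (Subgroup.zpowers (conePerm φ q hq)) (M × PosReal) := by
  refine ⟨fun {K L} hK hL => ?_⟩
  obtain ⟨A, hA⟩ := (hK.image continuous_log_snd).isBounded.exists_norm_le
  obtain ⟨B, hB⟩ := (hL.image continuous_log_snd).isBounded.exists_norm_le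
  have hl : 0 < |Real.log q| :=
    abs_pos.2 (Real.log_ne_zero_of_pos_of_ne_one hq hq1)
  refine ((finite_Icc (-⌈(A + B) / |Real.log q|⌉) ⌈(A + B) / |Real.log q|⌉).image
    (fun j => (⟨conePerm φ q hq ^ j, j, rfl⟩ :
      Subgroup.zpowers (conePerm φ q hq)))).subset ?_
  rintro ⟨_, j, rfl⟩ ⟨_, ⟨p, hp, rfl⟩, hpL⟩
  refine ⟨j, ?_, rfl⟩
  have h1 : |Real.log p.2| ≤ A := hA _ (mem_image_of_mem _ hp)
  have h2 : |Real.log ((conePerm φ q hq ^ j) p).2| ≤ B := hB _ (mem_image_of_mem _ hpL)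
  have h3 : |(j : ℝ)| * |Real.log q| ≤ A + B := by
    rw [← abs_mul]
    have h4 : (j : ℝ) * Real.log q = Real.log ((conePerm φ q hq ^ j) p).2 - Real.log p.2 := by
      rw [log_conePerm_zpow_snd]; ring
    rw [h4]
    refine (abs_sub _ _).trans ?_
    linarith
  have h5 : |(j : ℝ)| ≤ ⌈(A + B) / |Real.log q|⌉ :=
    ((le_div_iff₀ hl).2 h3).trans (Int.le_ceil _)
  exact abs_le.1 (by exact_mod_cast h5)

end ConeAction

/-! ### Smoothness of the action and the mapping torus as a manifold -/

section PosRealManifold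

theorem contMDiff_posReal_iff {E : Type*} [NormedAddCommGroup E] [NormedSpace ℝ E]
    {H : Type*} [TopologicalSpace H] {I : ModelWithCorners ℝ E H}
    {M : Type*} [TopologicalSpace M] [ChartedSpace H M] {f : M → PosReal} :
    ContMDiff I 𝓘(ℝ) ∞ f ↔ ContMDiff I 𝓘(ℝ) ∞ (fun x => (f x : ℝ)) :=
  (ContMDiff.subtypeVal_comp_iff PosReal f).symm

/-- The exponential as a diffeomorphism onto the half-line. -/
def expDiffeo : ℝ ≃ₘ^∞⟮𝓘(ℝ), 𝓘(ℝ)⟯ PosReal where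
  toFun t := ⟨Real.exp t, Real.exp_pos t⟩
  invFun s := Real.log s
  left_inv t := Real.log_exp t
  right_inv s := Subtype.ext (Real.exp_log s.2)
  contMDiff_toFun := contMDiff_posReal_iff.2 Real.contDiff_exp.contMDiff
  contMDiff_invFun := by
    intro s
    have hs : (0 : ℝ) < s := s.2
    exact (Real.contDiffAt_log.2 hs.ne').contMDiffAt.comp s contMDiff_subtype_val.contMDiffAt

theorem contMDiff_posReal_mul {r : ℝ} (hr : 0 < r) :
    ContMDiff 𝓘(ℝ) 𝓘(ℝ) ∞ (fun s : PosReal => (⟨r * s, mul_pos hr s.2⟩ : PosReal)) :=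
  contMDiff_posReal_iff.2 (contMDiff_const.mul contMDiff_subtype_val)

variable {E : Type*} [NormedAddCommGroup E] [NormedSpace ℝ E]
  {H : Type*} [TopologicalSpace H] {I : ModelWithCorners ℝ E H}
  {M : Type*} [TopologicalSpace M] [ChartedSpace H M] (φ : M ≃ₘ^∞⟮I, I⟯ M) {q : ℝ} (hq : 0 < q)

theorem contMDiff_conePerm :
    ContMDiff (I.prod 𝓘(ℝ)) (I.prod 𝓘(ℝ)) ∞ (conePerm φ.toEquiv q hq) :=
  φ.contMDiff.prodMap (contMDiff_posReal_mul hq)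

theorem contMDiff_conePerm_inv :
    ContMDiff (I.prod 𝓘(ℝ)) (I.prod 𝓘(ℝ)) ∞ ((conePerm φ.toEquiv q hq)⁻¹ : Equiv.Perm _) :=
  φ.symm.contMDiff.prodMap (contMDiff_posReal_mul (inv_pos.2 hq))

theorem contMDiff_conePerm_zpow (j : ℤ) :
    ContMDiff (I.prod 𝓘(ℝ)) (I.prod 𝓘(ℝ)) ∞ (conePerm φ.toEquiv q hq ^ j : Equiv.Perm _) := by
  induction j using Int.induction_on with
  | zero => exact contMDiff_id
  | succ i ih =>
    rw [zpow_add_one]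
    exact ih.comp (contMDiff_conePerm φ hq)
  | pred i ih =>
    rw [zpow_sub_one]
    exact ih.comp (contMDiff_conePerm_inv φ hq)

theorem continuousConstSMul_conePerm :
    ContinuousConstSMul (Subgroup.zpowers (conePerm φ.toEquiv q hq)) (M × PosReal) := by
  refine ⟨?_⟩
  rintro ⟨_, j, rfl⟩
  exact (contMDiff_conePerm_zpow φ hq j).continuous

theorem exists_conePerm_of_proj_eq {p p' : M × PosReal}
    (h : MappingTorus.proj φ.toEquiv q hq p = MappingTorus.proj φ.toEquiv q hq p') :
    ∃ T : M × PosReal → M × PosReal, ContMDiff (I.prod 𝓘(ℝ)) (I.prod 𝓘(ℝ)) ∞ T ∧ T p = p' ∧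
      ∀ x, MappingTorus.proj φ.toEquiv q hq (T x) = MappingTorus.proj φ.toEquiv q hq x := by
  obtain ⟨j, hj⟩ := (MappingTorus.proj_eq_iff φ.toEquiv hq).1 h.symm
  exact ⟨_, contMDiff_conePerm_zpow φ hq j, hj, MappingTorus.proj_conePerm_zpow φ.toEquiv hq j⟩

/-- Proper discontinuity and local compactness give the Hausdorff property; the slabs serve as
sheets, and powers of the generator as the deck transformations identifying points of a fibre. -/
theorem mappingTorus_smooth_structure [IsManifold I ∞ M] [T2Space M] [SecondCountableTopology M]
    [LocallyCompactSpace M] (hq1 : q ≠ 1) :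
    T2Space (MappingTorus φ.toEquiv q hq) ∧
      SecondCountableTopology (MappingTorus φ.toEquiv q hq) ∧
      ∃ (_ : ChartedSpace (ModelProd H ℝ) (MappingTorus φ.toEquiv q hq)),
        IsManifold (I.prod 𝓘(ℝ)) ∞ (MappingTorus φ.toEquiv q hq) ∧
        IsLocalDiffeomorph (I.prod 𝓘(ℝ)) (I.prod 𝓘(ℝ)) ∞
          (MappingTorus.proj φ.toEquiv q hq) := by
  have h1 := continuousConstSMul_conePerm φ hq
  have h2 := properlyDiscontinuousSMul_conePerm φ.toEquiv hq hq1
  have h3 : LocallyCompactSpace PosReal := PosReal.isOpen.locallyCompactSpace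
  refine ⟨t2Space_of_properlyDiscontinuousSMul_of_t2Space,
    ContinuousConstSMul.secondCountableTopology, ?_⟩
  have hc : Continuous (MappingTorus.proj φ.toEquiv q hq) := continuous_quot_mk
  have ho : IsOpenMap (MappingTorus.proj φ.toEquiv q hq) := isOpenMap_quotient_mk'_mul
  exact ⟨quotientChartedSpace hc ho (isOpen_coneSlab (q := q))
      (injOn_proj_coneSlab φ.toEquiv hq hq1) (mem_coneSlab_self hq hq1)
      (MappingTorus.proj_surjective φ.toEquiv hq),
    isManifold_quotient (I := I.prod 𝓘(ℝ)) hc ho _ _ _ _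
      fun _ _ => exists_conePerm_of_proj_eq φ hq,
    isLocalDiffeomorph_quotient (I := I.prod 𝓘(ℝ)) hc ho _ _ _ _
      fun _ _ => exists_conePerm_of_proj_eq φ hq⟩

end PosRealManifold

/-! ### Logarithmic coordinates and the structures on the mapping torus -/

section ConeCoordinates

variable {E : Type*} [NormedAddCommGroup E] [NormedSpace ℝ E]
  {H : Type*} [TopologicalSpace H] {I : ModelWithCorners ℝ E H}
  {M : Type*} [TopologicalSpace M] [ChartedSpace H M]

variable (I M) in
/-- The logarithmic coordinates on the cone. -/
def cylConeDiffeo : (M × ℝ) ≃ₘ^∞⟮I.prod 𝓘(ℝ), I.prod 𝓘(ℝ)⟯ (M × PosReal) :=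
  (Diffeomorph.refl I M ∞).prodCongr expDiffeo

theorem cylConeDiffeo_snd (p : M × ℝ) : ((cylConeDiffeo I M p).2 : ℝ) = Real.exp p.2 := rfl

theorem conePerm_cylConeDiffeo (φ : M ≃ₘ^∞⟮I, I⟯ M) {q : ℝ} (hq : 0 < q) (p : M × ℝ) :
    conePerm φ.toEquiv q hq (cylConeDiffeo I M p)
      = cylConeDiffeo I M (cylMap φ (Real.log q) p) := by
  refine Prod.ext rfl (Subtype.ext ?_)
  change q * Real.exp p.2 = Real.exp (p.2 + Real.log q)
  rw [Real.exp_add, Real.exp_log hq, mul_comm]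

variable [IsManifold I ∞ M]

theorem mfderiv_fst_cylConeDiffeo (p : M × ℝ) (v : TangentSpace (I.prod 𝓘(ℝ)) p) :
    mfderiv (I.prod 𝓘(ℝ)) I (Prod.fst : M × PosReal → M) (cylConeDiffeo I M p)
      (mfderiv (I.prod 𝓘(ℝ)) (I.prod 𝓘(ℝ)) (cylConeDiffeo I M) p v) = v.1 := by
  have h1 := mfderiv_comp_apply (I := I.prod 𝓘(ℝ)) (I' := I.prod 𝓘(ℝ)) (I'' := I) p
    (g := (Prod.fst : M × PosReal → M)) mdifferentiableAt_fst
    ((cylConeDiffeo I M).contMDiff.mdifferentiableAt (by simp)) v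
  refine h1.symm.trans ?_
  have h2 : (Prod.fst : M × PosReal → M) ∘ cylConeDiffeo I M = Prod.fst := rfl
  rw [h2, mfderiv_fst]
  rfl

theorem coneDs_cylConeDiffeo (p : M × ℝ) (v : TangentSpace (I.prod 𝓘(ℝ)) p) :
    coneDs I (cylConeDiffeo I M p)
      (mfderiv (I.prod 𝓘(ℝ)) (I.prod 𝓘(ℝ)) (cylConeDiffeo I M) p v) = Real.exp p.2 * v.2 := by
  have hs : ContMDiff (I.prod 𝓘(ℝ)) 𝓘(ℝ) ∞ (fun p : M × PosReal => (p.2 : ℝ)) :=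
    contMDiff_subtype_val.comp contMDiff_snd
  have h1 := mfderiv_comp_apply (I := I.prod 𝓘(ℝ)) (I' := I.prod 𝓘(ℝ)) (I'' := 𝓘(ℝ)) p
    (g := fun p : M × PosReal => (p.2 : ℝ)) (hs.mdifferentiableAt (by simp))
    ((cylConeDiffeo I M).contMDiff.mdifferentiableAt (by simp)) v
  refine h1.symm.trans ?_
  have h2 := mfderiv_comp_apply (I := I.prod 𝓘(ℝ)) (I' := 𝓘(ℝ)) (I'' := 𝓘(ℝ)) p
    (f := (Prod.snd : M × ℝ → ℝ)) (g := Real.exp)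
    (Real.differentiable_exp _).mdifferentiableAt mdifferentiableAt_snd v
  refine Eq.trans h2 ?_
  rw [mfderiv_snd, mfderiv_eq_fderiv]
  change fderiv ℝ Real.exp p.2 v.2 = _
  rw [fderiv_eq_smul_deriv, Real.deriv_exp, smul_eq_mul, mul_comm]

theorem neg_two_mul_coneDs_cylConeDiffeo (p : M × ℝ) (v : TangentSpace (I.prod 𝓘(ℝ)) p) :
    -2 * coneDs I (cylConeDiffeo I M p)
      (mfderiv (I.prod 𝓘(ℝ)) (I.prod 𝓘(ℝ)) (cylConeDiffeo I M) p v)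
        / ((cylConeDiffeo I M p).2 : ℝ) = cylForm p v := by
  rw [coneDs_cylConeDiffeo, cylConeDiffeo_snd, cylForm_apply]
  have := Real.exp_ne_zero p.2
  field_simp

theorem cylMetric_cylConeDiffeo (g : RiemMetric I M) (p : M × ℝ)
    (v w : TangentSpace (I.prod 𝓘(ℝ)) p) :
    cylMetric g (cylConeDiffeo I M p)
      (mfderiv (I.prod 𝓘(ℝ)) (I.prod 𝓘(ℝ)) (cylConeDiffeo I M) p v)
      (mfderiv (I.prod 𝓘(ℝ)) (I.prod 𝓘(ℝ)) (cylConeDiffeo I M) p w) = cylBilin g 1 1 p v w := by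
  rw [cylMetric, coneDs_cylConeDiffeo, coneDs_cylConeDiffeo, mfderiv_fst_cylConeDiffeo,
    mfderiv_fst_cylConeDiffeo, cylConeDiffeo_snd, cylBilin_apply]
  have := Real.exp_ne_zero p.2
  change g.inner p.1 v.1 w.1 + _ = _
  field_simp

variable (φ : M ≃ₘ^∞⟮I, I⟯ M) {q : ℝ} (hq : 0 < q)

theorem conePerm_pow_cylConeDiffeo (k : ℕ) (p : M × ℝ) :
    (conePerm φ.toEquiv q hq ^ k) (cylConeDiffeo I M p)
      = cylConeDiffeo I M ((cylMap φ (Real.log q))^[k] p) := by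
  induction k generalizing p with
  | zero => rfl
  | succ k ih =>
    rw [pow_succ, Equiv.Perm.mul_apply, conePerm_cylConeDiffeo, ih, Function.iterate_succ_apply]

theorem exists_iterate_cylMap_of_proj_eq {p p' : M × ℝ}
    (h : MappingTorus.proj φ.toEquiv q hq (cylConeDiffeo I M p)
      = MappingTorus.proj φ.toEquiv q hq (cylConeDiffeo I M p')) :
    ∃ k : ℕ, (cylMap φ (Real.log q))^[k] p = p' ∨ (cylMap φ (Real.log q))^[k] p' = p := by
  obtain ⟨j, hj⟩ := (MappingTorus.proj_eq_iff φ.toEquiv hq).1 h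
  obtain ⟨k, rfl | rfl⟩ := j.eq_nat_or_neg
  · refine ⟨k, Or.inr ((cylConeDiffeo I M).injective ?_)⟩
    change cylConeDiffeo I M _ = cylConeDiffeo I M _
    rw [← conePerm_pow_cylConeDiffeo φ hq, ← hj, zpow_natCast]
  · refine ⟨k, Or.inl ((cylConeDiffeo I M).injective ?_)⟩
    change cylConeDiffeo I M _ = cylConeDiffeo I M _
    rw [← conePerm_pow_cylConeDiffeo φ hq, ← hj, zpow_neg, zpow_natCast,
      ← Equiv.Perm.mul_apply, mul_inv_cancel, Equiv.Perm.one_apply]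

variable [CompleteSpace E] [FiniteDimensional ℝ E] [T2Space M]

theorem exists_mappingTorus_structures {D : AffineConnection I M} {g : RiemMetric I M} {c : ℝ}
    (hc : c < 0) (hDg : IsStatisticalOfConstCurvature D g c) (hφ : IsStatisticalAut D g φ)
    [ChartedSpace (ModelProd H ℝ) (MappingTorus φ.toEquiv q hq)]
    [IsManifold (I.prod 𝓘(ℝ)) ∞ (MappingTorus φ.toEquiv q hq)]
    (hloc : IsLocalDiffeomorph (I.prod 𝓘(ℝ)) (I.prod 𝓘(ℝ)) ∞ (MappingTorus.proj φ.toEquiv q hq)) :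
    ∃ (nabla : AffineConnection (I.prod 𝓘(ℝ)) (MappingTorus φ.toEquiv q hq))
      (θ : Π x : MappingTorus φ.toEquiv q hq, TangentSpace (I.prod 𝓘(ℝ)) x →L[ℝ] ℝ)
      (gK h : RiemMetric (I.prod 𝓘(ℝ)) (MappingTorus φ.toEquiv q hq))
      (ξ : Π x : MappingTorus φ.toEquiv q hq, TangentSpace (I.prod 𝓘(ℝ)) x),
      (∀ (p : M × PosReal) (v : TangentSpace (I.prod 𝓘(ℝ)) p),
        θ (MappingTorus.proj φ.toEquiv q hq p)
          (mfderiv (I.prod 𝓘(ℝ)) (I.prod 𝓘(ℝ)) (MappingTorus.proj φ.toEquiv q hq) p v)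
            = -2 * coneDs I p v / (p.2 : ℝ)) ∧
      (∀ (p : M × PosReal) (v w : TangentSpace (I.prod 𝓘(ℝ)) p),
        h.inner (MappingTorus.proj φ.toEquiv q hq p)
          (mfderiv (I.prod 𝓘(ℝ)) (I.prod 𝓘(ℝ)) (MappingTorus.proj φ.toEquiv q hq) p v)
          (mfderiv (I.prod 𝓘(ℝ)) (I.prod 𝓘(ℝ)) (MappingTorus.proj φ.toEquiv q hq) p w)
            = cylMetric g p v w) ∧
      IsRadiantLCH nabla h θ ξ (-2 * (1 + Real.sqrt (1 - c))) ∧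
      IsKoszulHessian nabla gK θ := by
  have hsq : Real.sqrt (1 - c) * Real.sqrt (1 - c) = 1 - c := Real.mul_self_sqrt (by linarith)
  have hsq1 : 1 < Real.sqrt (1 - c) := Real.lt_sqrt_of_sq_lt (by linarith)
  let Φ := cylConeDiffeo I M
  let F : M × ℝ → MappingTorus φ.toEquiv q hq := fun p => MappingTorus.proj φ.toEquiv q hq (Φ p)
  have hF : IsLocalDiffeomorph (I.prod 𝓘(ℝ)) (I.prod 𝓘(ℝ)) ∞ F := fun p =>
    IsLocalDiffeomorphAt.comp (hf := Φ.isLocalDiffeomorph p) (hg := hloc (Φ p))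
  have hsurj : Function.Surjective F :=
    (MappingTorus.proj_surjective φ.toEquiv hq).comp Φ.surjective
  have hFφ : ∀ p, F (cylMap φ (Real.log q) p) = F p := fun p => by
    change MappingTorus.proj _ _ _ (cylConeDiffeo I M _) = _
    rw [← conePerm_cylConeDiffeo φ hq]
    exact MappingTorus.proj_conePerm_zpow φ.toEquiv hq 1 _
  obtain ⟨nabla, θ, gK, k, ξ, hθ, hk, hR, hK⟩ := exists_descended_structures hF hsurj hFφ
    (fun p p' h => exists_iterate_cylMap_of_proj_eq φ hq h)
    (isSmoothConn_of_contMDiffCovariantDerivative hDg.smooth) hDg hφ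
    -- These are the solutions of `a = l - 2` and `a l = -c` with `l > 0`; `a` is positive because
    -- `c < 0` makes the root exceed 1.
    (l := 1 + Real.sqrt (1 - c)) (a := Real.sqrt (1 - c) - 1)
    (by linear_combination hsq) (by ring) (by linarith) (by linarith)
  have hdF : ∀ (p : M × ℝ) (v : TangentSpace (I.prod 𝓘(ℝ)) p),
      mfderiv (I.prod 𝓘(ℝ)) (I.prod 𝓘(ℝ)) F p v
        = mfderiv (I.prod 𝓘(ℝ)) (I.prod 𝓘(ℝ)) (MappingTorus.proj φ.toEquiv q hq) (Φ p)
          (mfderiv (I.prod 𝓘(ℝ)) (I.prod 𝓘(ℝ)) Φ p v) := fun p v =>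
    mfderiv_comp_apply (I := I.prod 𝓘(ℝ)) (I' := I.prod 𝓘(ℝ)) (I'' := I.prod 𝓘(ℝ)) p
      ((hloc (Φ p)).mdifferentiableAt (by simp)) (Φ.contMDiff.mdifferentiableAt (by simp)) v
  have hpre : ∀ p : M × PosReal, ∃ p₀ : M × ℝ, Φ p₀ = p := Φ.surjective
  have hprev : ∀ (p : M × ℝ) (v : TangentSpace (I.prod 𝓘(ℝ)) (Φ p)),
      ∃ v₀, mfderiv (I.prod 𝓘(ℝ)) (I.prod 𝓘(ℝ)) Φ p v₀ = v := fun p v =>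
    ((Φ.isLocalDiffeomorph p).mfderivToContinuousLinearEquiv (by simp)).surjective v
  refine ⟨nabla, θ, gK, k, ξ, fun p v => ?_, fun p v w => ?_, hR, hK⟩
  · obtain ⟨p, rfl⟩ := hpre p
    obtain ⟨v, rfl⟩ := hprev p v
    rw [neg_two_mul_coneDs_cylConeDiffeo, ← hθ, hdF]
  · obtain ⟨p, rfl⟩ := hpre p
    obtain ⟨v, rfl⟩ := hprev p v
    obtain ⟨w, rfl⟩ := hprev p w
    rw [cylMetric_cylConeDiffeo, ← hk, hdF, hdF]

end ConeCoordinates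

end AuxiliaryResults

theorem theoremK1 {n : ℕ} {M : Type*} [TopologicalSpace M] [T2Space M]
    [SecondCountableTopology M] [ChartedSpace (EuclideanSpace ℝ (Fin n)) M]
    [IsManifold (𝓡 n) ∞ M]
    (D : AffineConnection (𝓡 n) M) (g : RiemMetric (𝓡 n) M) (c : ℝ) (hc : c < 0)
    (hDg : IsStatisticalOfConstCurvature D g c)
    (φ : M ≃ₘ^∞⟮𝓡 n, 𝓡 n⟯ M) (hφ : IsStatisticalAut D g φ) (q : ℝ) (hq : 0 < q) :
    -- for `q ≠ 1` the mapping torus is a smooth manifold covered by `M × ℝ^{>0}`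
    (q ≠ 1 →
      T2Space (MappingTorus φ.toEquiv q hq) ∧
      SecondCountableTopology (MappingTorus φ.toEquiv q hq) ∧
      ∃ (_ : ChartedSpace (ModelProd (EuclideanSpace ℝ (Fin n)) ℝ) (MappingTorus φ.toEquiv q hq)),
        IsManifold ((𝓡 n).prod 𝓘(ℝ)) ∞ (MappingTorus φ.toEquiv q hq) ∧
        IsLocalDiffeomorph ((𝓡 n).prod 𝓘(ℝ)) ((𝓡 n).prod 𝓘(ℝ)) ∞
          (MappingTorus.proj φ.toEquiv q hq)) ∧
    -- with the smooth structure for which the projection is a local diffeomorphism,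
    -- the mapping torus carries the Hessian structure of Koszul type
    ∀ [ChartedSpace (ModelProd (EuclideanSpace ℝ (Fin n)) ℝ) (MappingTorus φ.toEquiv q hq)]
      [IsManifold ((𝓡 n).prod 𝓘(ℝ)) ∞ (MappingTorus φ.toEquiv q hq)],
      IsLocalDiffeomorph ((𝓡 n).prod 𝓘(ℝ)) ((𝓡 n).prod 𝓘(ℝ)) ∞
        (MappingTorus.proj φ.toEquiv q hq) →
      ∃ (nabla : AffineConnection ((𝓡 n).prod 𝓘(ℝ)) (MappingTorus φ.toEquiv q hq))
        (θ : Π x : MappingTorus φ.toEquiv q hq, TangentSpace ((𝓡 n).prod 𝓘(ℝ)) x →L[ℝ] ℝ)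
        (gK h : RiemMetric ((𝓡 n).prod 𝓘(ℝ)) (MappingTorus φ.toEquiv q hq))
        (ξ : Π x : MappingTorus φ.toEquiv q hq, TangentSpace ((𝓡 n).prod 𝓘(ℝ)) x),
        -- `θ` is the form induced by `-2 ds / s`
        (∀ (p : M × PosReal) (v : TangentSpace ((𝓡 n).prod 𝓘(ℝ)) p),
          θ (MappingTorus.proj φ.toEquiv q hq p)
            (mfderiv ((𝓡 n).prod 𝓘(ℝ)) ((𝓡 n).prod 𝓘(ℝ)) (MappingTorus.proj φ.toEquiv q hq) p v)
              = -2 * coneDs (𝓡 n) p v / (p.2 : ℝ)) ∧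
        -- `h` is the metric induced by `g + ds² / s²`
        (∀ (p : M × PosReal) (v w : TangentSpace ((𝓡 n).prod 𝓘(ℝ)) p),
          h.inner (MappingTorus.proj φ.toEquiv q hq p)
            (mfderiv ((𝓡 n).prod 𝓘(ℝ)) ((𝓡 n).prod 𝓘(ℝ)) (MappingTorus.proj φ.toEquiv q hq) p v)
            (mfderiv ((𝓡 n).prod 𝓘(ℝ)) ((𝓡 n).prod 𝓘(ℝ)) (MappingTorus.proj φ.toEquiv q hq) p w)
              = cylMetric g p v w) ∧
        -- `nabla` is the connection of the radiant l.c.H. structure with metric `h`, Lee form `θ`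
        -- and `nabla ξ = -2 λ Id`, where `λ` is the positive root of `λ (2 - λ) = c`
        IsRadiantLCH nabla h θ ξ (-2 * (1 + Real.sqrt (1 - c))) ∧
        -- `(nabla, nabla θ)` is a Hessian structure of Koszul type
        IsKoszulHessian nabla gK θ := by
  -- Needed for the Hausdorff property of the quotient.
  have : LocallyCompactSpace M := ChartedSpace.locallyCompactSpace (EuclideanSpace ℝ (Fin n)) M
  refine ⟨fun hq1 => mappingTorus_smooth_structure φ hq hq1, ?_⟩
  intro _ _ hloc
  exact exists_mappingTorus_structures φ hq hc hDg hφ hloc
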